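/- **Conventions.** A *computable metric space* is a complete metric space $(X,d)$ with a dense sequence $(s_i)_{i\in\mathbb N}$ of *ideal points* such that the reals $d(s_i,s_j)$ are computable uniformly in $(i,j)$. A *name* of $x\in X$ is a sequence of indices $(k_n)_n$ with $d(s_{k_n},s_{k_{n+1}})<2^{-n}$ for all $n$ and $s_{k_n}\to x$; a function $f:D\subseteq X\to Y$ between such spaces is *computable* if a recursive operator on $\mathbb N^{\mathbb N}$ sends every name of every $x\in D$ to a name of $f(x)$. An open set is *r.e.* if it is the union of a recursively enumerable family of balls $B(s_i,q)$ with $q\in\mathbb Q_{>0}$, and a *$\Pi^0_2$-set* is an intersection $\bigcap_n U_n$ of uniformly r.e. open sets. A Borel probability measure $\mu$ on $X$ is *computable* if it has a recursive name in the space of Borel probability measures with the Prokhorov metric, the ideal points being the measures supported on finitely many $s_i$ with rational weights; $(X,\mu)$ is then a *computable probability space*. The Cantor space $2^\omega$ carries the metric $2^{-\min\{n:\omega_n\ne\omega'_n\}}$ and the ideal points $w000\ldots$ A *$\mu$-randomness test* is a function $t:X\to[0,+\infty]$ with $\int t\,d\mu\le 1$ that is lower semicomputable from $\mu$ (some recursive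 operator sends each name of $\mu$ to an enumeration, possibly empty, of functions of the form $q\,1_{B(s_i,r)}$, $q,r\in\mathbb Q_{>0}$, with supremum $t$). A point $x$ is *$\mu$-random* if $t(x)<+\infty$ for every $\mu$-randomness test $t$. A *binary representation* of $(X,\mu)$ consists of a computable probability measure $\mu_\delta$ on $2^\omega$ and a surjective computable function $\delta:D_\delta\to X$, where $D_\delta\subseteq 2^\omega$ is a $\Pi^0_2$-set with $\mu_\delta(D_\delta)=1$ and $\mu(A)=\mu_\delta(\delta^{-1}(A))$ for all Borel $A\subseteq X$, together with a dense $\Pi^0_2$-set $D\subseteq X$ with $\mu(D)=1$ such that every $x\in D$ has exactly one *expansion* (element of $\delta^{-1}(x)$) and $\delta^{-1}:D\to 2^\omega$ is computable. Let $H$ be prefix Kolmogorov complexity: $H(w)$ is the length of a shortest $p$ with $U(p)=w$, where $U$ is a universal (additively optimal) partial recursive function on binary words with prefix-free domain. For $x\in D$ with expansion $\omega$ put $H_n(x)=H(\omega_0\ldots\omega_{n-1})$ and $\Gamma_n(x)=\delta([\omega_0\ldots\omega_{n-1}])=\{\delta(\omega'):\omega'\in D_\delta,\ \omega'_i=\omega_i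 \text{ for all } i<n\}$. **Statement.** Let $\delta$ be a binary representation, with set $D$ as above, of a computable probability space $(X,\mu)$ (not necessarily compact), and let $U$ be any universal prefix machine. Then a point $x\in X$ is $\mu$-random if and only if $x\in D$ and there is a real constant $c$ such that, for all $n\in\mathbb N$, $$H_n(x)\ \ge\ -\log_2 \mu(\Gamma_n(x)) - c ,$$ where $-\log_2 0=+\infty$. -/

import Mathlib

open MeasureTheory Filter Topology
open scoped ENNReal

noncomputable section

/-! ### Recursive functions and representations -/

/-- The word `σ₀ … σ_{n-1}`. -/
def initialWord {α : Type*} (σ : ℕ → α) (n : ℕ) : List α := (List.range n).map σ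

/-- A function on Baire space is recursive on `A` if on `A` it is the limit of a recursive
function on finite words that is monotone for the prefix order. -/
def RecursiveOn (F : (ℕ → ℕ) → (ℕ → ℕ)) (A : Set (ℕ → ℕ)) : Prop :=
  ∃ Φ : List ℕ → List ℕ, Computable Φ ∧ (∀ u v, u <+: v → Φ u <+: Φ v) ∧
    ∀ σ ∈ A, (∀ m, ∃ n, Φ (initialWord σ m) = initialWord (F σ) n) ∧
      ∀ n, ∃ m, initialWord (F σ) n <+: Φ (initialWord σ m)

/-- A partial map from Baire space to `X`, given by its graph: `ρ σ x` means that `σ` is in the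
domain and is sent to `x`. It represents the elements of its range. -/
abbrev NameRelation (X : Type*) := (ℕ → ℕ) → X → Prop

/-- `x` has a recursive name. -/
def Constructive {X : Type*} (ρ : NameRelation X) (x : X) : Prop :=
  ∃ σ : ℕ → ℕ, Computable σ ∧ ρ σ x

/-- The `x i` have names that are recursive uniformly in `i`. -/
def UniformlyConstructive {X : Type*} (ρ : NameRelation X) (x : ℕ → X) : Prop :=
  ∃ σ : ℕ → ℕ → ℕ, Computable₂ σ ∧ ∀ i, ρ (σ i) (x i)

/-- Some recursive function sends each name of each `x ∈ D` to a name of `f x`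
(the values of `f` outside `D` are irrelevant). -/
def ConstructiveOn {X Y : Type*} (ρX : NameRelation X) (ρY : NameRelation Y)
    (f : X → Y) (D : Set X) : Prop :=
  ∃ F : (ℕ → ℕ) → (ℕ → ℕ), RecursiveOn F {σ | ∃ x ∈ D, ρX σ x} ∧
    ∀ σ, ∀ x ∈ D, ρX σ x → ρY (F σ) (f x)

/-- `y` is `x`-constructive: it is the value at `x` of a function that is constructive
on `{x}`. -/
def ConstructiveFrom {X Y : Type*} (ρX : NameRelation X) (ρY : NameRelation Y)
    (x : X) (y : Y) : Prop :=
  ∃ f : X → Y, ConstructiveOn ρX ρY f {x} ∧ f x = y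

/-- The Cauchy representation: names of `x` are the fast sequences of ideal points converging
to `x`. -/
def cauchyRep {X : Type*} [PseudoMetricSpace X] (s : ℕ → X) : NameRelation X :=
  fun σ x => (∀ n, dist (s (σ n)) (s (σ (n + 1))) < (1 / 2 : ℝ) ^ n) ∧
    Tendsto (fun n => s (σ n)) atTop (𝓝 x)

/-- The representation of suprema of a numbered family in a complete lattice. The entry `k + 1`
of a name lists the object `p k`, the entry `0` lists nothing, so that the enumerated family may
be empty or finite. -/
def enumRep {L : Type*} [CompleteLattice L] (p : ℕ → L) : NameRelation L :=
  fun σ y => y = ⨆ (n : ℕ) (k : ℕ) (_ : σ n = k + 1), p k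

/-! ### Computable metric spaces -/

/-- The standard numbering of the rationals. -/
def ratNum (n : ℕ) : ℚ :=
  ((n.unpair.1 : ℚ) - n.unpair.2.unpair.1) / (n.unpair.2.unpair.2 + 1)

/-- The standard numbering of the positive rationals. -/
def posRatNum (n : ℕ) : ℚ := ((n.unpair.1 : ℚ) + 1) / (n.unpair.2 + 1)

/-- The canonical representation of the reals. -/
def realRep : NameRelation ℝ := cauchyRep fun n => (ratNum n : ℝ)

/-- `s` enumerates the ideal points of a computable metric space structure on `X`. -/
structure IsComputableMetricSpace {X : Type*} [MetricSpace X] (s : ℕ → X) : Prop where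
  complete : CompleteSpace X
  dense : DenseRange s
  dist_computable : UniformlyConstructive realRep
    fun n => dist (s n.unpair.1) (s n.unpair.2)

/-- The ideal ball `B_⟨i,j⟩ = B(s_i, q_j)`. -/
def idealBall {X : Type*} [MetricSpace X] (s : ℕ → X) (k : ℕ) : Set X :=
  Metric.ball (s k.unpair.1) (posRatNum k.unpair.2 : ℝ)

/-- The canonical representation of open sets, as unions of ideal balls. -/
def openRep {X : Type*} [MetricSpace X] (s : ℕ → X) : NameRelation (Set X) :=
  enumRep (idealBall s)

/-- Intersections of uniformly r.e. open sets. -/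
def IsPi02 {X : Type*} [MetricSpace X] (s : ℕ → X) (D : Set X) : Prop :=
  ∃ U : ℕ → Set X, UniformlyConstructive (openRep s) U ∧ D = ⋂ n, U n

/-- The step function `f_⟨i,j⟩`, equal to `q_j` on the ideal ball `B_i` and to `0` elsewhere. -/
def stepFunction {X : Type*} [MetricSpace X] (s : ℕ → X) (k : ℕ) : X → ℝ≥0∞ :=
  (idealBall s k.unpair.1).indicator fun _ => ENNReal.ofReal (posRatNum k.unpair.2 : ℝ)

/-- The canonical representation of nonnegative lower semicontinuous functions, as suprema of
step functions. -/
def lscRep {X : Type*} [MetricSpace X] (s : ℕ → X) : NameRelation (X → ℝ≥0∞) :=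
  enumRep (stepFunction s)

/-! ### Computable probability measures -/

/-- The `n`-th nonempty finite list of pairs (index of an ideal point, weight). -/
def weightList (n : ℕ) : List (ℕ × ℕ) :=
  let a := Denumerable.ofNat ((ℕ × ℕ) × List (ℕ × ℕ)) n
  a.1 :: a.2

/-- The mass of a list of pairs; the pair `(i, w)` has weight `w + 1`. -/
def totalWeight (l : List (ℕ × ℕ)) : ℝ≥0∞ := (l.map fun a => (a.2 + 1 : ℝ≥0∞)).sum

/-- The unnormalized sum of point masses. -/
def pointMasses {X : Type*} [MeasurableSpace X] (s : ℕ → X) (l : List (ℕ × ℕ)) : Measure X :=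
  (l.map fun a => (a.2 + 1 : ℝ≥0∞) • Measure.dirac (s a.1)).sum

theorem pointMasses_univ {X : Type*} [MeasurableSpace X] (s : ℕ → X) (l : List (ℕ × ℕ)) :
    pointMasses s l Set.univ = totalWeight l := by
  induction l with
  | nil => simp [pointMasses, totalWeight]
  | cons a l ih =>
    simp only [pointMasses, totalWeight, List.map_cons, List.sum_cons] at ih ⊢
    rw [Measure.add_apply, ih]
    simp

theorem totalWeight_ne_top (l : List (ℕ × ℕ)) : totalWeight l ≠ ∞ := by
  induction l with
  | nil => simp [totalWeight]
  | cons a l ih =>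
    simp only [totalWeight, List.map_cons, List.sum_cons] at ih ⊢
    exact ENNReal.add_ne_top.2 ⟨ENNReal.add_ne_top.2 ⟨ENNReal.natCast_ne_top _,
      ENNReal.one_ne_top⟩, ih⟩

theorem totalWeight_weightList_ne_zero (n : ℕ) : totalWeight (weightList n) ≠ 0 := by
  simp [totalWeight, weightList]

/-- The numbering of the ideal measures: the probability measures concentrated on finitely many
ideal points and giving them rational weights. -/
def idealMeasure {X : Type*} [MeasurableSpace X] (s : ℕ → X) (n : ℕ) : ProbabilityMeasure X :=
  ⟨(totalWeight (weightList n))⁻¹ • pointMasses s (weightList n), ⟨by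
    rw [Measure.smul_apply, pointMasses_univ, smul_eq_mul]
    exact ENNReal.inv_mul_cancel (totalWeight_weightList_ne_zero n) (totalWeight_ne_top _)⟩⟩

/-- The Cauchy representation of Borel probability measures, for the Prokhorov metric and the
ideal measures. -/
def measureRep {X : Type*} [MetricSpace X] [MeasurableSpace X] [BorelSpace X] (s : ℕ → X) :
    NameRelation (LevyProkhorov (ProbabilityMeasure X)) :=
  cauchyRep fun n => LevyProkhorov.ofMeasure (idealMeasure s n)

/-- Computable probability measures. -/
def IsComputableMeasure {X : Type*} [MetricSpace X] [MeasurableSpace X] [BorelSpace X]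
    (s : ℕ → X) (μ : ProbabilityMeasure X) : Prop :=
  Constructive (measureRep s) (LevyProkhorov.ofMeasure μ)

/-- Computable probability spaces. -/
structure IsComputableProbabilitySpace {X : Type*} [MetricSpace X] [MeasurableSpace X]
    [BorelSpace X] (s : ℕ → X) (μ : ProbabilityMeasure X) : Prop where
  space : IsComputableMetricSpace s
  measure : IsComputableMeasure s μ

/-- `F : D ⊆ X → Y` is a morphism of computable probability spaces (the values of `F` outside
`D` are irrelevant). -/
structure IsMorphism {X Y : Type*} [MetricSpace X] [MeasurableSpace X] [BorelSpace X]
    [MetricSpace Y] [MeasurableSpace Y] [BorelSpace Y] (sX : ℕ → X) (μ : ProbabilityMeasure X)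
    (sY : ℕ → Y) (ν : ProbabilityMeasure Y) (F : X → Y) (D : Set X) : Prop where
  pi02 : IsPi02 sX D
  full : (μ : Measure X) D = 1
  computable : ConstructiveOn (cauchyRep sX) (cauchyRep sY) F D
  preserving : ∀ A : Set Y, MeasurableSet A →
    (ν : Measure Y) A = (μ : Measure X) (D ∩ F ⁻¹' A)

/-! ### Randomness -/

/-- `t` is a `μ`-randomness test. -/
def IsRandomnessTest {X : Type*} [MetricSpace X] [MeasurableSpace X] [BorelSpace X]
    (s : ℕ → X) (μ : ProbabilityMeasure X) (t : X → ℝ≥0∞) : Prop :=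
  ConstructiveFrom (measureRep s) (lscRep s) (LevyProkhorov.ofMeasure μ) t ∧
    ∫⁻ x, t x ∂(μ : Measure X) ≤ 1

/-- `N` is a `μ`-effective null set. -/
def IsEffectiveNull {X : Type*} [MetricSpace X] [MeasurableSpace X] [BorelSpace X]
    (s : ℕ → X) (μ : ProbabilityMeasure X) (N : Set X) : Prop :=
  ∃ t, IsRandomnessTest s μ t ∧ N ⊆ {x | t x = ∞}

/-- `x` is `μ`-random: it lies in no `μ`-effective null set. -/
def IsRandom {X : Type*} [MetricSpace X] [MeasurableSpace X] [BorelSpace X]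
    (s : ℕ → X) (μ : ProbabilityMeasure X) (x : X) : Prop :=
  ∀ N : Set X, IsEffectiveNull s μ N → x ∉ N

/-! ### Cantor space and binary representations -/

/-- Cantor space carries the metric `d(ω, ω') = 2 ^ (-min {n | ω_n ≠ ω'_n})`. -/
instance cantorMetricSpace : MetricSpace (ℕ → Bool) :=
  PiNat.metricSpaceOfDiscreteUniformity fun _ => rfl

/-- The ideal points `w000…` of Cantor space: the binary digits of `n`, lowest first. -/
def cantorIdeal (n : ℕ) : ℕ → Bool := fun i => n.testBit i

/-- A binary representation `(δ, μ_δ)` of `(X, μ)`: the partial map `δ` is `toFun` on `dom`, and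
`D` is a dense full-measure `Π⁰₂` set of points with a unique expansion on which the inverse
of `δ` is computable. -/
structure BinaryRepresentation {X : Type*} [MetricSpace X] [MeasurableSpace X] [BorelSpace X]
    (s : ℕ → X) (μ : ProbabilityMeasure X) where
  measure : ProbabilityMeasure (ℕ → Bool)
  measure_computable : IsComputableMeasure cantorIdeal measure
  toFun : (ℕ → Bool) → X
  dom : Set (ℕ → Bool)
  morphism : IsMorphism cantorIdeal measure s μ toFun dom
  surjective : Set.SurjOn toFun dom Set.univ
  D : Set X
  dense_D : Dense D
  full_D : (μ : Measure X) D = 1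
  pi02_D : IsPi02 s D
  unique : ∀ x ∈ D, ∃! ω, ω ∈ dom ∧ toFun ω = x
  inverse_computable :
    ConstructiveOn (cauchyRep s) (cauchyRep cantorIdeal) (Function.invFunOn toFun dom) D

/-! ### Prefix complexity -/

/-- A partial recursive function on binary words with prefix-free domain. -/
def IsPrefixMachine (M : List Bool →. List Bool) : Prop :=
  Partrec M ∧ ∀ p ∈ M.Dom, ∀ q ∈ M.Dom, p <+: q → p = q

/-- A prefix machine that simulates every prefix machine up to an additive constant in the
length of programs. -/
def IsUniversalPrefixMachine (U : List Bool →. List Bool) : Prop :=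
  IsPrefixMachine U ∧ ∀ M, IsPrefixMachine M →
    ∃ c : ℕ, ∀ p w, w ∈ M p → ∃ q, w ∈ U q ∧ q.length ≤ p.length + c

/-- Comparability for the prefix order. -/
def comparableWords (x y : List Bool) : Bool := decide (x.take y.length = y.take x.length)

theorem comparableWords_iff (x y : List Bool) :
    comparableWords x y = true ↔ x <+: y ∨ y <+: x := by
  rw [comparableWords, decide_eq_true_iff]
  constructor
  · intro h
    rcases le_total x.length y.length with hl | hl
    · left
      rw [List.take_of_length_le hl] at h
      exact h ▸ List.take_prefix _ _
    · right
      rw [List.take_of_length_le hl] at h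
      exact h ▸ List.take_prefix _ _
  · rintro (⟨z, rfl⟩ | ⟨z, rfl⟩) <;> simp

/-- The `t`-th attempt, for `t = ⟨e, ⟨n, k⟩⟩`: if the program `e` halts within bound `n` on the
input `k` that codes the word `q`, the word `1^e 0 q` and the output. -/
def machineAttempt (t : ℕ) : Option (List Bool × ℕ) :=
  (Encodable.decode (α := List Bool) t.unpair.2.unpair.2).bind fun q =>
    (Nat.Partrec.Code.evaln t.unpair.2.unpair.1
      (Denumerable.ofNat Nat.Partrec.Code t.unpair.1) t.unpair.2.unpair.2).map fun y =>
        ((List.range t.unpair.1).map (fun _ => true) ++ false :: q, y)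

/-- Search for the first successful attempt whose word is comparable with the input, and answer
if this word is the input. -/
def universalMachine : List Bool →. List Bool := fun x =>
  (Nat.rfind fun t => Part.some
    (((machineAttempt t).map fun r => comparableWords r.1 x).getD false)).bind fun t =>
      (((machineAttempt t).bind fun r =>
        bif decide (r.1 = x) then Encodable.decode (α := List Bool) r.2 else none :
          Option (List Bool)) : Part (List Bool))

theorem machineAttempt_primrec : Primrec machineAttempt := by
  have h2 : Primrec fun t : ℕ => t.unpair.2 := Primrec.snd.comp Primrec.unpair
  have h1 : Primrec fun t : ℕ => t.unpair.1 := Primrec.fst.comp Primrec.unpair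
  have h22 : Primrec fun t : ℕ => t.unpair.2.unpair.2 := h2.comp h2
  have h21 : Primrec fun t : ℕ => t.unpair.2.unpair.1 := h1.comp h2
  refine Primrec.option_bind (Primrec.decode.comp h22) ?_
  refine Primrec.option_map (f := fun a : ℕ × List Bool => Nat.Partrec.Code.evaln
    a.1.unpair.2.unpair.1 (Denumerable.ofNat Nat.Partrec.Code a.1.unpair.1)
      a.1.unpair.2.unpair.2) ?_ ?_
  · exact Nat.Partrec.Code.primrec_evaln.comp
      (((h21.comp Primrec.fst).pair ((Primrec.ofNat _).comp (h1.comp Primrec.fst))).pair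
        (h22.comp Primrec.fst))
  · refine Primrec.pair (Primrec.list_append.comp ?_ ?_) Primrec.snd
    · exact Primrec.list_map (Primrec.list_range.comp
        (h1.comp (Primrec.fst.comp Primrec.fst))) (Primrec.const true).to₂
    · exact Primrec.list_cons.comp (Primrec.const false) (Primrec.snd.comp Primrec.fst)

theorem comparableWords_primrec : Primrec₂ comparableWords := by
  have : PrimrecRel fun x y : List Bool => x.take y.length = y.take x.length :=
    Primrec.eq.comp₂
      (Primrec.list_take.comp (Primrec.list_length.comp Primrec.snd) Primrec.fst)
      (Primrec.list_take.comp (Primrec.list_length.comp Primrec.fst) Primrec.snd)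
  exact this.decide

theorem universalMachine_partrec : Partrec universalMachine := by
  refine Partrec.bind (Partrec.rfind ?_) ?_
  · refine Computable.partrec (Primrec.to_comp ?_)
    refine Primrec.option_getD.comp (Primrec.option_map
      (machineAttempt_primrec.comp Primrec.snd) ?_) (Primrec.const false)
    exact comparableWords_primrec.comp (Primrec.fst.comp Primrec.snd)
      (Primrec.fst.comp Primrec.fst)
  · refine Computable.ofOption (Primrec.to_comp ?_)
    refine Primrec.option_bind (machineAttempt_primrec.comp Primrec.snd) ?_
    refine Primrec.cond (Primrec.eq.decide.comp (Primrec.fst.comp Primrec.snd)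
      (Primrec.fst.comp Primrec.fst)) (Primrec.decode.comp (Primrec.snd.comp Primrec.snd))
      (Primrec.const none)

theorem mem_universalMachine {x w : List Bool} : w ∈ universalMachine x ↔
    ∃ t y, machineAttempt t = some (x, y) ∧ Encodable.decode (α := List Bool) y = some w ∧
      ∀ t' < t, ∀ r, machineAttempt t' = some r → comparableWords r.1 x = false := by
  simp only [universalMachine, Part.mem_bind_iff, Part.mem_ofOption, Option.mem_def, Option.bind_eq_some_iff]
  constructor
  · rintro ⟨t, hfind, ⟨r, y⟩, hr, hw⟩
    obtain ⟨-, ht⟩ := Nat.mem_rfind.1 hfind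
    by_cases hx : r = x
    · subst hx
      refine ⟨t, y, hr, by simpa using hw, fun t' ht' r' hr' => ?_⟩
      have := Part.mem_some_iff.1 (ht ht')
      rw [hr'] at this
      simpa using this.symm
    · simp [hx] at hw
  · rintro ⟨t, y, hr, hw, ht⟩
    refine ⟨t, Nat.mem_rfind.2 ⟨Part.mem_some_iff.2 ?_, fun {m} hm =>
      Part.mem_some_iff.2 ?_⟩, (x, y), hr, by simpa using hw⟩
    · simp [hr, comparableWords]
    · cases h : machineAttempt m with
      | none => rfl
      | some r => simpa using (ht m hm r h).symm

theorem universalMachine_isUniversal : IsUniversalPrefixMachine universalMachine := by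
  refine ⟨⟨universalMachine_partrec, fun p hp q hq hpq => ?_⟩, fun M hM => ?_⟩
  · obtain ⟨w, hw⟩ := Part.dom_iff_mem.1 hp
    obtain ⟨v, hv⟩ := Part.dom_iff_mem.1 hq
    obtain ⟨t, y, ht, -, hlt⟩ := mem_universalMachine.1 hw
    obtain ⟨t', y', ht', -, hlt'⟩ := mem_universalMachine.1 hv
    rcases lt_trichotomy t t' with h | h | h
    · have := hlt' t h _ ht
      rw [(comparableWords_iff _ _).2 (Or.inl hpq)] at this
      cases this
    · subst h
      rw [ht] at ht'
      simpa using congrArg (fun o => o.map Prod.fst) ht'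
    · have := hlt t' h _ ht'
      rw [(comparableWords_iff _ _).2 (Or.inr hpq)] at this
      cases this
  · obtain ⟨c, hc⟩ := Nat.Partrec.Code.exists_code.1 hM.1
    have hev : ∀ k y, y ∈ c.eval k ↔ ∃ q w, Encodable.decode (α := List Bool) k = some q ∧
        w ∈ M q ∧ Encodable.encode w = y := by
      intro k y
      rw [hc]
      simp [Part.mem_bind_iff]
    refine ⟨Encodable.encode c + 1, fun p w hw => ?_⟩
    let code : List Bool → List Bool := fun q =>
      (List.range (Encodable.encode c)).map (fun _ => true) ++ false :: q
    have hpre : ∀ e q, (List.range e).map (fun _ => true) ++ false :: q =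
        List.replicate e true ++ false :: q := by
      intro e q
      congr 1
      exact List.ext_getElem (by simp) (by simp)
    have hcmp : ∀ e e' : ℕ, ∀ q q' : List Bool,
        List.replicate e true ++ false :: q <+: List.replicate e' true ++ false :: q' →
          e = e' ∧ q <+: q' := by
      intro e
      induction e with
      | zero =>
        intro e' q q' h
        cases e' with
        | zero => simpa using h
        | succ e' => simp [List.replicate_succ, List.cons_prefix_cons] at h
      | succ e ih =>
        intro e' q q' h
        cases e' with
        | zero => simp [List.replicate_succ, List.cons_prefix_cons] at h
        | succ e' =>
          simp only [List.replicate_succ, List.cons_append, List.cons_prefix_cons, true_and] at h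
          obtain ⟨h1, h2⟩ := ih e' q q' h
          exact ⟨by rw [h1], h2⟩
    -- every successful attempt comparable with the code word of `p` is for `p` itself
    have huniq : ∀ t r, machineAttempt t = some r → comparableWords r.1 (code p) = true →
        r.1 = code p ∧ Encodable.decode (α := List Bool) r.2 = some w := by
      rintro t ⟨x, y⟩ ht hcp
      simp only [machineAttempt, Option.bind_eq_some_iff, Option.map_eq_some_iff,
        Prod.mk.injEq] at ht
      obtain ⟨q, hq, y', hy', hx, rfl⟩ := ht
      rw [comparableWords_iff, ← hx, hpre] at hcp
      simp only [code, hpre] at hcp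
      have heq : t.unpair.1 = Encodable.encode c ∧ (q <+: p ∨ p <+: q) := by
        rcases hcp with h | h
        · obtain ⟨h1, h2⟩ := hcmp _ _ _ _ h
          exact ⟨h1, Or.inl h2⟩
        · obtain ⟨h1, h2⟩ := hcmp _ _ _ _ h
          exact ⟨h1.symm, Or.inr h2⟩
      obtain ⟨he, hqp⟩ := heq
      rw [he, Denumerable.ofNat_encode] at hy'
      obtain ⟨q', v, hq', hv, hvy⟩ := (hev _ _).1 (Nat.Partrec.Code.evaln_sound hy')
      rw [hq] at hq'
      cases hq'
      have hqd : q ∈ M.Dom := Part.dom_iff_mem.2 ⟨v, hv⟩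
      have hpd : p ∈ M.Dom := Part.dom_iff_mem.2 ⟨w, hw⟩
      have hqp' : q = p := by
        rcases hqp with h | h
        · exact hM.2 q hqd p hpd h
        · exact (hM.2 p hpd q hqd h).symm
      subst hqp'
      have := Part.mem_unique hv hw
      subst this
      refine ⟨?_, ?_⟩
      · rw [← hx]
        simp only [code, he]
      · simp [← hvy]
    obtain ⟨n, hn⟩ := Nat.Partrec.Code.evaln_complete.1
      ((hev (Encodable.encode p) (Encodable.encode w)).2 ⟨p, w, by simp, hw, rfl⟩)
    have hex : ∃ t r, machineAttempt t = some r ∧ comparableWords r.1 (code p) = true := by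
      refine ⟨Nat.pair (Encodable.encode c) (Nat.pair n (Encodable.encode p)),
        (code p, Encodable.encode w), ?_, by simp [comparableWords]⟩
      simp only [machineAttempt, Nat.unpair_pair, Encodable.encodek, Option.bind_some,
        Denumerable.ofNat_encode, Option.mem_def.1 hn, Option.map_some, code]
    classical
    obtain ⟨r, hr, hrc⟩ := Nat.find_spec hex
    obtain ⟨h1, h2⟩ := huniq _ _ hr hrc
    refine ⟨code p, mem_universalMachine.2 ⟨Nat.find hex, r.2, ?_, h2, ?_⟩, ?_⟩
    · rw [hr, ← h1]
    · intro t' ht' r' hr'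
      by_contra hne
      exact Nat.find_min hex ht' ⟨r', hr', by simpa using hne⟩
    · simp [code]
      omega

/-- The complexity of `w` with respect to `U`: the length of a shortest program for `w`. For
universal `U` every word has a program, so the minimum exists. -/
def complexity (U : List Bool →. List Bool) (w : List Bool) : ℕ :=
  sInf {k | ∃ p, w ∈ U p ∧ p.length = k}

/-- The base-two logarithm, with `log 0 = -∞`. -/
def log2 (a : ℝ≥0∞) : EReal := ENNReal.log a / (Real.log 2 : ℝ)

namespace BinaryRepresentation

variable {X : Type*} [MetricSpace X] [MeasurableSpace X] [BorelSpace X]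
  {s : ℕ → X} {μ : ProbabilityMeasure X}

/-- An expansion of `x`; for `x ∈ D` it is the only one. -/
def expansion (δ : BinaryRepresentation s μ) (x : X) : ℕ → Bool :=
  Function.invFunOn δ.toFun δ.dom x

/-- `H_n(x) = H(ω_{0..n-1})`, for `ω` the expansion of `x` and `H` the complexity with respect
to `U`. -/
def pointComplexity (δ : BinaryRepresentation s μ) (U : List Bool →. List Bool) (x : X) (n : ℕ) :
    ℕ :=
  complexity U (initialWord (δ.expansion x) n)

/-- `Γ_n(x) = δ([ω_{0..n-1}])`, for `ω` the expansion of `x`. -/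
def cell (δ : BinaryRepresentation s μ) (x : X) (n : ℕ) : Set X :=
  δ.toFun '' (δ.dom ∩ PiNat.cylinder (δ.expansion x) n)

end BinaryRepresentation

end

/-!
Write `ω` for the expansion of `x` and `[w]` for the cylinder of a word `w`. Since `δ` is invertible
on a set of full measure, `μ (Γ_n(x))` is the measure `μ_δ [ω₀…ω_{n-1}]`, and the claim compares
this measure with the length of a shortest program for `ω₀…ω_{n-1}`.

A random point lies in every r.e. open set `G` of full measure, hence in `D`: the points far from a
finite union of slightly shrunk balls of `G` form an r.e. open neighbourhood of the complement of
`G`, and its measure can be made effectively small because `μ` of the shrunk union can be bounded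
from below. At a random point of `D` the lower bound on complexity follows from the test
`t y = ∑ 2^(-|p|) / μ_δ [U p]`, summed over the programs `p` for which the expansion of `y` begins
with `U p`: by Kraft's inequality its integral is at most `1`.

Conversely, let `t x = ∞` for a test `t`. The set `t > 4^m` has measure at most `4^(-m)`, and its
preimage under `δ` is covered by the cylinders of a prefix-free r.e. set of words. Since
`∑ 2^m 4^(-m)` converges, the Kraft–Chaitin theorem provides, for every word `w` in the `m`-th set,
a program of length about `-log₂ μ_δ [w] - m`; some prefix of `ω` belongs to each of these sets, so
the lower bound on complexity fails at `x`.
-/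

noncomputable section

/-! ### Computable functions and recursively enumerable predicates -/

attribute [fun_prop] Computable
attribute [fun_prop] Computable.id Computable.const Computable.comp Computable.pair Computable.fst
  Computable.snd Computable.unpair Computable.encode Computable.decode Computable.cond
  Computable.option_some Computable.option_getD Computable.list_length

section ClosureProperties

variable {α β γ : Type*} [Primcodable α] [Primcodable β] [Primcodable γ]

/-- Types on which addition is computable, so that `fun_prop` can treat `ℕ` and `ℚ` alike. -/
class ComputableAdd (M : Type*) [Primcodable M] [Add M] : Prop where
  add : Computable fun p : M × M => p.1 + p.2

/-- Types on which subtraction is computable; on `ℕ` it is truncated. -/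
class ComputableSub (M : Type*) [Primcodable M] [Sub M] : Prop where
  sub : Computable fun p : M × M => p.1 - p.2

/-- Types on which multiplication is computable. -/
class ComputableMul (M : Type*) [Primcodable M] [Mul M] : Prop where
  mul : Computable fun p : M × M => p.1 * p.2

attribute [fun_prop] ComputableAdd.add ComputableSub.sub ComputableMul.mul

instance : ComputableAdd ℕ := ⟨Primrec.nat_add.to_comp⟩

instance : ComputableSub ℕ := ⟨Primrec.nat_sub.to_comp⟩

instance : ComputableMul ℕ := ⟨Primrec.nat_mul.to_comp⟩

@[fun_prop]
theorem computable_nat_div : Computable fun p : ℕ × ℕ => p.1 / p.2 := Primrec.nat_div.to_comp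

@[fun_prop]
theorem computable_nat_mod : Computable fun p : ℕ × ℕ => p.1 % p.2 := Primrec.nat_mod.to_comp

@[fun_prop]
theorem computable_nat_pair : Computable fun p : ℕ × ℕ => Nat.pair p.1 p.2 :=
  Primrec₂.natPair.to_comp

@[fun_prop]
theorem computable_and : Computable fun p : Bool × Bool => p.1 && p.2 := Primrec.and.to_comp

@[fun_prop]
theorem computable_or : Computable fun p : Bool × Bool => p.1 || p.2 := Primrec.or.to_comp

@[fun_prop]
theorem computable_not : Computable fun b : Bool => !b := Primrec.not.to_comp

@[fun_prop]
theorem computable_isSome : Computable fun o : Option α => o.isSome :=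
  Primrec.option_isSome.to_comp

@[fun_prop]
theorem computable_getElem? : Computable fun p : List α × ℕ => p.1[p.2]? :=
  Computable.list_getElem?

@[fun_prop]
theorem computable_take : Computable fun p : ℕ × List α => p.2.take p.1 :=
  Primrec.list_take.to_comp

@[fun_prop]
theorem computable_cons : Computable fun p : α × List α => p.1 :: p.2 := Computable.list_cons

@[fun_prop]
theorem computable_append : Computable fun p : List α × List α => p.1 ++ p.2 :=
  Computable.list_append

theorem computable_decide_nat_lt {f g : α → ℕ} (hf : Computable f) (hg : Computable g) :
    Computable fun a => decide (f a < g a) := Primrec.nat_lt.decide.to_comp.comp hf hg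

theorem computable_decide_eq [DecidableEq β] {f g : α → β} (hf : Computable f)
    (hg : Computable g) : Computable fun a => decide (f a = g a) :=
  Primrec.eq.decide.to_comp.comp hf hg

theorem computable_decide_and {p q : α → Prop} [DecidablePred p] [DecidablePred q]
    (hp : Computable fun a => decide (p a)) (hq : Computable fun a => decide (q a)) :
    Computable fun a => decide (p a ∧ q a) := by
  simp only [Bool.decide_and]
  fun_prop

theorem computable_option_map {f : α → Option β} {g : α × β → γ} (hf : Computable f)
    (hg : Computable g) : Computable fun a => (f a).map fun b => g (a, b) :=
  Computable.option_map hf hg.to₂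

theorem computable_option_bind {f : α → Option β} {g : α × β → Option γ} (hf : Computable f)
    (hg : Computable g) : Computable fun a => (f a).bind fun b => g (a, b) :=
  Computable.option_bind hf hg.to₂

theorem computable_nat_rec {n : α → ℕ} {z : α → β} {h : α × ℕ × β → β} (hn : Computable n)
    (hz : Computable z) (hh : Computable h) :
    Computable fun a => Nat.rec (motive := fun _ => β) (z a) (fun i r => h (a, i, r)) (n a) :=
  Computable.nat_rec hn hz (h := fun a p => h (a, p)) hh.to₂

theorem computable_decide_forall_lt {n : α → ℕ} {f : α × ℕ → Bool} (hn : Computable n)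
    (hf : Computable f) : Computable fun a => decide (∀ i < n a, f (a, i) = true) := by
  refine (computable_nat_rec (h := fun p : α × ℕ × Bool => p.2.2 && f (p.1, p.2.1))
    hn (Computable.const true) (by fun_prop)).of_eq fun a => ?_
  induction n a with
  | zero => simp
  | succ n ih =>
    simp only [ih, Nat.forall_lt_succ_right, Bool.decide_and, Bool.decide_eq_true]

theorem computable_sum_range {M : Type*} [AddCommMonoid M] [Primcodable M] [ComputableAdd M]
    {n : α → ℕ} {f : α × ℕ → M} (hn : Computable n) (hf : Computable f) :
    Computable fun a => ∑ i ∈ Finset.range (n a), f (a, i) := by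
  refine (computable_nat_rec (h := fun p : α × ℕ × M => p.2.2 + f (p.1, p.2.1))
    hn (Computable.const 0) (by fun_prop)).of_eq fun a => ?_
  induction n a with
  | zero => simp
  | succ n ih => simp only [ih, Finset.sum_range_succ]

@[fun_prop]
theorem computable_pow {M : Type*} [Monoid M] [Primcodable M] [ComputableMul M] :
    Computable fun p : M × ℕ => p.1 ^ p.2 := by
  refine (computable_nat_rec (h := fun q : (M × ℕ) × ℕ × M => q.2.2 * q.1.1)
    Computable.snd (Computable.const 1) (by fun_prop)).of_eq fun p => ?_
  induction p.2 with
  | zero => simp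
  | succ n ih => simp only [ih, pow_succ]

theorem computable_map_range {n : α → ℕ} {f : α × ℕ → β} (hn : Computable n)
    (hf : Computable f) : Computable fun a => (List.range (n a)).map fun i => f (a, i) := by
  refine (computable_nat_rec (h := fun p : α × ℕ × List β => p.2.2 ++ [f (p.1, p.2.1)])
    hn (Computable.const []) (by fun_prop)).of_eq fun a => ?_
  induction n a with
  | zero => simp
  | succ n ih => simp only [ih, List.range_succ, List.map_append, List.map_cons, List.map_nil]

end ClosureProperties

section REPredicates

variable {α β : Type*} [Primcodable α] [Primcodable β] {p q : α → Prop}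

theorem rePred_iff_exists_stage :
    REPred p ↔ ∃ f : α × ℕ → Bool, Computable f ∧ ∀ a, p a ↔ ∃ n, f (a, n) = true := by
  constructor
  · intro h
    obtain ⟨c, hc⟩ := Nat.Partrec.Code.exists_code.1 h
    refine ⟨fun q => (Nat.Partrec.Code.evaln q.2 c (Encodable.encode q.1)).isSome, ?_, fun a => ?_⟩
    · have hevaln : Computable fun q : α × ℕ =>
          Nat.Partrec.Code.evaln q.2 c (Encodable.encode q.1) :=
        Nat.Partrec.Code.primrec_evaln.to_comp.comp
          (g := fun q : α × ℕ => ((q.2, c), Encodable.encode q.1)) (by fun_prop)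
      fun_prop
    · have hdom : p a ↔ (c.eval (Encodable.encode a)).Dom := by
        rw [hc]
        simp [Part.dom_iff_mem]
      simp only [hdom, Part.dom_iff_mem, Nat.Partrec.Code.evaln_complete,
        Option.isSome_iff_exists, Option.mem_def]
      exact exists_comm
  · rintro ⟨f, hf, hp⟩
    have hsearch : Partrec fun a => Nat.rfind fun n => Part.some (f (a, n)) :=
      Partrec.rfind hf.to₂.partrec₂
    refine hsearch.dom_re.of_eq fun a => ?_
    rw [hp]
    refine Nat.rfind_dom.trans ?_
    simp only [Part.mem_some_iff, Part.some_dom, implies_true, and_true]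
    exact exists_congr fun _ => eq_comm

theorem exists_unique_stage_of_rePred (hp : REPred p) :
    ∃ f : α × ℕ → Bool, Computable f ∧ (∀ a, p a ↔ ∃ n, f (a, n) = true) ∧
      ∀ a m n, f (a, m) = true → f (a, n) = true → m = n := by
  obtain ⟨f, hf, hfp⟩ := rePred_iff_exists_stage.1 hp
  have hfirst : Computable fun q : α × ℕ => decide (∀ i < q.2, (!f (q.1, i)) = true) :=
    computable_decide_forall_lt (α := α × ℕ) (f := fun r => !f (r.1.1, r.2))
      (by fun_prop) (by fun_prop)
  refine ⟨fun q => f q && decide (∀ i < q.2, (!f (q.1, i)) = true), by fun_prop,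
    fun a => ?_, fun a m n hm hn => ?_⟩
  · simp only [hfp, Bool.and_eq_true, decide_eq_true_eq, Bool.not_eq_true', ← Bool.not_eq_true]
    classical
    exact ⟨fun h => ⟨Nat.find h, Nat.find_spec h, fun i => Nat.find_min h⟩,
      fun ⟨n, hn, _⟩ => ⟨n, hn⟩⟩
  · simp only [Bool.and_eq_true, decide_eq_true_eq, Bool.not_eq_true', ← Bool.not_eq_true]
      at hm hn
    exact le_antisymm (not_lt.1 fun h => hm.2 n h hn.1) (not_lt.1 fun h => hn.2 m h hm.1)

theorem rePred_of_computable_decide [DecidablePred p] (h : Computable fun a => decide (p a)) :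
    REPred p := ComputablePred.to_re ⟨inferInstance, h⟩

theorem rePred_eq_true {f : α → Bool} (h : Computable f) : REPred fun a => f a = true :=
  rePred_of_computable_decide (by simpa using h)

theorem rePred_eq {f g : α → β} (hf : Computable f) (hg : Computable g) :
    REPred fun a => f a = g a := by
  classical
  exact rePred_of_computable_decide (computable_decide_eq hf hg)

theorem rePred_ne {f g : α → β} (hf : Computable f) (hg : Computable g) :
    REPred fun a => f a ≠ g a := by
  classical
  have h := computable_decide_eq hf hg
  exact rePred_of_computable_decide ((show Computable fun a => !decide (f a = g a) by
    fun_prop).of_eq fun a => decide_not.symm)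

theorem rePred_nat_lt {f g : α → ℕ} (hf : Computable f) (hg : Computable g) :
    REPred fun a => f a < g a := rePred_of_computable_decide (computable_decide_nat_lt hf hg)

theorem rePred_comp {p : β → Prop} (hp : REPred p) {f : α → β} (hf : Computable f) :
    REPred fun a => p (f a) := Partrec.comp hp hf

theorem rePred_and (hp : REPred p) (hq : REPred q) : REPred fun a => p a ∧ q a := by
  have hpq : Partrec fun a => (Part.assert (p a) fun _ => Part.some ()).bind fun _ =>
      Part.assert (q a) fun _ => Part.some () :=
    Partrec.bind hp (Partrec.comp hq Computable.fst)
  refine hpq.dom_re.of_eq fun a => ?_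
  simp [Part.dom_iff_mem]

theorem rePred_or (hp : REPred p) (hq : REPred q) : REPred fun a => p a ∨ q a := by
  obtain ⟨f, hf, hfp⟩ := rePred_iff_exists_stage.1 hp
  obtain ⟨g, hg, hgq⟩ := rePred_iff_exists_stage.1 hq
  refine rePred_iff_exists_stage.2 ⟨fun r => f r || g r, by fun_prop, fun a => ?_⟩
  simp only [hfp, hgq, Bool.or_eq_true, exists_or]

theorem rePred_exists {p : α × β → Prop} (hp : REPred p) : REPred fun a => ∃ b, p (a, b) := by
  obtain ⟨f, hf, hfp⟩ := rePred_iff_exists_stage.1 hp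
  have hmap := computable_option_map (f := fun q : α × ℕ => Encodable.decode (α := β) q.2.unpair.1)
    (g := fun r => f ((r.1.1, r.2), r.1.2.unpair.2)) (by fun_prop) (by fun_prop)
  refine rePred_iff_exists_stage.2 ⟨fun q => ((Encodable.decode (α := β) q.2.unpair.1).map
    fun b => f ((q.1, b), q.2.unpair.2)).getD false, by fun_prop, fun a => ⟨?_, ?_⟩⟩
  · rintro ⟨b, hb⟩
    obtain ⟨n, hn⟩ := (hfp _).1 hb
    exact ⟨Nat.pair (Encodable.encode b) n, by simpa using hn⟩
  · rintro ⟨n, hn⟩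
    cases hd : Encodable.decode (α := β) n.unpair.1 with
    | none => simp [hd] at hn
    | some b => exact ⟨b, (hfp _).2 ⟨n.unpair.2, by simpa [hd] using hn⟩⟩

theorem rePred_exists_mem {l : α → List β} (hl : Computable l) {p : α × β → Prop}
    (hp : REPred p) : REPred fun a => ∃ b ∈ l a, p (a, b) := by
  have h : REPred fun r : (α × β) × ℕ => (l r.1.1)[r.2]? = some r.1.2 ∧ p (r.1.1, r.1.2) :=
    rePred_and (rePred_eq (by fun_prop) (by fun_prop)) (rePred_comp hp (by fun_prop))
  refine (rePred_exists (rePred_exists h)).of_eq fun a => ?_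
  simp only [exists_and_right, List.mem_iff_getElem?]

theorem rePred_forall_lt {n : α → ℕ} (hn : Computable n) {p : α × ℕ → Prop} (hp : REPred p) :
    REPred fun a => ∀ i < n a, p (a, i) := by
  obtain ⟨f, hf, hfp⟩ := rePred_iff_exists_stage.1 hp
  -- The existential quantifiers over stages are collected into one list of stages.
  have hstages : REPred fun q : α × List ℕ => ∀ i < n q.1, f ((q.1, i), q.2[i]?.getD 0) = true :=
    rePred_of_computable_decide (computable_decide_forall_lt (α := α × List ℕ)
      (f := fun r => f ((r.1.1, r.2), r.1.2[r.2]?.getD 0)) (by fun_prop) (by fun_prop))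
  refine (rePred_exists hstages).of_eq fun a => ⟨?_, fun ha => ?_⟩
  · rintro ⟨l, hl⟩ i hi
    exact (hfp _).2 ⟨_, hl i hi⟩
  · have hex : ∀ i, ∃ t, i < n a → f ((a, i), t) = true := fun i => by
      by_cases hi : i < n a
      · exact ((hfp _).1 (ha i hi)).imp fun _ ht _ => ht
      · exact ⟨0, fun h => (hi h).elim⟩
    choose t ht using hex
    exact ⟨(List.range (n a)).map t, fun i hi => by simpa [hi] using ht i hi⟩

theorem rePred_forall_mem {l : α → List β} (hl : Computable l) {p : α × β → Prop}
    (hp : REPred p) : REPred fun a => ∀ b ∈ l a, p (a, b) := by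
  have hentry : REPred fun r : (α × ℕ) × β => (l r.1.1)[r.1.2]? = some r.2 ∧ p (r.1.1, r.2) :=
    rePred_and (rePred_eq (by fun_prop) (by fun_prop)) (rePred_comp hp (by fun_prop))
  refine (rePred_forall_lt (n := fun a => (l a).length) (by fun_prop)
    (rePred_exists hentry)).of_eq fun a => ⟨fun h b hb => ?_, fun h i hi => ?_⟩
  · obtain ⟨i, hi, rfl⟩ := List.mem_iff_getElem.1 hb
    obtain ⟨b, hb, hpb⟩ := h i hi
    simp only [hi, getElem?_pos, Option.some.injEq] at hb
    exact hb ▸ hpb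
  · exact ⟨(l a)[i], by simp [hi], h _ (List.getElem_mem hi)⟩

theorem exists_enumeration_of_rePred {p : α × ℕ → Prop} (hp : REPred p) :
    ∃ σ : α → ℕ → ℕ, Computable₂ σ ∧ ∀ a k, p (a, k) ↔ ∃ n, σ a n = k + 1 := by
  obtain ⟨f, hf, hfp⟩ := rePred_iff_exists_stage.1 hp
  refine ⟨fun a n => bif f ((a, n.unpair.1), n.unpair.2) then n.unpair.1 + 1 else 0,
    show Computable fun q : α × ℕ => bif f ((q.1, q.2.unpair.1), q.2.unpair.2) then
      q.2.unpair.1 + 1 else 0 by fun_prop, fun a k => ⟨fun hk => ?_, ?_⟩⟩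
  · obtain ⟨n, hn⟩ := (hfp _).1 hk
    exact ⟨Nat.pair k n, by simp [hn]⟩
  · rintro ⟨n, hn⟩
    refine (hfp _).2 ⟨n.unpair.2, ?_⟩
    grind

theorem exists_injective_enumeration_of_rePred (hp : REPred p) :
    ∃ e : ℕ → Option α, Computable e ∧ (∀ a, p a ↔ ∃ t, e t = some a) ∧
      ∀ t t' a, e t = some a → e t' = some a → t = t' := by
  obtain ⟨f, hf, hfp, hunique⟩ := exists_unique_stage_of_rePred hp
  let e : ℕ → Option α := fun t => (Encodable.decode₂ α t.unpair.1).bind fun a =>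
    bif f (a, t.unpair.2) then some a else none
  have he : ∀ t a, e t = some a ↔ Encodable.encode a = t.unpair.1 ∧ f (a, t.unpair.2) = true := by
    intro t a
    simp only [e, Option.bind_eq_some_iff, Encodable.decode₂_eq_some]
    grind
  have hdecode : Computable fun t : ℕ => Encodable.decode₂ α t.unpair.1 :=
    Primrec.decode₂.to_comp.comp (by fun_prop)
  refine ⟨e, computable_option_bind (g := fun q : ℕ × α =>
    bif f (q.2, q.1.unpair.2) then some q.2 else none) hdecode (by fun_prop),
    fun a => ⟨fun ha => ?_, ?_⟩, fun t t' a ht ht' => ?_⟩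
  · obtain ⟨n, hn⟩ := (hfp a).1 ha
    exact ⟨Nat.pair (Encodable.encode a) n, (he _ _).2 (by simpa using hn)⟩
  · rintro ⟨t, ht⟩
    exact (hfp a).2 ⟨_, ((he _ _).1 ht).2⟩
  · obtain ⟨hcode, hstage⟩ := (he _ _).1 ht
    obtain ⟨hcode', hstage'⟩ := (he _ _).1 ht'
    rw [← Nat.pair_unpair t, ← Nat.pair_unpair t', ← hcode, ← hcode',
      hunique _ _ _ hstage hstage']

theorem exists_computable_selector_of_rePred [Inhabited β] {p : α × β → Prop} (hp : REPred p)
    (h : ∀ a, ∃ b, p (a, b)) : ∃ g : α → β, Computable g ∧ ∀ a, p (a, g a) := by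
  obtain ⟨f, hf, hfp⟩ := rePred_iff_exists_stage.1 hp
  let found : α → ℕ → Prop := fun a n =>
    ((Encodable.decode (α := β) n.unpair.1).map fun b => f ((a, b), n.unpair.2)).getD false = true
  have hfound : ComputablePred fun q : α × ℕ => found q.1 q.2 := by
    have hmap := computable_option_map
      (f := fun q : α × ℕ => Encodable.decode (α := β) q.2.unpair.1)
      (g := fun r => f ((r.1.1, r.2), r.1.2.unpair.2)) (by fun_prop) (by fun_prop)
    exact ⟨fun _ => instDecidableEqBool _ _,
      (hmap.option_getD (Computable.const false)).of_eq fun q => by simp [found]⟩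
  have hex : ∀ a, ∃ n, found a n := fun a => by
    obtain ⟨b, hb⟩ := h a
    obtain ⟨n, hn⟩ := (hfp _).1 hb
    exact ⟨Nat.pair (Encodable.encode b) n, by simpa [found] using hn⟩
  classical
  have hfind := Computable.find hfound hex
  refine ⟨fun a => (Encodable.decode (α := β) (Nat.find (hex a)).unpair.1).getD default,
    by fun_prop, fun a => ?_⟩
  have hspec := Nat.find_spec (hex a)
  cases hd : Encodable.decode (α := β) (Nat.find (hex a)).unpair.1 with
  | none => simp [found, hd] at hspec
  | some b => exact (hfp _).2 ⟨_, by simpa [found, hd] using hspec⟩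

end REPredicates

/-! ### Computability on the rationals -/

theorem ratNum_surjective : Function.Surjective ratNum := by
  intro q
  refine ⟨Nat.pair q.num.toNat (Nat.pair (-q.num).toNat (q.den - 1)), ?_⟩
  have hden : ((q.den - 1 : ℕ) : ℚ) + 1 = q.den := by
    have := q.pos
    exact_mod_cast (by omega : q.den - 1 + 1 = q.den)
  have hnum : ((q.num.toNat : ℕ) : ℚ) - ((-q.num).toNat : ℕ) = q.num := by
    exact_mod_cast (by omega : (q.num.toNat : ℤ) - ((-q.num).toNat : ℤ) = q.num)
  simp only [ratNum, Nat.unpair_pair, hden, hnum]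
  exact Rat.num_div_den q

theorem ratNum_eq_iff (m n : ℕ) : ratNum m = ratNum n ↔
    m.unpair.1 * (n.unpair.2.unpair.2 + 1) + n.unpair.2.unpair.1 * (m.unpair.2.unpair.2 + 1) =
      n.unpair.1 * (m.unpair.2.unpair.2 + 1) + m.unpair.2.unpair.1 * (n.unpair.2.unpair.2 + 1) := by
  rw [ratNum, ratNum, div_eq_div_iff (by positivity) (by positivity), ← @Nat.cast_inj ℚ]
  push_cast
  constructor <;> intro h <;> linarith

theorem ratNum_lt_iff (m n : ℕ) : ratNum m < ratNum n ↔
    m.unpair.1 * (n.unpair.2.unpair.2 + 1) + n.unpair.2.unpair.1 * (m.unpair.2.unpair.2 + 1) <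
      n.unpair.1 * (m.unpair.2.unpair.2 + 1) + m.unpair.2.unpair.1 * (n.unpair.2.unpair.2 + 1) := by
  rw [ratNum, ratNum, div_lt_div_iff₀ (by positivity) (by positivity), ← @Nat.cast_lt ℚ]
  push_cast
  constructor <;> intro h <;> linarith

theorem primrecRel_ratNum_eq : PrimrecRel fun m n => ratNum m = ratNum n := by
  have hfst : Primrec fun n : ℕ => n.unpair.1 := Primrec.fst.comp Primrec.unpair
  have hsnd : Primrec fun n : ℕ => n.unpair.2 := Primrec.snd.comp Primrec.unpair
  have hneg : Primrec fun n : ℕ => n.unpair.2.unpair.1 := hfst.comp hsnd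
  have hden : Primrec fun n : ℕ => n.unpair.2.unpair.2 + 1 := Primrec.succ.comp (hsnd.comp hsnd)
  have hcross {m n : ℕ × ℕ → ℕ} (hm : Primrec m) (hn : Primrec n) :
      Primrec fun p => (m p).unpair.1 * ((n p).unpair.2.unpair.2 + 1) +
        (n p).unpair.2.unpair.1 * ((m p).unpair.2.unpair.2 + 1) :=
    Primrec.nat_add.comp (Primrec.nat_mul.comp (hfst.comp hm) (hden.comp hn))
      (Primrec.nat_mul.comp (hneg.comp hn) (hden.comp hm))
  have h := Primrec.eq.comp (hcross Primrec.fst Primrec.snd) (hcross Primrec.snd Primrec.fst)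
  exact (h.of_eq fun p => (ratNum_eq_iff p.1 p.2).symm).primrecRel

/-- `n` is the least number of a rational in the standard numbering. -/
def IsLeastRatNum (n : ℕ) : Prop := ¬ ∃ m < n, ratNum m = ratNum n

instance : DecidablePred IsLeastRatNum := fun n => inferInstanceAs (Decidable (¬ ∃ m < n, _))

theorem primrecPred_isLeastRatNum : PrimrecPred IsLeastRatNum :=
  ((PrimrecRel.exists_lt primrecRel_ratNum_eq).comp Primrec.id Primrec.id).not

theorem isLeastRatNum_find {q : ℚ} (h : ∃ n, ratNum n = q) : IsLeastRatNum (Nat.find h) := by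
  rintro ⟨m, hm, hmq⟩
  exact Nat.find_min h hm (hmq.trans (Nat.find_spec h))

/-- The equivalence of the rationals with their least numbers in the standard numbering. -/
def ratEquivLeast : ℚ ≃ {n // IsLeastRatNum n} where
  toFun q := ⟨Nat.find (ratNum_surjective q), isLeastRatNum_find _⟩
  invFun n := ratNum n
  left_inv q := Nat.find_spec (ratNum_surjective q)
  right_inv n := Subtype.ext <| (Nat.find_eq_iff _).2 ⟨rfl, fun m hm h => n.2 ⟨m, hm, h⟩⟩

/-- Rationals are encoded by their least number in the standard numbering. Mathlib's default
`Primcodable.ofDenumerable` is computably equivalent, but with the present encoding the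
computability of `ratNum` is a plain search. -/
instance ratPrimcodable : Primcodable ℚ :=
  @Primcodable.ofEquiv _ _ (Primcodable.subtype primrecPred_isLeastRatNum) ratEquivLeast

/-- The least number of `q` in the standard numbering, a computable right inverse of `ratNum`. -/
def ratCode (q : ℚ) : ℕ := (ratEquivLeast q).1

theorem ratNum_ratCode (q : ℚ) : ratNum (ratCode q) = q := ratEquivLeast.left_inv q

@[fun_prop]
theorem computable_ratCode : Computable ratCode := by
  let _ := Primcodable.subtype primrecPred_isLeastRatNum
  exact (Primrec.subtype_val.comp (Primrec.of_equiv (e := ratEquivLeast))).to_comp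

@[fun_prop]
theorem computable_ratNum : Computable ratNum := by
  let _ := Primcodable.subtype primrecPred_isLeastRatNum
  have hex : ∀ n, ∃ m, ratNum m = ratNum n := fun n => ⟨n, rfl⟩
  have hfind : Computable fun n => Nat.find (hex n) :=
    Computable.find (primrecRel_ratNum_eq.comp Primrec.snd Primrec.fst).computablePred hex
  have hleast : Computable fun n =>
      (⟨Nat.find (hex n), isLeastRatNum_find _⟩ : {n // IsLeastRatNum n}) :=
    Computable.subtype_mk primrecPred_isLeastRatNum hfind
  exact ((Primrec.of_equiv_symm (e := ratEquivLeast)).to_comp.comp hleast).of_eq fun n =>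
    Nat.find_spec (hex n)

section RatPredicates

variable {α : Type*} [Primcodable α]

theorem computable_decide_rat_lt {f g : α → ℚ} (hf : Computable f) (hg : Computable g) :
    Computable fun a => decide (f a < g a) := by
  have h : Computable fun p : ℕ × ℕ => decide (ratNum p.1 < ratNum p.2) := by
    simp only [ratNum_lt_iff]
    exact computable_decide_nat_lt (by fun_prop) (by fun_prop)
  refine (h.comp (g := fun a => (ratCode (f a), ratCode (g a))) (by fun_prop)).of_eq fun a => ?_
  simp only [ratNum_ratCode]

theorem computable_decide_rat_le {f g : α → ℚ} (hf : Computable f) (hg : Computable g) :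
    Computable fun a => decide (f a ≤ g a) := by
  refine (computable_not.comp (computable_decide_rat_lt hg hf)).of_eq fun a => ?_
  simp only [← decide_not, not_lt]

theorem rePred_rat_lt {f g : α → ℚ} (hf : Computable f) (hg : Computable g) :
    REPred fun a => f a < g a := rePred_of_computable_decide (computable_decide_rat_lt hf hg)

theorem computable_of_eq_natCast_div {f : α → ℚ} {a b c : α → ℕ} (ha : Computable a)
    (hb : Computable b) (hc : Computable c)
    (h : ∀ x, f x = ((a x : ℚ) - b x) / (c x + 1)) : Computable f := by
  refine (computable_ratNum.comp (g := fun x => Nat.pair (a x) (Nat.pair (b x) (c x)))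
    (by fun_prop)).of_eq fun x => ?_
  simp [h, ratNum]

end RatPredicates

@[fun_prop]
theorem computable_natCast_rat : Computable fun n : ℕ => (n : ℚ) :=
  computable_of_eq_natCast_div (b := fun _ => 0) (c := fun _ => 0) Computable.id
    (by fun_prop) (by fun_prop) fun n => by simp

/-- The fractions are `(x.1 - x.2.1) / (x.2.2 + 1)`, as in the standard numbering. -/
theorem computable_rat_binary {op : ℚ → ℚ → ℚ} {a b c : (ℕ × ℕ × ℕ) × (ℕ × ℕ × ℕ) → ℕ}
    (ha : Computable a) (hb : Computable b) (hc : Computable c)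
    (h : ∀ x y : ℕ × ℕ × ℕ, op (((x.1 : ℚ) - x.2.1) / (x.2.2 + 1))
      (((y.1 : ℚ) - y.2.1) / (y.2.2 + 1)) = ((a (x, y) : ℚ) - b (x, y)) / (c (x, y) + 1)) :
    Computable fun p : ℚ × ℚ => op p.1 p.2 := by
  let frac : ℚ → ℕ × ℕ × ℕ := fun q =>
    ((ratCode q).unpair.1, (ratCode q).unpair.2.unpair.1, (ratCode q).unpair.2.unpair.2)
  have hfrac : Computable frac := by fun_prop
  have hq : ∀ q : ℚ, (((frac q).1 : ℚ) - (frac q).2.1) / ((frac q).2.2 + 1) = q := ratNum_ratCode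
  refine computable_of_eq_natCast_div (a := fun p => a (frac p.1, frac p.2))
    (b := fun p => b (frac p.1, frac p.2)) (c := fun p => c (frac p.1, frac p.2))
    (by fun_prop) (by fun_prop) (by fun_prop) fun p => ?_
  rw [← h, hq, hq]

instance : ComputableAdd ℚ := ⟨by
  refine computable_rat_binary
    (a := fun p => p.1.1 * (p.2.2.2 + 1) + p.2.1 * (p.1.2.2 + 1))
    (b := fun p => p.1.2.1 * (p.2.2.2 + 1) + p.2.2.1 * (p.1.2.2 + 1))
    (c := fun p => p.1.2.2 * p.2.2.2 + p.1.2.2 + p.2.2.2)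
    (by fun_prop) (by fun_prop) (by fun_prop) fun x y => ?_
  have h : ((x.2.2 * y.2.2 + x.2.2 + y.2.2 : ℕ) : ℚ) + 1 = (x.2.2 + 1) * (y.2.2 + 1) := by
    push_cast; ring
  rw [h]
  push_cast
  field_simp
  ring⟩

instance : ComputableMul ℚ := ⟨by
  refine computable_rat_binary
    (a := fun p => p.1.1 * p.2.1 + p.1.2.1 * p.2.2.1)
    (b := fun p => p.1.1 * p.2.2.1 + p.1.2.1 * p.2.1)
    (c := fun p => p.1.2.2 * p.2.2.2 + p.1.2.2 + p.2.2.2)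
    (by fun_prop) (by fun_prop) (by fun_prop) fun x y => ?_
  have h : ((x.2.2 * y.2.2 + x.2.2 + y.2.2 : ℕ) : ℚ) + 1 = (x.2.2 + 1) * (y.2.2 + 1) := by
    push_cast; ring
  rw [h]
  push_cast
  field_simp
  ring⟩

instance : ComputableSub ℚ := ⟨by
  have h : Computable fun p : ℚ × ℚ => p.1 + -1 * p.2 := by fun_prop
  exact h.of_eq fun p => by ring⟩

@[fun_prop]
theorem computable_posRatNum : Computable posRatNum :=
  computable_of_eq_natCast_div (a := fun n => n.unpair.1 + 1) (b := fun _ => 0)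
    (c := fun n => n.unpair.2) (by fun_prop) (by fun_prop) (by fun_prop)
    fun n => by simp [posRatNum]

theorem posRatNum_pos (n : ℕ) : 0 < posRatNum n := by
  unfold posRatNum
  positivity

theorem exists_posRatNum_eq {q : ℚ} (hq : 0 < q) : ∃ n, posRatNum n = q := by
  refine ⟨Nat.pair (q.num.toNat - 1) (q.den - 1), ?_⟩
  have hden : ((q.den - 1 : ℕ) : ℚ) + 1 = q.den := by
    have := q.pos
    exact_mod_cast (by omega : q.den - 1 + 1 = q.den)
  have hnum : ((q.num.toNat - 1 : ℕ) : ℚ) + 1 = q.num := by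
    have := Rat.num_pos.2 hq
    exact_mod_cast (by omega : ((q.num.toNat - 1 : ℕ) : ℤ) + 1 = q.num)
  simp only [posRatNum, Nat.unpair_pair, hden, hnum]
  exact Rat.num_div_den q

/-! ### Prefix machines from requests -/

/-- The number with binary expansion `0.l`, the left end point of the dyadic interval of length
`2 ^ (-l.length)` that corresponds to the word `l`. -/
def dyadicValue : List Bool → ℚ
  | [] => 0
  | b :: l => ((bif b then 1 else 0) + dyadicValue l) * (1 / 2)

theorem dyadicValue_eq_sum (l : List Bool) : dyadicValue l =
    ∑ i ∈ Finset.range l.length, (bif l[i]?.getD false then 1 else 0) * (1 / 2 : ℚ) ^ (i + 1) := by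
  induction l with
  | nil => simp [dyadicValue]
  | cons b l ih =>
    rw [dyadicValue, ih, List.length_cons, Finset.sum_range_succ', add_mul, Finset.sum_mul,
      add_comm]
    congr 1
    · refine Finset.sum_congr rfl fun i _ => ?_
      rw [List.getElem?_cons_succ, pow_succ _ (i + 1)]
      ring
    · simp

@[fun_prop]
theorem computable_dyadicValue : Computable dyadicValue := by
  have h := computable_sum_range (α := List Bool) (n := fun l => l.length)
    (f := fun q => (bif q.1[q.2]?.getD false then 1 else 0) * (1 / 2 : ℚ) ^ (q.2 + 1))
    (by fun_prop) (by fun_prop)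
  exact h.of_eq fun l => (dyadicValue_eq_sum l).symm

theorem dyadicValue_nonneg (l : List Bool) : 0 ≤ dyadicValue l := by
  induction l with
  | nil => simp [dyadicValue]
  | cons b l ih => cases b <;> simp only [dyadicValue, cond_true, cond_false] <;> positivity

theorem dyadicValue_add_le_one (l : List Bool) : dyadicValue l + (1 / 2) ^ l.length ≤ 1 := by
  induction l with
  | nil => simp [dyadicValue]
  | cons b l ih =>
    rw [dyadicValue, List.length_cons, pow_succ]
    cases b <;> simp only [cond_true, cond_false] <;> linarith

theorem dyadicValue_append (l m : List Bool) :
    dyadicValue (l ++ m) = dyadicValue l + (1 / 2) ^ l.length * dyadicValue m := by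
  induction l with
  | nil => simp [dyadicValue]
  | cons b l ih =>
    rw [List.cons_append, dyadicValue, ih, dyadicValue, List.length_cons, pow_succ]
    ring

theorem exists_dyadicValue_eq (n k : ℕ) (hk : k < 2 ^ n) :
    ∃ l : List Bool, l.length = n ∧ dyadicValue l = k * (1 / 2) ^ n := by
  induction n generalizing k with
  | zero => exact ⟨[], rfl, by simp [dyadicValue, Nat.lt_one_iff.1 hk]⟩
  | succ n ih =>
    by_cases h : k < 2 ^ n
    · obtain ⟨l, hl, hv⟩ := ih k h
      refine ⟨false :: l, by simp [hl], ?_⟩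
      rw [dyadicValue, hv, pow_succ, cond_false]
      ring
    · obtain ⟨l, hl, hv⟩ := ih (k - 2 ^ n) (by rw [pow_succ] at hk; omega)
      refine ⟨true :: l, by simp [hl], ?_⟩
      have hpow : (2 : ℚ) ^ n * (1 / 2) ^ n = 1 := by rw [← mul_pow]; norm_num
      rw [dyadicValue, hv, pow_succ, Nat.cast_sub (not_lt.1 h), cond_true]
      push_cast
      linear_combination (-1 / 2 : ℚ) * hpow

theorem exists_dyadicValue_mem_Icc {x : ℚ} {n : ℕ} (hx : 0 ≤ x) (hx1 : x + 2 * (1 / 2) ^ n ≤ 1) :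
    ∃ l : List Bool, l.length = n ∧ dyadicValue l ∈ Set.Icc x (x + (1 / 2) ^ n) := by
  have hpow : (1 / 2 : ℚ) ^ n = 1 / 2 ^ n := one_div_pow _ _
  have hpos : (0 : ℚ) < 2 ^ n := by positivity
  have hle : x ≤ ⌈x * 2 ^ n⌉₊ * (1 / 2) ^ n := by
    rw [hpow, mul_one_div, le_div_iff₀ hpos]
    exact Nat.le_ceil _
  have hlt : ⌈x * 2 ^ n⌉₊ * (1 / 2) ^ n < x + (1 / 2) ^ n := by
    rw [hpow, mul_one_div, div_lt_iff₀ hpos, add_mul, one_div_mul_cancel hpos.ne']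
    exact Nat.ceil_lt_add_one (by positivity)
  have hk : ⌈x * 2 ^ n⌉₊ < 2 ^ n := by
    have h : ⌈x * 2 ^ n⌉₊ * (1 / 2 : ℚ) ^ n < 1 := by
      linarith [show (0 : ℚ) < (1 / 2) ^ n by positivity]
    rw [hpow, mul_one_div, div_lt_one hpos] at h
    exact_mod_cast h
  obtain ⟨l, hl, hv⟩ := exists_dyadicValue_eq n _ hk
  exact ⟨l, hl, hv ▸ ⟨hle, hlt.le⟩⟩

section Requests

variable {α : Type*} (e : ℕ → Option α) (len : α → ℕ)

/-- The measure `2 ^ (-len a)` of the `t`-th request `e t = some a`. -/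
def requestWeight (t : ℕ) : ℚ := ((e t).map fun a => (1 / 2 : ℚ) ^ len a).getD 0

/-- The total measure of the requests before the `t`-th: the left end point of the interval
reserved for the `t`-th request. -/
def requestStart (t : ℕ) : ℚ := ∑ i ∈ Finset.range t, requestWeight e len i

/-- The `t`-th request, of length `n`, is served by the words of length `n + 1` whose dyadic
intervals lie in the interval reserved for it. The extra bit pays for the fact that this interval
is not itself dyadic. -/
def servesRequest (q : List Bool) (t : ℕ) : Bool :=
  ((e t).map fun a => decide (q.length = len a + 1 ∧ requestStart e len t ≤ dyadicValue q ∧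
    dyadicValue q + (1 / 2) ^ q.length ≤ requestStart e len (t + 1))).getD false

/-- The machine that answers with `out a` on the words that serve the request `a`. -/
def requestMachine (out : α → List Bool) : List Bool →. List Bool := fun q =>
  (Nat.rfind fun t => Part.some (servesRequest e len q t)).bind
    fun t => ((e t).map out : Option (List Bool))

theorem requestWeight_nonneg (t : ℕ) : 0 ≤ requestWeight e len t := by
  unfold requestWeight
  cases e t <;> simp

theorem requestStart_nonneg (t : ℕ) : 0 ≤ requestStart e len t :=
  Finset.sum_nonneg fun i _ => requestWeight_nonneg e len i

theorem requestStart_mono : Monotone (requestStart e len) := by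
  refine monotone_nat_of_le_succ fun t => ?_
  rw [requestStart, requestStart, Finset.sum_range_succ]
  linarith [requestWeight_nonneg e len t]

variable {e len} {out : α → List Bool}

theorem servesRequest_iff {q : List Bool} {t : ℕ} : servesRequest e len q t = true ↔
    ∃ a, e t = some a ∧ q.length = len a + 1 ∧ requestStart e len t ≤ dyadicValue q ∧
      dyadicValue q + (1 / 2) ^ q.length ≤ requestStart e len (t + 1) := by
  rw [servesRequest]
  cases e t <;> simp

theorem eq_of_servesRequest_of_prefix {q r : List Bool} {t t' : ℕ}
    (hq : servesRequest e len q t = true) (hr : servesRequest e len r t' = true)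
    (hqr : q <+: r) : t = t' := by
  obtain ⟨a, -, -, hstart, hend⟩ := servesRequest_iff.1 hq
  obtain ⟨a', -, -, hstart', hend'⟩ := servesRequest_iff.1 hr
  obtain ⟨z, rfl⟩ := hqr
  rw [dyadicValue_append, List.length_append, pow_add] at hend'
  rw [dyadicValue_append] at hstart'
  have hq0 : (0 : ℚ) < (1 / 2) ^ q.length := by positivity
  have hz0 : (0 : ℚ) < (1 / 2) ^ z.length := by positivity
  have hz := dyadicValue_nonneg z
  have hz1 := dyadicValue_add_le_one z
  rcases lt_trichotomy t t' with h | h | h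
  · have hdisjoint : requestStart e len (t + 1) ≤ requestStart e len t' := requestStart_mono e len h
    nlinarith
  · exact h
  · have hdisjoint : requestStart e len (t' + 1) ≤ requestStart e len t := requestStart_mono e len h
    nlinarith [mul_nonneg hq0.le hz, mul_pos hq0 hz0]

theorem exists_servesRequest {t : ℕ} {a : α} (ht : e t = some a)
    (hle : requestStart e len (t + 1) ≤ 1) :
    ∃ q : List Bool, q.length = len a + 1 ∧ servesRequest e len q t = true := by
  have hend : requestStart e len (t + 1) =
      requestStart e len t + 2 * (1 / 2) ^ (len a + 1) := by
    rw [requestStart, Finset.sum_range_succ, requestWeight, ht, pow_succ]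
    simp only [requestStart, Option.map_some, Option.getD_some]
    ring
  obtain ⟨q, hq, hstart, hlt⟩ :=
    exists_dyadicValue_mem_Icc (requestStart_nonneg e len t) (hend ▸ hle)
  refine ⟨q, hq, servesRequest_iff.2 ⟨a, ht, hq, hstart, ?_⟩⟩
  rw [hend, hq]
  linarith

theorem mem_requestMachine {q v : List Bool} : v ∈ requestMachine e len out q ↔
    ∃ t a, servesRequest e len q t = true ∧ e t = some a ∧ out a = v := by
  simp only [requestMachine, Part.mem_bind_iff, Part.mem_ofOption, Option.mem_def,
    Option.map_eq_some_iff]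
  constructor
  · rintro ⟨t, ht, a, ha, hv⟩
    exact ⟨t, a, (Part.mem_some_iff.1 (Nat.mem_rfind.1 ht).1).symm, ha, hv⟩
  · rintro ⟨t, a, ht, ha, hv⟩
    refine ⟨t, Nat.mem_rfind.2 ⟨Part.mem_some_iff.2 ht.symm, fun {m} hm =>
      Part.mem_some_iff.2 (Bool.eq_false_iff.2 fun hserves => ?_).symm⟩, a, ha, hv⟩
    exact hm.ne (eq_of_servesRequest_of_prefix hserves ht (List.prefix_refl q))

theorem eq_of_prefix_of_mem_requestMachine_dom {q r : List Bool}
    (hq : q ∈ (requestMachine e len out).Dom) (hr : r ∈ (requestMachine e len out).Dom)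
    (hqr : q <+: r) : q = r := by
  obtain ⟨v, hv⟩ := Part.dom_iff_mem.1 hq
  obtain ⟨w, hw⟩ := Part.dom_iff_mem.1 hr
  obtain ⟨t, -, ht, -⟩ := mem_requestMachine.1 hv
  obtain ⟨t', -, ht', -⟩ := mem_requestMachine.1 hw
  obtain rfl := eq_of_servesRequest_of_prefix ht ht' hqr
  obtain ⟨a, ha, hlen, -⟩ := servesRequest_iff.1 ht
  obtain ⟨b, hb, hlen', -⟩ := servesRequest_iff.1 ht'
  obtain rfl := Option.some_injective _ (ha.symm.trans hb)
  exact hqr.eq_of_length (hlen.trans hlen'.symm)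

theorem tsum_map_getD_of_injective_enumeration {p : α → Prop}
    (hp : ∀ a, p a ↔ ∃ t, e t = some a)
    (hinj : ∀ t t' a, e t = some a → e t' = some a → t = t') (f : α → ℝ≥0∞) :
    ∑' t, ((e t).map f).getD 0 = ∑' a : {a // p a}, f a := by
  choose index hindex using fun a : {a // p a} => (hp a).1 a.2
  have hinjective : Function.Injective index := fun a b hab =>
    Subtype.ext (Option.some_injective _ ((hindex a).symm.trans (hab ▸ hindex b)))
  rw [← hinjective.tsum_eq (f := fun t => ((e t).map f).getD 0) fun t ht => ?_]
  · simp only [hindex, Option.map_some, Option.getD_some]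
  · cases ha : e t with
    | none => simp [ha] at ht
    | some a =>
      exact ⟨⟨a, (hp a).2 ⟨t, ha⟩⟩, hinj _ _ a (hindex _) ha⟩

theorem requestStart_le_one
    (hsum : ∑' t, ((e t).map fun a => (1 / 2 : ℝ≥0∞) ^ len a).getD 0 ≤ 1) (t : ℕ) :
    requestStart e len t ≤ 1 := by
  have hweight : ∀ i, ENNReal.ofReal (requestWeight e len i : ℝ) =
      ((e i).map fun a => (1 / 2 : ℝ≥0∞) ^ len a).getD 0 := by
    intro i
    unfold requestWeight
    cases e i with
    | none => simp
    | some a => simp [ENNReal.ofReal_pow, ENNReal.ofReal_inv_of_pos, ENNReal.inv_pow]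
  have hstart : ENNReal.ofReal (requestStart e len t : ℝ) ≤ 1 := by
    rw [requestStart, Rat.cast_sum, ENNReal.ofReal_sum_of_nonneg fun i _ => by
      exact_mod_cast requestWeight_nonneg e len i]
    simp only [hweight]
    exact (ENNReal.sum_le_tsum _).trans hsum
  exact_mod_cast ENNReal.ofReal_le_one.1 hstart

variable [Primcodable α]

theorem computable_requestStart (he : Computable e) (hlen : Computable len) :
    Computable (requestStart e len) := by
  have hmap := computable_option_map (g := fun q : ℕ × α => (1 / 2 : ℚ) ^ len q.2) he (by fun_prop)
  have hweight : Computable (requestWeight e len) := hmap.option_getD (Computable.const 0)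
  exact computable_sum_range (α := ℕ) (n := fun t => t) (f := fun q => requestWeight e len q.2)
    (by fun_prop) (by fun_prop)

theorem computable_servesRequest (he : Computable e) (hlen : Computable len) :
    Computable fun q : List Bool × ℕ => servesRequest e len q.1 q.2 := by
  have hstart := computable_requestStart he hlen
  have hlength : Computable fun r : (List Bool × ℕ) × α =>
      decide (r.1.1.length = len r.2 + 1) := computable_decide_eq (by fun_prop) (by fun_prop)
  have hleft : Computable fun r : (List Bool × ℕ) × α =>
      decide (requestStart e len r.1.2 ≤ dyadicValue r.1.1) :=
    computable_decide_rat_le (by fun_prop) (by fun_prop)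
  have hright : Computable fun r : (List Bool × ℕ) × α =>
      decide (dyadicValue r.1.1 + (1 / 2) ^ r.1.1.length ≤ requestStart e len (r.1.2 + 1)) :=
    computable_decide_rat_le (by fun_prop) (by fun_prop)
  have hmap := computable_option_map (f := fun q : List Bool × ℕ => e q.2) (by fun_prop)
    (computable_decide_and hlength (computable_decide_and hleft hright))
  exact hmap.option_getD (Computable.const false)

theorem isPrefixMachine_requestMachine (he : Computable e) (hlen : Computable len)
    (hout : Computable out) : IsPrefixMachine (requestMachine e len out) := by
  refine ⟨Partrec.bind (Partrec.rfind (computable_servesRequest he hlen).to₂.partrec₂)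
    (Computable.ofOption ?_), fun q hq r hr => eq_of_prefix_of_mem_requestMachine_dom hq hr⟩
  exact computable_option_map (f := fun r : List Bool × ℕ => e r.2) (g := fun r => out r.2)
    (by fun_prop) (by fun_prop)

/-- The Kraft–Chaitin theorem, up to one bit. -/
theorem exists_prefixMachine_of_requests {p : α → Prop}
    (hp : REPred p) (hout : Computable out) (hlen : Computable len)
    (hsum : ∑' a : {a // p a}, (1 / 2 : ℝ≥0∞) ^ len a ≤ 1) :
    ∃ M, IsPrefixMachine M ∧ ∀ a, p a → ∃ q : List Bool, out a ∈ M q ∧ q.length = len a + 1 := by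
  obtain ⟨e, he, hpe, hinj⟩ := exists_injective_enumeration_of_rePred hp
  rw [← tsum_map_getD_of_injective_enumeration hpe hinj fun a => (1 / 2 : ℝ≥0∞) ^ len a] at hsum
  refine ⟨requestMachine e len out, isPrefixMachine_requestMachine he hlen hout, fun a ha => ?_⟩
  obtain ⟨t, ht⟩ := (hpe a).1 ha
  obtain ⟨q, hq, hserves⟩ := exists_servesRequest ht (requestStart_le_one hsum (t + 1))
  exact ⟨q, mem_requestMachine.2 ⟨t, a, hserves, ht, rfl⟩, hq⟩

end Requests

/-! ### Names of points -/

theorem length_initialWord {α : Type*} (σ : ℕ → α) (n : ℕ) : (initialWord σ n).length = n := by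
  simp [initialWord]

theorem getElem?_initialWord {α : Type*} (σ : ℕ → α) {n i : ℕ} (hi : i < n) :
    (initialWord σ n)[i]? = some (σ i) := by
  simp [initialWord, hi]

theorem initialWord_prefix_initialWord {α : Type*} (σ : ℕ → α) {m n : ℕ} (h : m ≤ n) :
    initialWord σ m <+: initialWord σ n := by
  obtain ⟨k, rfl⟩ := Nat.exists_eq_add_of_le h
  rw [initialWord, initialWord, List.range_add, List.map_append]
  exact List.prefix_append _ _

theorem eq_of_prefix_initialWord_of_getElem? {α : Type*} {σ : ℕ → α} {u : List α} {n i : ℕ}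
    {c : α} (h : u <+: initialWord σ n) (hc : u[i]? = some c) : c = σ i := by
  have hi : i < u.length := (List.getElem?_eq_some_iff.1 hc).1
  have hin : i < n := by simpa [length_initialWord] using hi.trans_le h.length_le
  obtain ⟨z, hz⟩ := h
  have hword : (initialWord σ n)[i]? = some c := by
    rw [← hz, List.getElem?_append_left hi, hc]
  rw [getElem?_initialWord σ hin] at hword
  exact (Option.some_injective _ hword).symm

section CauchyNames

variable {X : Type*} [PseudoMetricSpace X] {s : ℕ → X} {x : X}

theorem tendsto_one_half_pow : Tendsto (fun n : ℕ => (1 / 2 : ℝ) ^ n) atTop (𝓝 0) :=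
  tendsto_pow_atTop_nhds_zero_of_lt_one (by norm_num) (by norm_num)

theorem dist_le_of_cauchyRep {σ : ℕ → ℕ} (h : cauchyRep s σ x) (n : ℕ) :
    dist (s (σ n)) x ≤ 2 * (1 / 2) ^ n := by
  have := dist_le_of_le_geometric_two_of_tendsto (C := 2) (f := fun n => s (σ n))
    (fun n => (h.1 n).le.trans (by simp)) h.2 n
  simpa [div_eq_mul_inv] using this

theorem cauchyRep_of_dist_lt {σ : ℕ → ℕ} {N : ℕ}
    (hstep : ∀ n < N, dist (s (σ n)) (s (σ (n + 1))) < (1 / 2 : ℝ) ^ n)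
    (hclose : ∀ n, N ≤ n → dist x (s (σ n)) < (1 / 2 : ℝ) ^ (n + 2)) : cauchyRep s σ x := by
  refine ⟨fun n => ?_, tendsto_iff_dist_tendsto_zero.2 ?_⟩
  · rcases lt_or_ge n N with hn | hn
    · exact hstep n hn
    · calc dist (s (σ n)) (s (σ (n + 1)))
          ≤ dist x (s (σ n)) + dist x (s (σ (n + 1))) := dist_triangle_left _ _ _
        _ < (1 / 2) ^ (n + 2) + (1 / 2) ^ (n + 1 + 2) :=
          add_lt_add (hclose n hn) (hclose _ (Nat.le_succ_of_le hn))
        _ = 3 / 8 * (1 / 2) ^ n := by ring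
        _ ≤ (1 / 2) ^ n := mul_le_of_le_one_left (by positivity) (by norm_num)
  · refine squeeze_zero' (Eventually.of_forall fun n => dist_nonneg) ?_ tendsto_one_half_pow
    filter_upwards [eventually_ge_atTop N] with n hn
    rw [dist_comm]
    exact (hclose n hn).le.trans (pow_le_pow_of_le_one (by norm_num) (by norm_num) (by omega))

/-- `u` is the beginning of a name: exactly then it extends to names of the points of a ball about
its last entry. -/
def IsNamePrefix (s : ℕ → X) (u : List ℕ) : Prop :=
  0 < u.length ∧ ∀ i < u.length - 1,
    dist (s (u[i]?.getD 0)) (s (u[i + 1]?.getD 0)) < (1 / 2 : ℝ) ^ i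

theorem isNamePrefix_initialWord {σ : ℕ → ℕ} (h : cauchyRep s σ x) {n : ℕ} (hn : 0 < n) :
    IsNamePrefix s (initialWord σ n) := by
  rw [IsNamePrefix, length_initialWord]
  refine ⟨hn, fun i hi => ?_⟩
  rw [getElem?_initialWord σ (by omega), getElem?_initialWord σ (by omega)]
  exact h.1 i

theorem exists_cauchyRep_of_isNamePrefix (hs : DenseRange s) {u : List ℕ} (hu : IsNamePrefix s u)
    (hx : dist (s (u[u.length - 1]?.getD 0)) x < (1 / 2 : ℝ) ^ (u.length - 1)) :
    ∃ σ, cauchyRep s σ x ∧ initialWord σ u.length = u := by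
  obtain ⟨hpos, hu⟩ := hu
  have hgap : 0 < (1 / 2 : ℝ) ^ (u.length - 1) - dist (s (u[u.length - 1]?.getD 0)) x :=
    sub_pos.2 hx
  choose τ hτ using fun n : ℕ =>
    hs.exists_dist_lt x (lt_min (show (0 : ℝ) < (1 / 2) ^ (n + 2) by positivity) hgap)
  let σ : ℕ → ℕ := fun n => u[n]?.getD (τ n)
  have hσ : ∀ n < u.length, σ n = u[n]?.getD 0 := fun n hn => by simp [σ, hn]
  have hσ' : ∀ n, u.length ≤ n → σ n = τ n := fun n hn => by simp [σ, hn]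
  refine ⟨σ, cauchyRep_of_dist_lt (N := u.length) (fun n hn => ?_) fun n hn => ?_, ?_⟩
  · rcases (Nat.succ_le_of_lt hn).lt_or_eq with hlt | heq
    · rw [hσ n hn, hσ (n + 1) hlt]
      exact hu n (by omega)
    · have hlast : u.length - 1 = n := by omega
      rw [hlast] at hτ
      rw [hσ n hn, hσ' (n + 1) heq.ge]
      linarith [dist_triangle (s (u[n]?.getD 0)) x (s (τ (n + 1))),
        lt_min_iff.1 (hτ (n + 1))]
  · rw [hσ' n hn]
    exact (lt_min_iff.1 (hτ n)).1
  · refine List.ext_getElem (length_initialWord _ _) fun i _ hi => ?_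
    simp [initialWord, σ, hi]

theorem exists_cauchyRep_dist_lt (hs : DenseRange s) (x : X) :
    ∃ σ, cauchyRep s σ x ∧ ∀ n, dist (s (σ n)) x < (1 / 2 : ℝ) ^ n := by
  choose σ hσ using fun n : ℕ =>
    hs.exists_dist_lt x (show (0 : ℝ) < (1 / 2) ^ (n + 2) by positivity)
  refine ⟨σ, cauchyRep_of_dist_lt (N := 0) (by simp) fun n _ => hσ n, fun n => ?_⟩
  rw [dist_comm]
  exact (hσ n).trans_le (pow_le_pow_of_le_one (by norm_num) (by norm_num) (by omega))

end CauchyNames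

/-! ### Semidecidable comparisons of computable reals -/

theorem UniformlyConstructive.neg {x : ℕ → ℝ} (h : UniformlyConstructive realRep x) :
    UniformlyConstructive realRep fun i => -x i := by
  obtain ⟨σ, hσ, hx⟩ := h
  have hσ' : Computable fun p : ℕ × ℕ => σ p.1 p.2 := hσ
  refine ⟨fun i n => ratCode (-1 * ratNum (σ i n)),
    show Computable fun p : ℕ × ℕ => ratCode (-1 * ratNum (σ p.1 p.2)) by fun_prop,
    fun i => ⟨fun n => ?_, ?_⟩⟩
  · simpa [ratNum_ratCode] using (hx i).1 n
  · simpa [ratNum_ratCode] using (hx i).2.neg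

theorem UniformlyConstructive.rePred_lt {x : ℕ → ℝ} (h : UniformlyConstructive realRep x) :
    REPred fun p : ℕ × ℚ => x p.1 < (p.2 : ℝ) := by
  obtain ⟨σ, hσ, hx⟩ := h
  have hσ' : Computable fun p : ℕ × ℕ => σ p.1 p.2 := hσ
  have hre : REPred fun r : (ℕ × ℚ) × ℕ => ratNum (σ r.1.1 r.2) + 2 * (1 / 2) ^ r.2 < r.1.2 :=
    rePred_rat_lt (by fun_prop) (by fun_prop)
  refine (rePred_exists hre).of_eq fun p => ⟨?_, fun hlt => ?_⟩
  · rintro ⟨n, hn⟩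
    have hdist := dist_le_of_cauchyRep (hx p.1) n
    rw [Real.dist_eq] at hdist
    rw [← Rat.cast_lt (K := ℝ)] at hn
    push_cast at hn
    linarith [(abs_le.1 hdist).1]
  · have hlim : Tendsto (fun n => (ratNum (σ p.1 n) : ℝ) + 2 * (1 / 2) ^ n) atTop (𝓝 (x p.1)) := by
      simpa using (hx p.1).2.add (tendsto_one_half_pow.const_mul 2)
    obtain ⟨n, hn⟩ := (hlim.eventually_lt_const hlt).exists
    exact ⟨n, (Rat.cast_lt (K := ℝ)).1 (by push_cast; exact hn)⟩

theorem UniformlyConstructive.rePred_gt {x : ℕ → ℝ} (h : UniformlyConstructive realRep x) :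
    REPred fun p : ℕ × ℚ => (p.2 : ℝ) < x p.1 := by
  refine (rePred_comp h.neg.rePred_lt (f := fun p : ℕ × ℚ => (p.1, -1 * p.2))
    (by fun_prop)).of_eq fun p => ?_
  simp

/-- The distances of the ideal points are uniformly upper semicomputable. -/
def SemidecidableDistLT {X : Type*} [PseudoMetricSpace X] (s : ℕ → X) : Prop :=
  REPred fun p : (ℕ × ℕ) × ℚ => dist (s p.1.1) (s p.1.2) < (p.2 : ℝ)

theorem IsComputableMetricSpace.semidecidableDistLT {X : Type*} [MetricSpace X] {s : ℕ → X}
    (h : IsComputableMetricSpace s) : SemidecidableDistLT s := by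
  refine (rePred_comp h.dist_computable.rePred_lt
    (f := fun p : (ℕ × ℕ) × ℚ => (Nat.pair p.1.1 p.1.2, p.2)) (by fun_prop)).of_eq fun p => ?_
  simp

theorem IsComputableMetricSpace.rePred_lt_dist {X : Type*} [MetricSpace X] {s : ℕ → X}
    (h : IsComputableMetricSpace s) :
    REPred fun p : (ℕ × ℕ) × ℚ => (p.2 : ℝ) < dist (s p.1.1) (s p.1.2) := by
  refine (rePred_comp h.dist_computable.rePred_gt
    (f := fun p : (ℕ × ℕ) × ℚ => (Nat.pair p.1.1 p.1.2, p.2)) (by fun_prop)).of_eq fun p => ?_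
  simp

/-! ### Recursively enumerable open sets -/

section OpenSets

variable {X Y : Type*} [MetricSpace X] [MetricSpace Y] {sX : ℕ → X} {sY : ℕ → Y}

/-- The union of the ideal balls with numbers in `S`. -/
def ballUnion (s : ℕ → X) (S : ℕ → Prop) : Set X := {x | ∃ k, S k ∧ x ∈ idealBall s k}

theorem mem_idealBall {s : ℕ → X} {k : ℕ} {x : X} :
    x ∈ idealBall s k ↔ dist x (s k.unpair.1) < (posRatNum k.unpair.2 : ℝ) := Iff.rfl

theorem isOpen_ballUnion (s : ℕ → X) (S : ℕ → Prop) : IsOpen (ballUnion s S) := by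
  refine isOpen_iff_mem_nhds.2 fun x ⟨k, hk, hx⟩ => ?_
  exact mem_of_superset (Metric.isOpen_ball.mem_nhds hx) fun y hy => ⟨k, hk, hy⟩

theorem IsPi02.exists_rePred {s : ℕ → X} {D : Set X} (hD : IsPi02 s D) :
    ∃ S : ℕ × ℕ → Prop, REPred S ∧ ∀ x, x ∈ D ↔ ∀ n, x ∈ ballUnion s fun k => S (n, k) := by
  obtain ⟨U, ⟨σ, hσ, hU⟩, rfl⟩ := hD
  have hσ' : Computable fun p : ℕ × ℕ => σ p.1 p.2 := hσ
  have hre : REPred fun r : (ℕ × ℕ) × ℕ => σ r.1.1 r.2 = r.1.2 + 1 :=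
    rePred_eq (by fun_prop) (by fun_prop)
  refine ⟨_, rePred_exists hre, fun x => ?_⟩
  rw [Set.mem_iInter]
  refine forall_congr' fun n => ?_
  rw [hU n]
  simp only [Set.iSup_eq_iUnion, Set.mem_iUnion, ballUnion, Set.mem_ofPred_eq]
  grind

theorem IsPi02.measurableSet [MeasurableSpace X] [BorelSpace X] {s : ℕ → X} {D : Set X}
    (hD : IsPi02 s D) : MeasurableSet D := by
  obtain ⟨S, -, hS⟩ := hD.exists_rePred
  have hInter : D = ⋂ n, ballUnion s fun k => S (n, k) := Set.ext fun x => by simp [hS]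
  rw [hInter]
  exact MeasurableSet.iInter fun n => (isOpen_ballUnion _ _).measurableSet

theorem rePred_isNamePrefix (hX : SemidecidableDistLT sX) : REPred (IsNamePrefix sX) := by
  refine rePred_and (rePred_nat_lt (by fun_prop) (by fun_prop)) (rePred_forall_lt
    (n := fun u : List ℕ => u.length - 1) (p := fun q : List ℕ × ℕ =>
      dist (sX (q.1[q.2]?.getD 0)) (sX (q.1[q.2 + 1]?.getD 0)) < (1 / 2 : ℝ) ^ q.2)
    (by fun_prop) ?_)
  refine (rePred_comp hX (f := fun q : List ℕ × ℕ => ((q.1[q.2]?.getD 0, q.1[q.2 + 1]?.getD 0),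
    (1 / 2 : ℚ) ^ q.2)) (by fun_prop)).of_eq fun q => ?_
  push_cast
  rfl

/-- The word `u`, the place `n` and the value `c` certify that a function computed by `Φ` maps the
ball `j` into the ball `k`: the names extending `u` are names of the points of the ball `j`, and
the `n`-th entry `c` of the output on `u` determines the value up to `2 * 2 ^ (-n)`. -/
def CertifiesPreimage (sX : ℕ → X) (sY : ℕ → Y) (Φ : List ℕ → List ℕ) (k j : ℕ) (u : List ℕ)
    (n c : ℕ) : Prop :=
  (IsNamePrefix sX u ∧ u[u.length - 1]?.getD 0 = j.unpair.1 ∧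
      posRatNum j.unpair.2 = (1 / 2) ^ (u.length - 1)) ∧
    (Φ u)[n]? = some c ∧
      dist (sY c) (sY k.unpair.1) < ((posRatNum k.unpair.2 - 2 * (1 / 2) ^ n : ℚ) : ℝ)

theorem rePred_certifiesPreimage (hX : SemidecidableDistLT sX) (hY : SemidecidableDistLT sY)
    {Φ : List ℕ → List ℕ} (hΦ : Computable Φ) :
    REPred fun r : (((ℕ × ℕ) × List ℕ) × ℕ) × ℕ =>
      CertifiesPreimage sX sY Φ r.1.1.1.1 r.1.1.1.2 r.1.1.2 r.1.2 r.2 := by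
  have hvalue := rePred_comp hY (f := fun r : (((ℕ × ℕ) × List ℕ) × ℕ) × ℕ =>
    ((r.2, r.1.1.1.1.unpair.1), posRatNum r.1.1.1.1.unpair.2 - 2 * (1 / 2) ^ r.1.2)) (by fun_prop)
  exact rePred_and
    (rePred_and (rePred_comp (rePred_isNamePrefix hX) (by fun_prop))
      (rePred_and (rePred_eq (by fun_prop) (by fun_prop)) (rePred_eq (by fun_prop) (by fun_prop))))
    (rePred_and (rePred_eq (by fun_prop) (by fun_prop)) hvalue)

section Certificates

variable {f : X → Y} {x : X} {Φ : List ℕ → List ℕ} {F : (ℕ → ℕ) → ℕ → ℕ} {k : ℕ}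

theorem mem_idealBall_of_certifiesPreimage (hs : DenseRange sX)
    (hlim : ∀ σ, cauchyRep sX σ x → ∀ m, ∃ n, Φ (initialWord σ m) = initialWord (F σ) n)
    (hF : ∀ σ, cauchyRep sX σ x → cauchyRep sY (F σ) (f x)) {j : ℕ} {u : List ℕ} {n c : ℕ}
    (hcert : CertifiesPreimage sX sY Φ k j u n c) (hxj : x ∈ idealBall sX j) :
    f x ∈ idealBall sY k := by
  obtain ⟨⟨hu, hcentre, hradius⟩, hc, hvalue⟩ := hcert
  rw [mem_idealBall, ← hcentre, hradius, dist_comm] at hxj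
  obtain ⟨σ, hσ, hσu⟩ := exists_cauchyRep_of_isNamePrefix hs hu (x := x) (by simpa using hxj)
  obtain ⟨N, hN⟩ := hlim σ hσ u.length
  rw [hσu] at hN
  have hprefix : Φ u <+: initialWord (F σ) N := by rw [hN]
  rw [eq_of_prefix_initialWord_of_getElem? hprefix hc] at hvalue
  have herror := dist_le_of_cauchyRep (hF σ hσ) n
  push_cast at hvalue
  rw [mem_idealBall]
  linarith [dist_triangle_left (f x) (sY k.unpair.1) (sY (F σ n))]

theorem exists_certifiesPreimage (hs : DenseRange sX) (hmono : ∀ u v, u <+: v → Φ u <+: Φ v)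
    (hlim : ∀ σ, cauchyRep sX σ x → ∀ n, ∃ m, initialWord (F σ) n <+: Φ (initialWord σ m))
    (hF : ∀ σ, cauchyRep sX σ x → cauchyRep sY (F σ) (f x)) (hfx : f x ∈ idealBall sY k) :
    ∃ j u n c, CertifiesPreimage sX sY Φ k j u n c ∧ x ∈ idealBall sX j := by
  obtain ⟨σ, hσ, hclose⟩ := exists_cauchyRep_dist_lt hs x
  have herror : Tendsto (fun n => dist (sY (F σ n)) (sY k.unpair.1) + 2 * (1 / 2 : ℝ) ^ n) atTop
      (𝓝 (dist (f x) (sY k.unpair.1))) := by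
    simpa using ((hF σ hσ).2.dist tendsto_const_nhds).add (tendsto_one_half_pow.const_mul 2)
  obtain ⟨n, hn⟩ := (herror.eventually_lt_const (mem_idealBall.1 hfx)).exists
  obtain ⟨m, hm⟩ := hlim σ hσ (n + 1)
  obtain ⟨z, hz⟩ := hm.trans (hmono _ _ (initialWord_prefix_initialWord σ (Nat.le_succ m)))
  obtain ⟨r, hr⟩ := exists_posRatNum_eq (q := (1 / 2) ^ m) (by positivity)
  refine ⟨Nat.pair (σ m) r, initialWord σ (m + 1), n, F σ n,
    ⟨⟨isNamePrefix_initialWord hσ (Nat.succ_pos m), ?_, ?_⟩, ?_, ?_⟩, ?_⟩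
  · rw [length_initialWord, Nat.add_sub_cancel, getElem?_initialWord σ (Nat.lt_succ_self m),
      Nat.unpair_pair, Option.getD_some]
  · simpa [length_initialWord] using hr
  · rw [← hz, List.getElem?_append_left (by rw [length_initialWord]; exact Nat.lt_succ_self n),
      getElem?_initialWord _ (Nat.lt_succ_self n)]
  · push_cast
    linarith
  · rw [mem_idealBall, Nat.unpair_pair, dist_comm, hr]
    simpa using hclose m

end Certificates

theorem ConstructiveOn.exists_rePred_preimage (hX : SemidecidableDistLT sX) (hs : DenseRange sX)
    (hY : SemidecidableDistLT sY) {f : X → Y} {D : Set X}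
    (hf : ConstructiveOn (cauchyRep sX) (cauchyRep sY) f D) :
    ∃ R : ℕ × ℕ → Prop, REPred R ∧
      ∀ k, ∀ x ∈ D, f x ∈ idealBall sY k ↔ x ∈ ballUnion sX fun j => R (k, j) := by
  obtain ⟨F, ⟨Φ, hΦ, hmono, hlim⟩, hF⟩ := hf
  refine ⟨_, rePred_exists (rePred_exists (rePred_exists (rePred_certifiesPreimage hX hY hΦ))),
    fun k x hx => ⟨fun hfx => ?_, ?_⟩⟩
  · obtain ⟨j, u, n, c, hcert, hxj⟩ := exists_certifiesPreimage hs hmono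
      (fun σ hσ => (hlim σ ⟨x, hx, hσ⟩).2) (fun σ => hF σ x hx) hfx
    exact ⟨j, ⟨u, n, c, hcert⟩, hxj⟩
  · rintro ⟨j, ⟨u, n, c, hcert⟩, hxj⟩
    exact mem_idealBall_of_certifiesPreimage hs (fun σ hσ => (hlim σ ⟨x, hx, hσ⟩).1)
      (fun σ => hF σ x hx) hcert hxj

end OpenSets

/-! ### Lower semicomputability of the measure of finite unions of balls -/

theorem rePred_lt_sum_range {α : Type*} [Primcodable α] {p : α × ℕ → Prop} [DecidablePred p]
    (hp : REPred p) {w : α × ℕ → ℚ} (hw : Computable w) (hw_nonneg : ∀ r, 0 ≤ w r) {n : α → ℕ}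
    (hn : Computable n) {q : α → ℚ} (hq : Computable q) :
    REPred fun a => q a < ∑ i ∈ Finset.range (n a), if p (a, i) then w (a, i) else 0 := by
  -- The existential witness is a mask selecting some of the indices that satisfy `p`.
  have hmask : REPred fun r : α × List Bool => ∀ i < n r.1,
      r.2[i]?.getD false = false ∨ p (r.1, i) :=
    rePred_forall_lt (p := fun t : (α × List Bool) × ℕ =>
      t.1.2[t.2]?.getD false = false ∨ p (t.1.1, t.2)) (by fun_prop)
      (rePred_or (rePred_eq (by fun_prop) (by fun_prop)) (rePred_comp hp (by fun_prop)))
  have hsum : Computable fun r : α × List Bool =>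
      ∑ i ∈ Finset.range (n r.1), bif r.2[i]?.getD false then w (r.1, i) else 0 :=
    computable_sum_range (f := fun t : (α × List Bool) × ℕ =>
      bif t.1.2[t.2]?.getD false then w (t.1.1, t.2) else 0) (by fun_prop) (by fun_prop)
  refine (rePred_exists (rePred_and hmask (rePred_rat_lt (f := fun r => q r.1) (by fun_prop)
    hsum))).of_eq fun a => ⟨?_, fun hlt => ?_⟩
  · rintro ⟨mask, hsound, hlt⟩
    refine hlt.trans_le (Finset.sum_le_sum fun i hi => ?_)
    rcases hsound i (Finset.mem_range.1 hi) with hfalse | hpi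
    · rw [hfalse, cond_false]
      split_ifs
      exacts [hw_nonneg _, le_rfl]
    · rw [if_pos hpi]
      cases mask[i]?.getD false
      exacts [hw_nonneg _, le_rfl]
  · refine ⟨(List.range (n a)).map fun i => decide (p (a, i)), fun i hi => ?_, hlt.trans_eq ?_⟩
    · simpa [hi] using (em _).symm
    · refine Finset.sum_congr rfl fun i hi => ?_
      simp [Finset.mem_range.1 hi, Bool.cond_decide]

theorem sum_map_eq_sum_range {β M : Type*} [AddCommMonoid M] (l : List β) (d : β) (f : β → M) :
    (l.map f).sum = ∑ i ∈ Finset.range l.length, f (l[i]?.getD d) := by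
  induction l with
  | nil => simp
  | cons b l ih =>
    rw [List.map_cons, List.sum_cons, ih, List.length_cons, Finset.sum_range_succ', add_comm]
    simp

@[fun_prop]
theorem computable_weightList {α : Type*} [Primcodable α] {f : α → ℕ} (hf : Computable f) :
    Computable fun a => weightList (f a) := by
  have hdecode : Computable fun n : ℕ => Denumerable.ofNat ((ℕ × ℕ) × List (ℕ × ℕ)) n := by
    have hgetD : Computable fun n : ℕ =>
        (Encodable.decode (α := (ℕ × ℕ) × List (ℕ × ℕ)) n).getD ((0, 0), []) := by fun_prop
    refine hgetD.of_eq fun n => ?_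
    rw [Denumerable.decode_eq_ofNat]
    rfl
  unfold weightList
  fun_prop

/-- The `i`-th pair of the `n`-th weight list. -/
def weightEntry (n i : ℕ) : ℕ × ℕ := (weightList n)[i]?.getD (0, 0)

@[fun_prop]
theorem computable_weightEntry {α : Type*} [Primcodable α] {f g : α → ℕ} (hf : Computable f)
    (hg : Computable g) : Computable fun a => weightEntry (f a) (g a) := by
  unfold weightEntry
  fun_prop

section IdealMeasure

variable {X : Type*} [MeasurableSpace X] (s : ℕ → X)

theorem pointMasses_apply (l : List (ℕ × ℕ)) {G : Set X} (hG : MeasurableSet G) :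
    pointMasses s l G = (l.map fun a => (a.2 + 1 : ℝ≥0∞) * G.indicator 1 (s a.1)).sum := by
  induction l with
  | nil => simp [pointMasses]
  | cons a l ih =>
    simp only [pointMasses, List.map_cons, List.sum_cons] at ih ⊢
    rw [Measure.add_apply, ih, Measure.smul_apply, Measure.dirac_apply' _ hG, smul_eq_mul]

open Classical in
theorem toReal_pointMasses_weightList (n : ℕ) {G : Set X} (hG : MeasurableSet G) :
    (pointMasses s (weightList n) G).toReal =
      ∑ i ∈ Finset.range (weightList n).length,
        if s (weightEntry n i).1 ∈ G then ((weightEntry n i).2 + 1 : ℝ) else 0 := by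
  have hterm : ∀ a : ℕ × ℕ, ((a.2 + 1 : ℝ≥0∞) * G.indicator 1 (s a.1)) =
      ENNReal.ofReal (if s a.1 ∈ G then (a.2 + 1 : ℝ) else 0) := fun a => by
    rw [Set.indicator_apply]
    split_ifs
    · rw [Pi.one_apply, mul_one, ENNReal.ofReal_add (by positivity) (by positivity)]
      simp
    · simp
  rw [pointMasses_apply s _ hG, sum_map_eq_sum_range _ (0, 0)]
  simp only [hterm]
  rw [← ENNReal.ofReal_sum_of_nonneg fun i _ => by positivity,
    ENNReal.toReal_ofReal (Finset.sum_nonneg fun i _ => by positivity)]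
  rfl

open Classical in
theorem idealMeasure_real_apply (n : ℕ) {G : Set X} (hG : MeasurableSet G) :
    (idealMeasure s n : Measure X).real G =
      (∑ i ∈ Finset.range (weightList n).length,
        if s (weightEntry n i).1 ∈ G then ((weightEntry n i).2 + 1 : ℝ) else 0) /
      ∑ i ∈ Finset.range (weightList n).length, ((weightEntry n i).2 + 1 : ℝ) := by
  have hdiv : (idealMeasure s n : Measure X) G =
      (totalWeight (weightList n))⁻¹ * pointMasses s (weightList n) G := by
    simp only [idealMeasure, ProbabilityMeasure.coe_mk, Measure.smul_apply, smul_eq_mul]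
  rw [measureReal_def, hdiv, ENNReal.toReal_mul, ENNReal.toReal_inv, ← pointMasses_univ s,
    toReal_pointMasses_weightList s n hG, toReal_pointMasses_weightList s n MeasurableSet.univ,
    inv_mul_eq_div]
  simp only [Set.mem_univ, if_true]

end IdealMeasure

section ShrunkBalls

variable {X : Type*} [MetricSpace X]

/-- The union of the ideal balls with numbers in `l`, of radii diminished by `ε`. -/
def shrunkBalls (s : ℕ → X) (l : List ℕ) (ε : ℚ) : Set X :=
  {x | ∃ k ∈ l, dist x (s k.unpair.1) < ((posRatNum k.unpair.2 - ε : ℚ) : ℝ)}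

theorem isOpen_shrunkBalls (s : ℕ → X) (l : List ℕ) (ε : ℚ) : IsOpen (shrunkBalls s l ε) := by
  refine isOpen_iff_mem_nhds.2 fun x ⟨k, hk, hx⟩ => ?_
  exact mem_of_superset (Metric.isOpen_ball.mem_nhds hx) fun y hy => ⟨k, hk, hy⟩

theorem antitone_shrunkBalls (s : ℕ → X) (l : List ℕ) : Antitone (shrunkBalls s l) := by
  rintro ε ε' h x ⟨k, hk, hx⟩
  refine ⟨k, hk, hx.trans_le ?_⟩
  gcongr

theorem thickening_shrunkBalls_subset (s : ℕ → X) (l : List ℕ) (δ ε : ℚ) :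
    Metric.thickening (ε : ℝ) (shrunkBalls s l (δ + ε)) ⊆ shrunkBalls s l δ := by
  intro x hx
  obtain ⟨y, ⟨k, hk, hy⟩, hxy⟩ := Metric.mem_thickening_iff.1 hx
  refine ⟨k, hk, ?_⟩
  have := dist_triangle x y (s k.unpair.1)
  push_cast at hy ⊢
  linarith

theorem iUnion_shrunkBalls (s : ℕ → X) (l : List ℕ) (δ : ℚ) {ε : ℕ → ℚ} (hε_nonneg : ∀ n, 0 ≤ ε n)
    (hε : Tendsto (fun n => (ε n : ℝ)) atTop (𝓝 0)) :
    ⋃ n, shrunkBalls s l (δ + ε n) = shrunkBalls s l δ := by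
  refine Set.Subset.antisymm
    (Set.iUnion_subset fun n => antitone_shrunkBalls s l (le_add_of_nonneg_right (hε_nonneg n))) ?_
  rintro x ⟨k, hk, hx⟩
  push_cast at hx
  obtain ⟨n, hn⟩ := (hε.eventually_lt_const
    (show (0 : ℝ) < posRatNum k.unpair.2 - δ - dist x (s k.unpair.1) by linarith)).exists
  refine Set.mem_iUnion.2 ⟨n, k, hk, ?_⟩
  push_cast
  linarith

variable [MeasurableSpace X] {s : ℕ → X}

theorem tendsto_measureReal_shrunkBalls (μ : Measure X) [IsFiniteMeasure μ] (l : List ℕ) (δ : ℚ)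
    {ε : ℕ → ℚ} (hε_nonneg : ∀ n, 0 ≤ ε n) (hε_anti : Antitone ε)
    (hε : Tendsto (fun n => (ε n : ℝ)) atTop (𝓝 0)) :
    Tendsto (fun n => μ.real (shrunkBalls s l (δ + ε n))) atTop
      (𝓝 (μ.real (shrunkBalls s l δ))) := by
  have hmono : Monotone fun n => shrunkBalls s l (δ + ε n) := fun m n hmn =>
    antitone_shrunkBalls s l (by gcongr; exact hε_anti hmn)
  have hlim := tendsto_measure_iUnion_atTop (μ := μ) hmono
  rw [iUnion_shrunkBalls s l δ hε_nonneg hε] at hlim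
  exact (ENNReal.tendsto_toReal (measure_ne_top _ _)).comp hlim

variable [BorelSpace X]

theorem measureReal_le_of_levyProkhorov_dist_lt {μ ν : ProbabilityMeasure X} {ε : ℝ}
    (h : dist (LevyProkhorov.ofMeasure μ) (LevyProkhorov.ofMeasure ν) < ε) {B : Set X}
    (hB : MeasurableSet B) :
    (μ : Measure X).real B ≤ (ν : Measure X).real (Metric.thickening ε B) + ε := by
  have hε : 0 < ε := dist_nonneg.trans_lt h
  have hedist : levyProkhorovEDist (μ : Measure X) (ν : Measure X) < ENNReal.ofReal ε :=
    (ENNReal.lt_ofReal_iff_toReal_lt (levyProkhorovEDist_ne_top _ _)).2 h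
  have hle := left_measure_le_of_levyProkhorovEDist_lt hedist hB
  rw [ENNReal.toReal_ofReal hε.le] at hle
  have hle_real := ENNReal.toReal_mono (by simp) hle
  rwa [ENNReal.toReal_add (by simp) (by simp), ENNReal.toReal_ofReal hε.le] at hle_real

theorem measureReal_shrunkBalls_le {μ ν : ProbabilityMeasure X} {ε : ℚ}
    (h : dist (LevyProkhorov.ofMeasure μ) (LevyProkhorov.ofMeasure ν) < ε) (l : List ℕ) (δ : ℚ) :
    (μ : Measure X).real (shrunkBalls s l (δ + ε)) ≤
      (ν : Measure X).real (shrunkBalls s l δ) + ε :=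
  (measureReal_le_of_levyProkhorov_dist_lt h (isOpen_shrunkBalls s l _).measurableSet).trans
    (add_le_add_left (measureReal_mono (thickening_shrunkBalls_subset s l δ ε)) _)

theorem rePred_lt_idealMeasure (hs : SemidecidableDistLT s) :
    REPred fun p : (ℕ × List ℕ) × ℚ × ℚ =>
      (p.2.1 : ℝ) < (idealMeasure s p.1.1 : Measure X).real (shrunkBalls s p.1.2 p.2.2) := by
  classical
  let inBalls : ((ℕ × List ℕ) × ℚ × ℚ) × ℕ → Prop := fun r =>
    s (weightEntry r.1.1.1 r.2).1 ∈ shrunkBalls s r.1.1.2 r.1.2.2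
  have hinBalls : REPred inBalls := rePred_exists_mem
    (l := fun r : ((ℕ × List ℕ) × ℚ × ℚ) × ℕ => r.1.1.2) (by fun_prop)
    (rePred_comp hs (f := fun t : (((ℕ × List ℕ) × ℚ × ℚ) × ℕ) × ℕ =>
      (((weightEntry t.1.1.1.1 t.1.2).1, t.2.unpair.1), posRatNum t.2.unpair.2 - t.1.1.2.2))
      (by fun_prop))
  have htotal : Computable fun p : (ℕ × List ℕ) × ℚ × ℚ =>
      ∑ i ∈ Finset.range (weightList p.1.1).length, ((weightEntry p.1.1 i).2 + 1 : ℚ) :=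
    computable_sum_range (f := fun r : ((ℕ × List ℕ) × ℚ × ℚ) × ℕ =>
      ((weightEntry r.1.1.1 r.2).2 + 1 : ℚ)) (by fun_prop) (by fun_prop)
  refine (rePred_lt_sum_range hinBalls
    (w := fun r : ((ℕ × List ℕ) × ℚ × ℚ) × ℕ => ((weightEntry r.1.1.1 r.2).2 + 1 : ℚ))
    (n := fun p : (ℕ × List ℕ) × ℚ × ℚ => (weightList p.1.1).length)
    (q := fun p : (ℕ × List ℕ) × ℚ × ℚ =>
      p.2.1 * ∑ i ∈ Finset.range (weightList p.1.1).length, ((weightEntry p.1.1 i).2 + 1 : ℚ))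
    (by fun_prop) (fun r => by positivity) (by fun_prop) (by fun_prop)).of_eq fun p => ?_
  rw [idealMeasure_real_apply s _ (isOpen_shrunkBalls s _ _).measurableSet, lt_div_iff₀,
    ← Rat.cast_lt (K := ℝ)]
  · push_cast [apply_ite (Rat.cast (K := ℝ))]
    rfl
  · exact Finset.sum_pos (fun i _ => by positivity) ⟨0, by simp [weightList]⟩

theorem IsComputableMeasure.rePred_lt_measureReal_shrunkBalls (hs : SemidecidableDistLT s)
    {μ : ProbabilityMeasure X} (hμ : IsComputableMeasure s μ) :
    REPred fun p : List ℕ × ℚ × ℚ =>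
      (p.2.1 : ℝ) < (μ : Measure X).real (shrunkBalls s p.1 p.2.2) := by
  obtain ⟨σ, hσ, hname⟩ := hμ
  let ε : ℕ → ℚ := fun n => 4 * (1 / 2) ^ n
  have hdist : ∀ n, dist (LevyProkhorov.ofMeasure (idealMeasure s (σ n)))
      (LevyProkhorov.ofMeasure μ) < ε n := fun n => by
    refine (dist_le_of_cauchyRep hname n).trans_lt ?_
    push_cast [ε]
    linarith [show (0 : ℝ) < (1 / 2) ^ n by positivity]
  have hε_nonneg : ∀ n, 0 ≤ ε n := fun n => by positivity
  have hε_anti : Antitone ε := fun m n hmn => mul_le_mul_of_nonneg_left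
    (pow_le_pow_of_le_one (by norm_num) (by norm_num) hmn) (by norm_num)
  have hε_lim : Tendsto (fun n => (ε n : ℝ)) atTop (𝓝 0) := by
    simpa [ε] using tendsto_one_half_pow.const_mul 4
  have hre := rePred_comp (rePred_lt_idealMeasure hs) (f := fun r : (List ℕ × ℚ × ℚ) × ℕ =>
    ((σ r.2, r.1.1), r.1.2.1 + ε r.2, r.1.2.2 + ε r.2)) (by fun_prop)
  refine (rePred_exists hre).of_eq ?_
  rintro ⟨l, q, δ⟩
  dsimp only
  constructor
  · rintro ⟨n, hn⟩
    rw [Rat.cast_add] at hn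
    linarith [measureReal_shrunkBalls_le (s := s) (hdist n) l δ]
  · intro hlt
    have hlim := (tendsto_measureReal_shrunkBalls (s := s) (μ : Measure X) l δ
      (ε := fun n => 2 * ε n) (fun n => by linarith [hε_nonneg n])
      (hε_anti.const_mul (by norm_num)) (by simpa using hε_lim.const_mul 2)).sub
        (hε_lim.const_mul 2)
    rw [mul_zero, sub_zero] at hlim
    obtain ⟨n, hn⟩ := (hlim.eventually_const_lt hlt).exists
    have hle := measureReal_shrunkBalls_le (s := s) (by rw [dist_comm]; exact hdist n) l (δ + ε n)
    rw [add_assoc, ← two_mul] at hle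
    refine ⟨n, ?_⟩
    push_cast
    linarith

end ShrunkBalls

/-! ### Randomness tests and recursively enumerable families of step functions -/

theorem computable_initialWord {σ : ℕ → ℕ} (hσ : Computable σ) : Computable (initialWord σ) :=
  computable_map_range (α := ℕ) (n := fun n => n) (f := fun q => σ q.2) (by fun_prop) (by fun_prop)

theorem lintegral_tsum_two_pow_indicator_le_one {X : Type*} [MeasurableSpace X]
    {μ : Measure X} {V : ℕ → Set X} (hV : ∀ m, MeasurableSet (V m))
    (hμV : ∀ m, μ (V m) ≤ 4⁻¹ ^ (m + 1)) :
    ∫⁻ y, ∑' m, (V m).indicator (fun _ => (2 : ℝ≥0∞) ^ m) y ∂μ ≤ 1 := by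
  have hterm : ∀ m, ∫⁻ y, (V m).indicator (fun _ => (2 : ℝ≥0∞) ^ m) y ∂μ ≤
      2⁻¹ ^ (m + 1) := fun m => by
    have hfour : (4⁻¹ : ℝ≥0∞) = 2⁻¹ * 2⁻¹ := by
      rw [← ENNReal.mul_inv (by simp) (by simp)]
      norm_num
    calc ∫⁻ y, (V m).indicator (fun _ => (2 : ℝ≥0∞) ^ m) y ∂μ
        = 2 ^ m * μ (V m) := lintegral_indicator_const (hV m) _
      _ ≤ 2 ^ m * 4⁻¹ ^ (m + 1) := mul_le_mul_right (hμV m) _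
      _ = (2 * 2⁻¹) ^ m * 2⁻¹ * 2⁻¹ ^ (m + 1) := by rw [hfour]; ring
      _ ≤ 2⁻¹ ^ (m + 1) := by
        rw [ENNReal.mul_inv_cancel (by simp) (by simp), one_pow, one_mul]
        exact mul_le_of_le_one_left' (by simp)
  rw [lintegral_tsum fun m => (measurable_const.indicator (hV m)).aemeasurable]
  calc ∑' m, ∫⁻ y, (V m).indicator (fun _ => (2 : ℝ≥0∞) ^ m) y ∂μ
      ≤ ∑' m : ℕ, 2⁻¹ ^ (m + 1) := ENNReal.tsum_le_tsum hterm
    _ = 1 := by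
      rw [ENNReal.tsum_geometric_add_one, ENNReal.one_sub_inv_two, inv_inv,
        ENNReal.inv_mul_cancel (by simp) (by simp)]

section Tests

variable {X : Type*} [MetricSpace X] [MeasurableSpace X] [BorelSpace X] {s : ℕ → X}
  {μ : ProbabilityMeasure X} {x : X}

theorem isRandomnessTest_of_rePred {T : ℕ → Prop} (hT : REPred T)
    (hInt : ∫⁻ x, (⨆ (k : ℕ) (_ : T k), stepFunction s k) x ∂(μ : Measure X) ≤ 1) :
    IsRandomnessTest s μ (⨆ (k : ℕ) (_ : T k), stepFunction s k) := by
  obtain ⟨σ, hσ, hσT⟩ := exists_enumeration_of_rePred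
    (rePred_comp hT (f := fun q : Unit × ℕ => q.2) (by fun_prop))
  have hσ' : Computable (σ ()) := hσ.comp (Computable.const ()) Computable.id
  refine ⟨⟨fun _ => ⨆ (k : ℕ) (_ : T k), stepFunction s k, ⟨fun _ => σ (),
    ⟨fun u => initialWord (σ ()) u.length, ?_, ?_, fun τ _ => ⟨fun m => ⟨m, ?_⟩, fun n => ⟨n, ?_⟩⟩⟩,
    ?_⟩, rfl⟩, hInt⟩
  · exact (computable_initialWord hσ').comp (by fun_prop)
  · exact fun u v h => initialWord_prefix_initialWord _ h.length_le
  · simp only [length_initialWord]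
  · simp only [length_initialWord, List.prefix_rfl]
  · intro τ x _ _
    change _ = ⨆ (n : ℕ) (k : ℕ) (_ : σ () n = k + 1), stepFunction s k
    rw [iSup_comm]
    refine iSup_congr fun k => ?_
    rw [← iSup_exists (p := fun n => σ () n = k + 1) (f := fun _ => stepFunction s k)]
    exact iSup_congr_Prop (hσT () k) fun _ => rfl

theorem IsRandomnessTest.exists_rePred {t : X → ℝ≥0∞} (ht : IsRandomnessTest s μ t)
    (hμ : IsComputableMeasure s μ) :
    ∃ T : ℕ → Prop, REPred T ∧ t = ⨆ (k : ℕ) (_ : T k), stepFunction s k := by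
  obtain ⟨⟨f, ⟨F, ⟨Φ, hΦ, -, hlim⟩, hF⟩, rfl⟩, -⟩ := ht
  obtain ⟨σ, hσ, hname⟩ := hμ
  obtain ⟨hsound, hcomplete⟩ := hlim σ ⟨_, rfl, hname⟩
  have hword := computable_initialWord hσ
  have hre : REPred fun r : (ℕ × ℕ) × ℕ => (Φ (initialWord σ r.1.2))[r.2]? = some (r.1.1 + 1) :=
    rePred_eq (by fun_prop) (by fun_prop)
  refine ⟨_, rePred_exists (rePred_exists hre), ?_⟩
  have hrep : f _ = ⨆ (n : ℕ) (k : ℕ) (_ : F σ n = k + 1), stepFunction s k := hF σ _ rfl hname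
  rw [hrep, iSup_comm]
  refine iSup_congr fun k => ?_
  rw [← iSup_exists (p := fun n => F σ n = k + 1) (f := fun _ => stepFunction s k)]
  refine iSup_congr_Prop ⟨?_, ?_⟩ fun _ => rfl
  · rintro ⟨n, hn⟩
    obtain ⟨m, z, hz⟩ := hcomplete (n + 1)
    refine ⟨m, n, ?_⟩
    rw [← hz, List.getElem?_append_left (by rw [length_initialWord]; exact Nat.lt_succ_self n),
      getElem?_initialWord _ (Nat.lt_succ_self n), hn]
  · rintro ⟨m, n, h⟩
    obtain ⟨N, hN⟩ := hsound m
    have hprefix : Φ (initialWord σ m) <+: initialWord (F σ) N := by rw [hN]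
    exact ⟨n, (eq_of_prefix_initialWord_of_getElem? hprefix h).symm⟩

theorem IsRandom.exists_weight_le {α : Type*} [Primcodable α] (hx : IsRandom s μ x)
    {R : α × ℕ → Prop} (hR : REPred R) {g : α → ℚ} (hg : Computable g) (hg_pos : ∀ a, 0 < g a)
    {h : X → ℝ≥0∞} (hInt : ∫⁻ y, h y ∂(μ : Measure X) ≤ 1)
    (hle : ∀ a, ∀ y ∈ ballUnion s (fun k => R (a, k)), ENNReal.ofReal (g a) ≤ h y) :
    ∃ M : ℝ≥0∞, M ≠ ∞ ∧ ∀ a, x ∈ ballUnion s (fun k => R (a, k)) → ENNReal.ofReal (g a) ≤ M := by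
  have hre : REPred fun r : ℕ × α => R (r.2, r.1.unpair.1) ∧ posRatNum r.1.unpair.2 = g r.2 :=
    rePred_and (rePred_comp hR (by fun_prop)) (rePred_eq (by fun_prop) (by fun_prop))
  have htest := isRandomnessTest_of_rePred (s := s) (μ := μ) (rePred_exists hre) <| by
    refine (lintegral_mono fun y => ?_).trans hInt
    simp only [iSup_apply]
    refine iSup_le fun k => iSup_le fun ⟨a, ha, hk⟩ => ?_
    by_cases hy : y ∈ idealBall s k.unpair.1
    · rw [stepFunction, Set.indicator_of_mem hy, hk]
      exact hle a y ⟨_, ha, hy⟩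
    · rw [stepFunction, Set.indicator_of_notMem hy]
      exact zero_le
  refine ⟨_, fun htop => hx {y | _ = ∞} ⟨_, htest, subset_rfl⟩ htop, fun a ⟨k, hk, hxk⟩ => ?_⟩
  obtain ⟨j, hj⟩ := exists_posRatNum_eq (hg_pos a)
  simp only [iSup_apply]
  refine le_iSup_of_le (Nat.pair k j) (le_iSup_of_le ⟨a, by simpa using hk, by simpa using hj⟩ ?_)
  rw [stepFunction, Nat.unpair_pair, Set.indicator_of_mem hxk, hj]

theorem IsRandom.exists_notMem_ballUnion (hx : IsRandom s μ x) {R : ℕ × ℕ → Prop} (hR : REPred R)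
    (hμR : ∀ m, (μ : Measure X) (ballUnion s fun k => R (m, k)) ≤ 4⁻¹ ^ (m + 1)) :
    ∃ m, x ∉ ballUnion s fun k => R (m, k) := by
  by_contra! hmem
  have hcast : ∀ m : ℕ, ENNReal.ofReal ((2 ^ m : ℚ) : ℝ) = 2 ^ m := fun m => by
    push_cast
    rw [ENNReal.ofReal_pow (by norm_num), ENNReal.ofReal_ofNat]
  obtain ⟨M, hM, hbound⟩ := hx.exists_weight_le hR (g := fun m => 2 ^ m) (by fun_prop)
    (fun m => by positivity) (lintegral_tsum_two_pow_indicator_le_one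
      (fun m => (isOpen_ballUnion s fun k => R (m, k)).measurableSet) hμR) fun m y hy => by
        refine le_trans ?_ (ENNReal.le_tsum m)
        rw [Set.indicator_of_mem hy, hcast]
  obtain ⟨n, hn⟩ := ENNReal.exists_nat_gt hM
  have hpow : (n : ℝ≥0∞) ≤ 2 ^ n := by exact_mod_cast Nat.lt_two_pow_self.le
  exact (hpow.trans ((hcast n).symm.trans_le (hbound n (hmem n)))).not_gt hn

end Tests

section FarFromBalls

variable {X : Type*} [MetricSpace X] {s : ℕ → X}

/-- The ideal ball `j` is disjoint from all the balls `k ∈ l`, of radii diminished by `ε`, because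
of the distances of the centres. -/
def FarFromBalls (s : ℕ → X) (l : List ℕ) (ε : ℚ) (j : ℕ) : Prop :=
  ∀ k ∈ l, ((posRatNum k.unpair.2 - ε + posRatNum j.unpair.2 : ℚ) : ℝ) <
    dist (s j.unpair.1) (s k.unpair.1)

theorem rePred_farFromBalls (hs : IsComputableMetricSpace s) :
    REPred fun p : (List ℕ × ℚ) × ℕ => FarFromBalls s p.1.1 p.1.2 p.2 :=
  rePred_forall_mem (l := fun p : (List ℕ × ℚ) × ℕ => p.1.1) (by fun_prop)
    (rePred_comp hs.rePred_lt_dist (f := fun r : ((List ℕ × ℚ) × ℕ) × ℕ =>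
      ((r.1.2.unpair.1, r.2.unpair.1),
        posRatNum r.2.unpair.2 - r.1.1.2 + posRatNum r.1.2.unpair.2)) (by fun_prop))

theorem ballUnion_farFromBalls_subset (l : List ℕ) (ε : ℚ) :
    ballUnion s (FarFromBalls s l ε) ⊆ (shrunkBalls s l ε)ᶜ := by
  rintro y ⟨j, hj, hyj⟩ ⟨k, hk, hyk⟩
  have hfar := hj k hk
  rw [mem_idealBall] at hyj
  push_cast at hfar hyk
  linarith [dist_triangle_left (s j.unpair.1) (s k.unpair.1) y]

theorem mem_ballUnion_farFromBalls (hs : DenseRange s) {l : List ℕ} {ε : ℚ} (hε : 0 < ε) {x : X}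
    (hx : ∀ k ∈ l, x ∉ idealBall s k) : x ∈ ballUnion s (FarFromBalls s l ε) := by
  have hε' : (0 : ℝ) < ε := by exact_mod_cast hε
  obtain ⟨j, hj⟩ := hs.exists_dist_lt x (show (0 : ℝ) < ε / 4 by positivity)
  obtain ⟨i, hi⟩ := exists_posRatNum_eq (show 0 < ε / 4 by positivity)
  refine ⟨Nat.pair j i, fun k hk => ?_, ?_⟩
  · have hxk := hx k hk
    rw [mem_idealBall, not_lt] at hxk
    simp only [Nat.unpair_pair, hi]
    push_cast
    linarith [dist_triangle x (s j) (s k.unpair.1)]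
  · rw [mem_idealBall, Nat.unpair_pair, hi]
    exact_mod_cast hj

end FarFromBalls

theorem exists_lt_measureReal_shrunkBalls {X : Type*} [MetricSpace X] [MeasurableSpace X]
    {s : ℕ → X} {μ : Measure X} [IsFiniteMeasure μ] {S : ℕ → Prop} {c : ℝ}
    (hc : c < μ.real (ballUnion s S)) :
    ∃ b : List ℕ × ℕ, (∀ k ∈ b.1, S k) ∧
      c < μ.real (shrunkBalls s b.1 ((1 / 2) ^ b.2)) := by
  classical
  let stage : ℕ → Set X := fun N => shrunkBalls s ((List.range N).filter (S ·)) ((1 / 2) ^ N)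
  have hmono : Monotone stage := by
    rintro M N hMN y ⟨k, hk, hy⟩
    simp only [List.mem_filter, List.mem_range, decide_eq_true_eq] at hk
    refine ⟨k, by simpa using ⟨hk.1.trans_le hMN, hk.2⟩, hy.trans_le ?_⟩
    have hpow : (1 / 2 : ℚ) ^ N ≤ (1 / 2) ^ M :=
      pow_le_pow_of_le_one (by norm_num) (by norm_num) hMN
    exact_mod_cast sub_le_sub_left hpow _
  have hsub : ballUnion s S ⊆ ⋃ N, stage N := by
    rintro y ⟨k, hk, hy⟩
    obtain ⟨N, hN, hkN⟩ := ((tendsto_one_half_pow.eventually_lt_const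
      (sub_pos.2 (mem_idealBall.1 hy))).and (eventually_gt_atTop k)).exists
    refine Set.mem_iUnion.2 ⟨N, k, by simpa using ⟨hkN, hk⟩, ?_⟩
    push_cast
    linarith
  have hlim := (ENNReal.tendsto_toReal (measure_ne_top _ _)).comp
    (tendsto_measure_iUnion_atTop (μ := μ) hmono)
  obtain ⟨N, hN⟩ := (hlim.eventually_const_lt (hc.trans_le (measureReal_mono hsub))).exists
  exact ⟨((List.range N).filter (S ·), N), fun k hk => by simpa using (List.mem_filter.1 hk).2, hN⟩

section FullMeasure

variable {X : Type*} [MetricSpace X] [MeasurableSpace X] [BorelSpace X] {s : ℕ → X}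
  {μ : ProbabilityMeasure X}

theorem measure_ballUnion_farFromBalls_le {l : List ℕ} {ε : ℚ} {r : ℝ}
    (h : 1 - r < (μ : Measure X).real (shrunkBalls s l ε)) :
    (μ : Measure X) (ballUnion s (FarFromBalls s l ε)) ≤ ENNReal.ofReal r := by
  refine (measure_mono (ballUnion_farFromBalls_subset l ε)).trans ?_
  rw [← ofReal_measureReal, probReal_compl_eq_one_sub (isOpen_shrunkBalls _ _ _).measurableSet]
  exact ENNReal.ofReal_le_ofReal (by linarith)

theorem exists_computable_shrunkBalls (hX : IsComputableProbabilitySpace s μ) {S : ℕ → Prop}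
    (hS : REPred S) (hfull : (μ : Measure X) (ballUnion s S) = 1) :
    ∃ b : ℕ → List ℕ × ℕ, Computable b ∧ ∀ m, (∀ k ∈ (b m).1, S k) ∧
      1 - (1 / 4 : ℝ) ^ (m + 1) <
        (μ : Measure X).real (shrunkBalls s (b m).1 ((1 / 2) ^ (b m).2)) := by
  have hre : REPred fun q : ℕ × List ℕ × ℕ => (∀ k ∈ q.2.1, S k) ∧
      ((1 - (1 / 4) ^ (q.1 + 1) : ℚ) : ℝ) <
        (μ : Measure X).real (shrunkBalls s q.2.1 ((1 / 2) ^ q.2.2)) :=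
    rePred_and (rePred_forall_mem (l := fun q : ℕ × List ℕ × ℕ => q.2.1)
      (p := fun r : (ℕ × List ℕ × ℕ) × ℕ => S r.2) (by fun_prop) (rePred_comp hS (by fun_prop)))
      (rePred_comp (hX.measure.rePred_lt_measureReal_shrunkBalls hX.space.semidecidableDistLT)
        (f := fun q : ℕ × List ℕ × ℕ => (q.2.1, 1 - (1 / 4) ^ (q.1 + 1), (1 / 2) ^ q.2.2))
        (by fun_prop))
  have hex : ∀ m : ℕ, ∃ b : List ℕ × ℕ, (∀ k ∈ b.1, S k) ∧ ((1 - (1 / 4) ^ (m + 1) : ℚ) : ℝ) <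
      (μ : Measure X).real (shrunkBalls s b.1 ((1 / 2) ^ b.2)) := fun m =>
    exists_lt_measureReal_shrunkBalls <| by
      rw [measureReal_def, hfull, ENNReal.toReal_one]
      push_cast
      linarith [show (0 : ℝ) < (1 / 4) ^ (m + 1) by positivity]
  obtain ⟨b, hb, hspec⟩ := exists_computable_selector_of_rePred hre hex
  refine ⟨b, hb, fun m => ⟨(hspec m).1, ?_⟩⟩
  have hm := (hspec m).2
  push_cast at hm ⊢
  exact hm

/-- The points far from a finite part of `S` of measure more than `1 - 4⁻ᵐ⁻¹` form the `m`-th set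
of a Martin-Löf test covering the complement of `S`. -/
theorem IsRandom.mem_ballUnion {x : X} (hx : IsRandom s μ x)
    (hX : IsComputableProbabilitySpace s μ) {S : ℕ → Prop} (hS : REPred S)
    (hfull : (μ : Measure X) (ballUnion s S) = 1) : x ∈ ballUnion s S := by
  by_contra hxS
  obtain ⟨b, hb, hbS⟩ := exists_computable_shrunkBalls hX hS hfull
  have hfar : REPred fun q : ℕ × ℕ => FarFromBalls s (b q.1).1 ((1 / 2) ^ (b q.1).2) q.2 :=
    rePred_comp (rePred_farFromBalls hX.space)
      (f := fun q : ℕ × ℕ => (((b q.1).1, (1 / 2 : ℚ) ^ (b q.1).2), q.2)) (by fun_prop)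
  obtain ⟨m, hm⟩ := hx.exists_notMem_ballUnion hfar fun m => by
    refine (measure_ballUnion_farFromBalls_le (hbS m).2).trans_eq ?_
    rw [ENNReal.ofReal_pow (by norm_num), one_div, ENNReal.ofReal_inv_of_pos (by norm_num),
      ENNReal.ofReal_ofNat]
  have hxfar : x ∈ ballUnion s (FarFromBalls s (b m).1 ((1 / 2) ^ (b m).2)) :=
    mem_ballUnion_farFromBalls hX.space.dense (pow_pos one_half_pos _) fun k hk hxk =>
      hxS ⟨k, (hbS m).1 k hk, hxk⟩
  exact hm hxfar

end FullMeasure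

theorem IsRandom.mem_of_isPi02 {X : Type*} [MetricSpace X] [MeasurableSpace X] [BorelSpace X]
    {s : ℕ → X} {μ : ProbabilityMeasure X} {x : X} (hx : IsRandom s μ x)
    (hX : IsComputableProbabilitySpace s μ) {D : Set X} (hD : IsPi02 s D)
    (hfull : (μ : Measure X) D = 1) : x ∈ D := by
  obtain ⟨S, hS, hDS⟩ := hD.exists_rePred
  refine (hDS x).2 fun n =>
    hx.mem_ballUnion hX (rePred_comp hS (f := fun k => (n, k)) (by fun_prop)) ?_
  refine le_antisymm prob_le_one ?_
  rw [← hfull]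
  exact measure_mono fun y hy => (hDS y).1 hy n

/-! ### Words and cylinders -/

theorem initialWord_eq_iff {α : Type*} {σ τ : ℕ → α} {n : ℕ} :
    initialWord σ n = initialWord τ n ↔ ∀ i < n, σ i = τ i := by
  simp [initialWord, List.map_inj_left]

theorem take_initialWord {α : Type*} (σ : ℕ → α) {i n : ℕ} (h : i ≤ n) :
    (initialWord σ n).take i = initialWord σ i := by
  rw [initialWord, initialWord, ← List.map_take, List.take_range, min_eq_left h]

/-- The cylinder `[w]`: the binary sequences that begin with the word `w`. -/
def wordCylinder (w : List Bool) : Set (ℕ → Bool) := {ω | initialWord ω w.length = w}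

theorem mem_wordCylinder {ω : ℕ → Bool} {w : List Bool} :
    ω ∈ wordCylinder w ↔ initialWord ω w.length = w := Iff.rfl

theorem mem_wordCylinder_initialWord {ω ω' : ℕ → Bool} {n : ℕ} :
    ω ∈ wordCylinder (initialWord ω' n) ↔ ∀ i < n, ω i = ω' i := by
  rw [mem_wordCylinder, length_initialWord, initialWord_eq_iff]

theorem cylinder_eq_wordCylinder (ω : ℕ → Bool) (n : ℕ) :
    PiNat.cylinder ω n = wordCylinder (initialWord ω n) :=
  Set.ext fun _ => mem_wordCylinder_initialWord.symm

theorem mem_wordCylinder_iff_getElem? {ω : ℕ → Bool} {w : List Bool} :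
    ω ∈ wordCylinder w ↔ ∀ i < w.length, w[i]?.getD false = ω i := by
  rw [mem_wordCylinder]
  refine ⟨fun h i hi => ?_, fun h => List.ext_getElem? fun i => ?_⟩
  · rw [← h, getElem?_initialWord ω hi, Option.getD_some]
  · by_cases hi : i < w.length
    · rw [getElem?_initialWord ω hi, ← h i hi, List.getElem?_eq_getElem hi, Option.getD_some]
    · rw [List.getElem?_eq_none (by rw [length_initialWord]; omega),
        List.getElem?_eq_none (by omega)]

theorem measurableSet_wordCylinder (w : List Bool) : MeasurableSet (wordCylinder w) := by
  have hw : wordCylinder w =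
      ⋂ i : Fin w.length, (fun ω : ℕ → Bool => ω i) ⁻¹' {w[(i : ℕ)]?.getD false} := by
    ext ω
    simp only [mem_wordCylinder_iff_getElem?, Set.mem_iInter, Set.mem_preimage,
      Set.mem_singleton_iff, Fin.forall_iff, eq_comm]
  rw [hw]
  exact MeasurableSet.iInter fun i => measurable_pi_apply _ (measurableSet_singleton _)

theorem prefix_or_prefix_of_mem_wordCylinder {ω : ℕ → Bool} {v w : List Bool}
    (hv : ω ∈ wordCylinder v) (hw : ω ∈ wordCylinder w) : v <+: w ∨ w <+: v := by
  rw [← mem_wordCylinder.1 hv, ← mem_wordCylinder.1 hw]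
  exact (le_total v.length w.length).imp (initialWord_prefix_initialWord ω)
    (initialWord_prefix_initialWord ω)

theorem exists_list_compl_wordCylinder (w : List Bool) :
    ∃ l : List (List Bool), (∀ v ∈ l, v.length = w.length ∧ v ≠ w) ∧
      (wordCylinder w)ᶜ = ⋃ v ∈ l, wordCylinder v := by
  have hfin : {v : List Bool | v.length = w.length ∧ v ≠ w}.Finite :=
    (List.finite_length_eq Bool w.length).subset fun v hv => hv.1
  refine ⟨hfin.toFinset.toList, by simp, Set.ext fun ω => ?_⟩
  simp only [Set.mem_compl_iff, mem_wordCylinder, Finset.mem_toList, Set.Finite.mem_toFinset,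
    Set.mem_ofPred_eq, Set.mem_iUnion, exists_prop]
  refine ⟨fun hω => ⟨_, ⟨length_initialWord ω _, hω⟩, by rw [length_initialWord]⟩, ?_⟩
  rintro ⟨v, ⟨hlen, hne⟩, hv⟩ hω
  exact hne (by rw [← hv, hlen, hω])

theorem tsum_measure_wordCylinder_le {ν : Measure (ℕ → Bool)} {P : List Bool → Prop}
    (hP : ∀ v w, P v → P w → v <+: w → v = w) {W : Set (ℕ → Bool)}
    (hW : ∀ w, P w → wordCylinder w ⊆ W) : ∑' w : {w // P w}, ν (wordCylinder w) ≤ ν W := by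
  refine (tsum_meas_le_meas_iUnion_of_disjoint ν (fun w => measurableSet_wordCylinder _) ?_).trans
    (measure_mono (Set.iUnion_subset fun w => hW _ w.2))
  intro v w hvw
  refine Set.disjoint_left.2 fun ω hv hw => hvw (Subtype.ext ?_)
  rcases prefix_or_prefix_of_mem_wordCylinder hv hw with h | h
  · exact hP _ _ v.2 w.2 h
  · exact (hP _ _ w.2 v.2 h).symm

theorem uniquelyDecodable_of_prefixFree {α : Type*} {S : Set (List α)} (hnil : [] ∉ S)
    (hS : ∀ p ∈ S, ∀ q ∈ S, p <+: q → p = q) : InformationTheory.UniquelyDecodable S := by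
  intro l
  induction l with
  | nil =>
    rintro (_ | ⟨b, l'⟩) - h' heq
    · rfl
    · simp only [List.flatten_nil, List.flatten_cons, List.nil_eq, List.append_eq_nil_iff] at heq
      exact (hnil (heq.1 ▸ h' b (by simp))).elim
  | cons a l ih =>
    rintro (_ | ⟨b, l'⟩) h h' heq
    · simp only [List.flatten_nil, List.flatten_cons, List.append_eq_nil_iff] at heq
      exact (hnil (heq.1 ▸ h a (by simp))).elim
    · rw [List.forall_mem_cons] at h h'
      simp only [List.flatten_cons] at heq
      obtain rfl : a = b := by
        rcases List.prefix_or_prefix_of_prefix (List.prefix_append a l.flatten)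
          (heq ▸ List.prefix_append b l'.flatten) with hab | hba
        · exact hS a h.1 b h'.1 hab
        · exact (hS b h'.1 a h.1 hba).symm
      rw [List.append_cancel_left_eq] at heq
      rw [ih l' h.2 h'.2 heq]

theorem tsum_two_pow_neg_length_le_one {S : Set (List Bool)}
    (hS : ∀ p ∈ S, ∀ q ∈ S, p <+: q → p = q) : ∑' p : S, (1 / 2 : ℝ≥0∞) ^ p.1.length ≤ 1 := by
  by_cases hnil : [] ∈ S
  · obtain rfl : S = {[]} :=
      Set.eq_singleton_iff_unique_mem.2 ⟨hnil, fun p hp => (hS _ hnil p hp List.nil_prefix).symm⟩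
    rw [tsum_singleton ([] : List Bool) fun p => (1 / 2 : ℝ≥0∞) ^ p.length]
    simp
  · rw [ENNReal.tsum_eq_iSup_sum]
    refine iSup_le fun F => ?_
    have hkraft := ENNReal.ofReal_le_ofReal <| InformationTheory.kraft_mcmillan_inequality
      (S := F.map (Function.Embedding.subtype _)) <| uniquelyDecodable_of_prefixFree
        (by simp [hnil]) (by simpa using fun p hp _ q hq _ => hS p hp q hq)
    rw [Finset.sum_map, ENNReal.ofReal_sum_of_nonneg fun i _ => by positivity,
      ENNReal.ofReal_one] at hkraft
    refine (Finset.sum_congr rfl fun p _ => ?_).trans_le hkraft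
    rw [ENNReal.ofReal_pow (by positivity)]
    simp [ENNReal.ofReal_inv_of_pos]

/-! ### Recursively enumerable open sets of Cantor space -/

@[fun_prop]
theorem computable_testBit {α : Type*} [Primcodable α] {f g : α → ℕ} (hf : Computable f)
    (hg : Computable g) : Computable fun a => (f a).testBit (g a) := by
  simp only [Nat.testBit_eq_decide_div_mod_eq]
  exact computable_decide_eq (by fun_prop) (by fun_prop)

theorem cantor_dist_le_iff {ω ω' : ℕ → Bool} {n : ℕ} :
    dist ω ω' ≤ (1 / 2 : ℝ) ^ n ↔ ∀ i < n, ω i = ω' i :=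
  (PiNat.mem_cylinder_iff_dist_le (E := fun _ => Bool)).symm

theorem cantor_dist_lt_iff {ω ω' : ℕ → Bool} {q : ℝ} :
    dist ω ω' < q ↔ ∃ n : ℕ, (1 / 2 : ℝ) ^ n < q ∧ ∀ i < n, ω i = ω' i := by
  refine ⟨fun h => ?_, fun ⟨n, hn, h⟩ => (cantor_dist_le_iff.2 h).trans_lt hn⟩
  rcases eq_or_ne ω ω' with rfl | hne
  · rw [dist_self] at h
    obtain ⟨n, hn⟩ := exists_pow_lt_of_lt_one h (show (1 / 2 : ℝ) < 1 by norm_num)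
    exact ⟨n, hn, fun _ _ => rfl⟩
  · have hdist : dist ω ω' = (1 / 2 : ℝ) ^ PiNat.firstDiff ω ω' := PiNat.dist_eq_of_ne hne
    exact ⟨PiNat.firstDiff ω ω', hdist ▸ h, cantor_dist_le_iff.1 hdist.le⟩

theorem cantor_dist_lt_two_mul_pow_iff {ω ω' : ℕ → Bool} {n : ℕ} :
    dist ω ω' < 2 * (1 / 2 : ℝ) ^ n ↔ ∀ i < n, ω i = ω' i := by
  have hpos : (0 : ℝ) < (1 / 2) ^ n := by positivity
  refine ⟨fun h i hi => ?_, fun h => (cantor_dist_le_iff.2 h).trans_lt (by linarith)⟩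
  obtain ⟨m, hm, hagree⟩ := cantor_dist_lt_iff.1 h
  refine hagree i (hi.trans_le ?_)
  by_contra! hmn
  have hpow : (1 / 2 : ℝ) ^ n ≤ (1 / 2) ^ (m + 1) :=
    pow_le_pow_of_le_one (by norm_num) (by norm_num) hmn
  rw [pow_succ] at hpow
  linarith

theorem semidecidableDistLT_cantorIdeal : SemidecidableDistLT cantorIdeal := by
  have hre : REPred fun r : ((ℕ × ℕ) × ℚ) × ℕ => (1 / 2) ^ r.2 < r.1.2 ∧
      ∀ i < r.2, r.1.1.1.testBit i = r.1.1.2.testBit i :=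
    rePred_and (rePred_rat_lt (by fun_prop) (by fun_prop)) (rePred_forall_lt
      (p := fun r : (((ℕ × ℕ) × ℚ) × ℕ) × ℕ => r.1.1.1.1.testBit r.2 = r.1.1.1.2.testBit r.2)
      (by fun_prop) (rePred_eq (by fun_prop) (by fun_prop)))
  refine (rePred_exists hre).of_eq fun p => ?_
  rw [cantor_dist_lt_iff]
  refine exists_congr fun n => and_congr ?_ Iff.rfl
  rw [← Rat.cast_lt (K := ℝ)]
  push_cast
  rfl

theorem exists_cantorIdeal_mem_wordCylinder (w : List Bool) :
    ∃ n, cantorIdeal n ∈ wordCylinder w := by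
  refine ⟨Nat.ofBits fun i : Fin w.length => w[(i : ℕ)],
    mem_wordCylinder_iff_getElem?.2 fun i hi => ?_⟩
  rw [cantorIdeal, Nat.testBit_ofBits_lt _ _ hi, List.getElem?_eq_getElem hi, Option.getD_some]

theorem denseRange_cantorIdeal : DenseRange cantorIdeal := by
  refine Metric.denseRange_iff.2 fun ω r hr => ?_
  obtain ⟨n, hn⟩ := exists_pow_lt_of_lt_one hr (show (1 / 2 : ℝ) < 1 by norm_num)
  obtain ⟨k, hk⟩ := exists_cantorIdeal_mem_wordCylinder (initialWord ω n)
  exact ⟨k, cantor_dist_lt_iff.2 ⟨n, hn, fun i hi => (mem_wordCylinder_initialWord.1 hk i hi).symm⟩⟩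

theorem exists_computable_idealBall_eq_wordCylinder : ∃ code : List Bool → ℕ, Computable code ∧
    ∀ w, idealBall cantorIdeal (code w) = wordCylinder w := by
  have hre : REPred fun q : List Bool × ℕ =>
      (∀ i < q.1.length, q.1[i]?.getD false = q.2.unpair.1.testBit i) ∧
        posRatNum q.2.unpair.2 = 2 * (1 / 2) ^ q.1.length :=
    rePred_and (rePred_forall_lt (p := fun r : (List Bool × ℕ) × ℕ =>
      r.1.1[r.2]?.getD false = r.1.2.unpair.1.testBit r.2) (by fun_prop)
      (rePred_eq (by fun_prop) (by fun_prop))) (rePred_eq (by fun_prop) (by fun_prop))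
  have hex : ∀ w : List Bool, ∃ k : ℕ,
      (∀ i < w.length, w[i]?.getD false = k.unpair.1.testBit i) ∧
        posRatNum k.unpair.2 = 2 * (1 / 2) ^ w.length := fun w => by
    obtain ⟨n, hn⟩ := exists_cantorIdeal_mem_wordCylinder w
    obtain ⟨j, hj⟩ := exists_posRatNum_eq (q := 2 * (1 / 2) ^ w.length) (by positivity)
    exact ⟨Nat.pair n j, by simpa [cantorIdeal] using mem_wordCylinder_iff_getElem?.1 hn,
      by simpa using hj⟩
  obtain ⟨code, hcode, hspec⟩ := exists_computable_selector_of_rePred hre hex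
  refine ⟨code, hcode, fun w => Set.ext fun ω => ?_⟩
  obtain ⟨hcentre, hradius⟩ := hspec w
  rw [mem_idealBall, hradius, mem_wordCylinder_iff_getElem?]
  push_cast
  rw [cantor_dist_lt_two_mul_pow_iff]
  exact forall₂_congr fun i hi => by rw [hcentre i hi, eq_comm, cantorIdeal]

/-- The cylinder of `w` is contained in the ideal ball `k` because `2 ^ (-|w|)` is less than the
radius. -/
def WordInBall (k : ℕ) (w : List Bool) : Prop :=
  (1 / 2) ^ w.length < posRatNum k.unpair.2 ∧
    ∀ i < w.length, w[i]?.getD false = k.unpair.1.testBit i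

theorem rePred_wordInBall : REPred fun q : ℕ × List Bool => WordInBall q.1 q.2 :=
  rePred_and (rePred_rat_lt (by fun_prop) (by fun_prop)) (rePred_forall_lt
    (p := fun r : (ℕ × List Bool) × ℕ => r.1.2[r.2]?.getD false = r.1.1.unpair.1.testBit r.2)
    (by fun_prop) (rePred_eq (by fun_prop) (by fun_prop)))

theorem mem_idealBall_cantorIdeal_iff {ω : ℕ → Bool} {k : ℕ} :
    ω ∈ idealBall cantorIdeal k ↔ ∃ n, WordInBall k (initialWord ω n) := by
  rw [mem_idealBall, cantor_dist_lt_iff]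
  refine exists_congr fun n => ?_
  rw [WordInBall, length_initialWord, ← Rat.cast_lt (K := ℝ)]
  push_cast
  refine and_congr Iff.rfl (forall₂_congr fun i hi => ?_)
  rw [getElem?_initialWord ω hi, Option.getD_some, cantorIdeal]

section PrefixFree

variable {α : Type*} [Primcodable α]

theorem exists_rePred_words {R : α × ℕ → Prop} (hR : REPred R) :
    ∃ Q : α × List Bool → Prop, REPred Q ∧ ∀ a ω,
      ω ∈ ballUnion cantorIdeal (fun k => R (a, k)) ↔ ∃ n, Q (a, initialWord ω n) := by
  have hre : REPred fun r : (α × List Bool) × ℕ => R (r.1.1, r.2) ∧ WordInBall r.2 r.1.2 :=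
    rePred_and (rePred_comp hR (f := fun r : (α × List Bool) × ℕ => (r.1.1, r.2)) (by fun_prop))
      (rePred_comp rePred_wordInBall (f := fun r : (α × List Bool) × ℕ => (r.2, r.1.2))
        (by fun_prop))
  refine ⟨_, rePred_exists hre, fun a ω => ⟨?_, ?_⟩⟩
  · rintro ⟨k, hk, hω⟩
    obtain ⟨n, hn⟩ := mem_idealBall_cantorIdeal_iff.1 hω
    exact ⟨n, k, hk, hn⟩
  · rintro ⟨n, k, hk, hn⟩
    exact ⟨k, hk, mem_idealBall_cantorIdeal_iff.2 ⟨n, hn⟩⟩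

/-- A word counts as accepted once one of its prefixes has been enumerated within as many stages
as the word has letters. -/
theorem exists_computable_words_of_rePred {Q : α × List Bool → Prop} (hQ : REPred Q) :
    ∃ A : α × List Bool → Bool, Computable A ∧ ∀ a (ω : ℕ → Bool),
      (∃ n, Q (a, initialWord ω n)) ↔ ∃ n, A (a, initialWord ω n) = true := by
  obtain ⟨f, hf, hfQ⟩ := rePred_iff_exists_stage.1 hQ
  have hinner : Computable fun r : (α × List Bool) × ℕ =>
      decide (∀ j < r.1.2.length + 1, (!f ((r.1.1, r.1.2.take r.2), j)) = true) :=
    computable_decide_forall_lt (f := fun t : ((α × List Bool) × ℕ) × ℕ =>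
      !f ((t.1.1.1, t.1.1.2.take t.1.2), t.2)) (by fun_prop) (by fun_prop)
  have houter := computable_decide_forall_lt (n := fun q : α × List Bool => q.2.length + 1)
    (by fun_prop) hinner
  refine ⟨_, computable_not.comp houter, fun a ω => ?_⟩
  have haccept : ∀ n, (!decide (∀ i < (initialWord ω n).length + 1,
      decide (∀ j < (initialWord ω n).length + 1,
        (!f ((a, (initialWord ω n).take i), j)) = true) = true)) = true ↔
      ∃ i ≤ n, ∃ j ≤ n, f ((a, initialWord ω i), j) = true := fun n => by
    simp only [length_initialWord, Order.lt_add_one_iff, Bool.not_eq_eq_eq_not, Bool.not_true,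
      decide_eq_true_eq, decide_eq_false_iff_not, not_forall, exists_prop, Bool.not_eq_false]
    refine exists_congr fun i => and_congr_right fun hi => ?_
    rw [take_initialWord ω hi]
  simp only [hfQ, haccept]
  exact ⟨fun ⟨n, j, h⟩ => ⟨max n j, n, le_max_left n j, j, le_max_right n j, h⟩,
    fun ⟨_, i, _, j, _, h⟩ => ⟨i, j, h⟩⟩

theorem exists_prefixFree_of_computable {A : α × List Bool → Bool} (hA : Computable A) :
    ∃ P : α × List Bool → Prop, REPred P ∧
      (∀ a v w, P (a, v) → P (a, w) → v <+: w → v = w) ∧ ∀ a (ω : ℕ → Bool),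
        (∃ n, A (a, initialWord ω n) = true) ↔ ∃ n, P (a, initialWord ω n) := by
  refine ⟨fun q => A q = true ∧ ∀ i < q.2.length, A (q.1, q.2.take i) = false, ?_, ?_, ?_⟩
  · exact rePred_and (rePred_eq_true hA) (rePred_forall_lt
      (p := fun r : (α × List Bool) × ℕ => A (r.1.1, r.1.2.take r.2) = false) (by fun_prop)
      (rePred_eq (by fun_prop) (by fun_prop)))
  · rintro a v w ⟨hv, -⟩ ⟨-, hw⟩ hvw
    by_contra hne
    have hlt : v.length < w.length := hvw.length_le.lt_of_ne fun h => hne (hvw.eq_of_length h)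
    have hfalse : A (a, w.take v.length) = false := hw v.length hlt
    rw [← List.prefix_iff_eq_take.1 hvw, hv] at hfalse
    exact Bool.noConfusion hfalse
  · refine fun a ω => ⟨fun hex => ?_, fun ⟨n, hn, _⟩ => ⟨n, hn⟩⟩
    classical
    refine ⟨Nat.find hex, Nat.find_spec hex, fun i hi => ?_⟩
    have hi : i < Nat.find hex := by simpa only [length_initialWord] using hi
    rw [take_initialWord ω hi.le]
    simpa using Nat.find_min hex hi

theorem exists_prefixFree_of_rePred {R : α × ℕ → Prop} (hR : REPred R) :
    ∃ P : α × List Bool → Prop, REPred P ∧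
      (∀ a v w, P (a, v) → P (a, w) → v <+: w → v = w) ∧ ∀ a (ω : ℕ → Bool),
        ω ∈ ballUnion cantorIdeal (fun k => R (a, k)) ↔ ∃ n, P (a, initialWord ω n) := by
  obtain ⟨Q, hQ, hQR⟩ := exists_rePred_words hR
  obtain ⟨A, hA, hAQ⟩ := exists_computable_words_of_rePred hQ
  obtain ⟨P, hP, hfree, hPA⟩ := exists_prefixFree_of_computable hA
  exact ⟨P, hP, hfree, fun a ω => (hQR a ω).trans ((hAQ a ω).trans (hPA a ω))⟩

end PrefixFree

section CylinderMeasure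

variable {ν : ProbabilityMeasure (ℕ → Bool)}

theorem IsComputableMeasure.rePred_lt_measureReal_biUnion (hν : IsComputableMeasure cantorIdeal ν) :
    REPred fun p : List (List Bool) × ℚ =>
      (p.2 : ℝ) < (ν : Measure (ℕ → Bool)).real (⋃ w ∈ p.1, wordCylinder w) := by
  obtain ⟨code, hcode, hball⟩ := exists_computable_idealBall_eq_wordCylinder
  have hmap := computable_map_range (n := fun p : List (List Bool) × ℚ => p.1.length)
    (f := fun r => code (r.1.1[r.2]?.getD [])) (by fun_prop) (by fun_prop)
  refine (rePred_comp (hν.rePred_lt_measureReal_shrunkBalls semidecidableDistLT_cantorIdeal)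
    (hmap.pair (show Computable fun p : List (List Bool) × ℚ => (p.2, (0 : ℚ)) by
      fun_prop))).of_eq fun p => ?_
  have hcodes : (List.range p.1.length).map (fun i => code (p.1[i]?.getD [])) = p.1.map code :=
    List.ext_getElem (by simp) (by simp +contextual)
  have hunion : shrunkBalls cantorIdeal (p.1.map code) 0 = ⋃ w ∈ p.1, wordCylinder w := by
    ext ω
    simp [shrunkBalls, ← hball, mem_idealBall]
  rw [hcodes, hunion]

theorem IsComputableMeasure.rePred_lt_measureReal_wordCylinder
    (hν : IsComputableMeasure cantorIdeal ν) : REPred fun p : List Bool × ℚ =>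
      (p.2 : ℝ) < (ν : Measure (ℕ → Bool)).real (wordCylinder p.1) :=
  (rePred_comp hν.rePred_lt_measureReal_biUnion
    (f := fun p : List Bool × ℚ => ([p.1], p.2)) (by fun_prop)).of_eq fun p => by
      simp

/-- The complement of a cylinder is the union of the other cylinders of the same length. -/
theorem IsComputableMeasure.rePred_measureReal_wordCylinder_lt
    (hν : IsComputableMeasure cantorIdeal ν) : REPred fun p : List Bool × ℚ =>
      (ν : Measure (ℕ → Bool)).real (wordCylinder p.1) < (p.2 : ℝ) := by
  have hre : REPred fun r : (List Bool × ℚ) × List (List Bool) =>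
      (∀ v ∈ r.2, v.length = r.1.1.length ∧ v ≠ r.1.1) ∧
        ((1 - r.1.2 : ℚ) : ℝ) < (ν : Measure (ℕ → Bool)).real (⋃ w ∈ r.2, wordCylinder w) :=
    rePred_and (rePred_forall_mem (l := fun r : (List Bool × ℚ) × List (List Bool) => r.2)
      (p := fun r : ((List Bool × ℚ) × List (List Bool)) × List Bool =>
        r.2.length = r.1.1.1.length ∧ r.2 ≠ r.1.1.1) (by fun_prop)
      (rePred_and (rePred_eq (by fun_prop) (by fun_prop))
        (rePred_ne (by fun_prop) (by fun_prop))))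
      (rePred_comp hν.rePred_lt_measureReal_biUnion
        (f := fun r : (List Bool × ℚ) × List (List Bool) => (r.2, 1 - r.1.2)) (by fun_prop))
  refine (rePred_exists hre).of_eq fun ⟨w, q⟩ => ?_
  have hcompl := probReal_compl_eq_one_sub (μ := (ν : Measure (ℕ → Bool)))
    (measurableSet_wordCylinder w)
  push_cast
  constructor
  · rintro ⟨l, hl, hlt⟩
    have hsub : ⋃ v ∈ l, wordCylinder v ⊆ (wordCylinder w)ᶜ := by
      refine Set.iUnion₂_subset fun v hv ω hωv hωw => (hl v hv).2 ?_
      rw [← mem_wordCylinder.1 hωv, (hl v hv).1, mem_wordCylinder.1 hωw]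
    linarith [measureReal_mono (μ := (ν : Measure (ℕ → Bool))) hsub]
  · intro hlt
    obtain ⟨l, hl, hcover⟩ := exists_list_compl_wordCylinder w
    refine ⟨l, hl, ?_⟩
    rw [← hcover, hcompl]
    linarith

end CylinderMeasure

/-! ### Complexity -/

section Complexity

variable {U : List Bool →. List Bool}

theorem rePred_mem_of_partrec {α β : Type*} [Primcodable α] [Primcodable β] {f : α →. β}
    (hf : Partrec f) : REPred fun q : α × β => q.2 ∈ f q.1 := by
  classical
  have hguard : Partrec fun q : α × β => (f q.1).bind fun b =>
      ((bif decide (b = q.2) then some () else Option.none : Option Unit) : Part Unit) := by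
    refine Partrec.bind (hf.comp Computable.fst) (Computable.ofOption ?_)
    exact Computable.cond (computable_decide_eq (by fun_prop) (by fun_prop)) (by fun_prop)
      (by fun_prop)
  refine hguard.dom_re.of_eq fun q => ?_
  simp only [Part.dom_iff_mem, Part.mem_bind_iff, Part.mem_ofOption, Option.mem_def]
  constructor
  · rintro ⟨u, b, hb, hu⟩
    by_cases hbq : b = q.2
    · exact hbq ▸ hb
    · simp [hbq] at hu
  · exact fun hq => ⟨(), q.2, hq, by simp⟩

theorem complexity_le_length {p w : List Bool} (hw : w ∈ U p) : complexity U w ≤ p.length :=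
  Nat.sInf_le ⟨p, hw, rfl⟩

theorem IsUniversalPrefixMachine.exists_complexity_le (hU : IsUniversalPrefixMachine U)
    {α : Type*} [Primcodable α] {p : α → Prop} (hp : REPred p)
    {out : α → List Bool} {len : α → ℕ} (hout : Computable out) (hlen : Computable len)
    (hsum : ∑' a : {a // p a}, (1 / 2 : ℝ≥0∞) ^ len a ≤ 1) :
    ∃ c : ℕ, ∀ a, p a → (∃ q, out a ∈ U q) ∧ complexity U (out a) ≤ len a + c := by
  obtain ⟨M, hM, hserve⟩ := exists_prefixMachine_of_requests hp hout hlen hsum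
  obtain ⟨c, hc⟩ := hU.2 M hM
  refine ⟨c + 1, fun a ha => ?_⟩
  obtain ⟨q, hq, hql⟩ := hserve a ha
  obtain ⟨r, hr, hrl⟩ := hc q _ hq
  exact ⟨⟨r, hr⟩, (complexity_le_length hr).trans (by omega)⟩

theorem IsUniversalPrefixMachine.exists_program (hU : IsUniversalPrefixMachine U)
    (w : List Bool) : ∃ p, w ∈ U p ∧ p.length = complexity U w := by
  have hsum : ∑' _ : {v : List Bool // v = w}, (1 / 2 : ℝ≥0∞) ^ 0 ≤ 1 :=
    ((tsum_singleton w fun _ => (1 / 2 : ℝ≥0∞) ^ 0).trans (pow_zero _)).le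
  obtain ⟨c, hc⟩ := hU.exists_complexity_le (out := fun v => v) (len := fun _ => 0)
    (rePred_eq (by fun_prop) (by fun_prop)) (by fun_prop) (by fun_prop) hsum
  obtain ⟨q, hq⟩ := (hc w rfl).1
  exact Nat.sInf_mem (s := {k | ∃ p, w ∈ U p ∧ p.length = k}) ⟨q.length, q, hq, rfl⟩

end Complexity

section Logarithm

theorem log2_zero : log2 0 = ⊥ := by
  rw [log2, ENNReal.log_zero, EReal.bot_div_of_pos_ne_top _ (EReal.coe_ne_top _)]
  exact_mod_cast Real.log_pos one_lt_two

theorem log2_top : log2 ∞ = ⊤ := by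
  rw [log2, ENNReal.log_top, EReal.top_div_of_pos_ne_top _ (EReal.coe_ne_top _)]
  exact_mod_cast Real.log_pos one_lt_two

theorem log2_ofReal {r : ℝ} (hr : 0 < r) :
    log2 (ENNReal.ofReal r) = ((Real.logb 2 r : ℝ) : EReal) := by
  rw [log2, ENNReal.log_ofReal_of_pos hr, Real.logb, EReal.coe_div]

theorem ofReal_half_pow (n : ℕ) : ENNReal.ofReal ((1 / 2) ^ n) = (1 / 2) ^ n := by
  rw [ENNReal.ofReal_pow (by norm_num), one_div, ENNReal.ofReal_inv_of_pos two_pos,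
    ENNReal.ofReal_ofNat, one_div]

theorem neg_log2_sub_le_iff (a : ℝ≥0∞) (c n : ℕ) :
    -log2 a - ((c : ℝ) : EReal) ≤ (n : EReal) ↔ (1 / 2 : ℝ≥0∞) ^ (n + c) ≤ a := by
  have hn : (n : EReal) = ((n : ℝ) : EReal) := rfl
  rcases eq_or_ne a ∞ with rfl | hatop
  · simp [log2_top]
  obtain ⟨r, hr, rfl⟩ : ∃ r : ℝ, 0 ≤ r ∧ a = ENNReal.ofReal r :=
    ⟨a.toReal, ENNReal.toReal_nonneg, (ENNReal.ofReal_toReal hatop).symm⟩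
  rcases hr.eq_or_lt with rfl | hr
  · rw [ENNReal.ofReal_zero, log2_zero, EReal.neg_bot, EReal.top_sub_coe, hn]
    simp only [top_le_iff, EReal.coe_ne_top, false_iff, not_le]
    exact ENNReal.pow_pos (by simp) _
  · rw [← ofReal_half_pow, ENNReal.ofReal_le_ofReal_iff hr.le, log2_ofReal hr, hn,
      ← EReal.coe_neg, ← EReal.coe_sub, EReal.coe_le_coe_iff,
      ← Real.logb_le_logb one_lt_two (by positivity) hr, Real.logb_pow, one_div,
      Real.logb_inv, Real.logb_self_eq_one one_lt_two]
    push_cast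
    constructor <;> intro h <;> linarith

end Logarithm

section HalfPow

theorem half_pow_le_half_pow_iff {i j : ℕ} :
    (1 / 2 : ℝ≥0∞) ^ i ≤ (1 / 2) ^ j ↔ j ≤ i := by
  rw [← ofReal_half_pow, ← ofReal_half_pow, ENNReal.ofReal_le_ofReal_iff (by positivity)]
  exact pow_le_pow_iff_right_of_lt_one₀ (by norm_num) (by norm_num)

theorem half_pow_lt_half_pow_iff {i j : ℕ} :
    (1 / 2 : ℝ≥0∞) ^ i < (1 / 2) ^ j ↔ j < i := by
  rw [← not_le, half_pow_le_half_pow_iff, not_le]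

theorem half_pow_add_lt_iff {a : ℝ≥0∞} {l m : ℕ} :
    (1 / 2 : ℝ≥0∞) ^ (l + m) < a ↔ (1 / 2 : ℝ≥0∞) ^ l < 2 ^ m * a := by
  rw [pow_add, one_div, ← ENNReal.inv_pow (n := m), ← div_eq_mul_inv,
    ENNReal.div_lt_iff (by simp) (by simp), mul_comm]

theorem exists_half_pow_lt_and_le {a : ℝ≥0∞} {k m : ℕ} (hk : (1 / 2) ^ k ≤ a)
    (hm : a ≤ (1 / 2) ^ m) : ∃ l : ℕ, (1 / 2) ^ (l + 1 + m) < a ∧ a ≤ (1 / 2) ^ (l + m) := by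
  classical
  have hex : ∃ l : ℕ, (1 / 2) ^ (l + 1 + m) < a :=
    ⟨k, (half_pow_lt_half_pow_iff.2 (by omega)).trans_le hk⟩
  refine ⟨Nat.find hex, Nat.find_spec hex, ?_⟩
  rcases hfind : Nat.find hex with _ | l
  · simpa using hm
  · exact not_lt.1 (Nat.find_min hex (m := l) (by omega))

theorem tsum_half_pow_tail_le (k : ℕ) :
    ∑' l : {l : ℕ // k ≤ l}, (1 / 2 : ℝ≥0∞) ^ (l : ℕ) ≤ 2 * (1 / 2) ^ k := by
  have hsurj : Function.Surjective fun i : ℕ => (⟨i + k, k.le_add_left i⟩ : {l : ℕ // k ≤ l}) :=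
    fun l => ⟨l - k, Subtype.ext (Nat.sub_add_cancel l.2)⟩
  refine (ENNReal.tsum_le_tsum_comp_of_surjective hsurj fun l => (1 / 2) ^ (l : ℕ)).trans_eq ?_
  simp only [pow_add, ENNReal.tsum_mul_right]
  rw [ENNReal.tsum_geometric, one_div, ENNReal.one_sub_inv_two, inv_inv]

theorem tsum_half_pow_lt_le (a : ℝ≥0∞) :
    ∑' l : {l : ℕ // (1 / 2 : ℝ≥0∞) ^ l < a}, (1 / 2 : ℝ≥0∞) ^ (l : ℕ) ≤ 2 * a := by
  classical
  by_cases hex : ∃ l : ℕ, (1 / 2 : ℝ≥0∞) ^ l < a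
  · calc ∑' l : {l : ℕ // (1 / 2 : ℝ≥0∞) ^ l < a}, (1 / 2 : ℝ≥0∞) ^ (l : ℕ)
        ≤ ∑' l : {l : ℕ // Nat.find hex ≤ l}, (1 / 2 : ℝ≥0∞) ^ (l : ℕ) :=
          ENNReal.tsum_mono_subtype (fun l : ℕ => (1 / 2 : ℝ≥0∞) ^ l)
            fun l hl => Nat.find_min' hex hl
      _ ≤ 2 * (1 / 2) ^ Nat.find hex := tsum_half_pow_tail_le _
      _ ≤ 2 * a := by
          gcongr
          exact (Nat.find_spec hex).le
  · have : IsEmpty {l : ℕ // (1 / 2 : ℝ≥0∞) ^ l < a} := ⟨fun l => hex ⟨l, l.2⟩⟩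
    simp

end HalfPow

section ComputableMeasureHalfPow

variable {ν : ProbabilityMeasure (ℕ → Bool)}

theorem IsComputableMeasure.rePred_half_pow_lt_wordCylinder
    (hν : IsComputableMeasure cantorIdeal ν) : REPred fun q : List Bool × ℕ =>
      (1 / 2 : ℝ≥0∞) ^ q.2 < (ν : Measure (ℕ → Bool)) (wordCylinder q.1) :=
  (rePred_comp hν.rePred_lt_measureReal_wordCylinder
    (f := fun q : List Bool × ℕ => (q.1, (1 / 2 : ℚ) ^ q.2)) (by fun_prop)).of_eq fun q => by
      rw [← ofReal_half_pow, ENNReal.ofReal_lt_iff_lt_toReal (by positivity) (measure_ne_top _ _)]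
      push_cast
      rfl

theorem IsComputableMeasure.rePred_wordCylinder_lt_half_pow
    (hν : IsComputableMeasure cantorIdeal ν) : REPred fun q : List Bool × ℕ =>
      (ν : Measure (ℕ → Bool)) (wordCylinder q.1) < (1 / 2 : ℝ≥0∞) ^ q.2 :=
  (rePred_comp hν.rePred_measureReal_wordCylinder_lt
    (f := fun q : List Bool × ℕ => (q.1, (1 / 2 : ℚ) ^ q.2)) (by fun_prop)).of_eq fun q => by
      rw [← ofReal_half_pow, ENNReal.lt_ofReal_iff_toReal_lt (measure_ne_top _ _)]
      push_cast
      rfl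

end ComputableMeasureHalfPow

/-! ### Complexity at random points -/

section RandomPoints

variable {X : Type*} [MetricSpace X] [MeasurableSpace X] [BorelSpace X] {s : ℕ → X}
  {μ : ProbabilityMeasure X} {U : List Bool →. List Bool}

theorem lintegral_tsum_program_indicator_le_one {Y : Type*} [MeasurableSpace Y] {ν : Measure Y}
    (hU : IsPrefixMachine U) {V : List Bool → Set Y} (hV : ∀ w, MeasurableSet (V w))
    {a : List Bool → ℝ≥0∞} (hle : ∀ w, ν (V w) ≤ a w) :
    ∫⁻ y, ∑' p : U.Dom, (V ((U p).get p.2)).indicator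
      (fun _ => (1 / 2) ^ p.1.length * (a ((U p).get p.2))⁻¹) y ∂ν ≤ 1 := by
  rw [lintegral_tsum fun p => (measurable_const.indicator (hV _)).aemeasurable]
  refine (ENNReal.tsum_le_tsum fun p => ?_).trans (tsum_two_pow_neg_length_le_one hU.2)
  rw [lintegral_indicator_const (hV _), mul_assoc]
  refine mul_le_of_le_one_right' ((mul_le_mul_right (hle _) _).trans ?_)
  rw [mul_comm]
  exact ENNReal.mul_inv_le_one _

/-- The test sums, over the programs `p`, the indicator of the set attached to the output `w` of
`p`, with weight `2⁻ˡ / a w` for `l` the length of `p`. -/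
theorem IsRandom.exists_half_pow_complexity_le (hU : IsUniversalPrefixMachine U) {x : X}
    (hx : IsRandom s μ x) {R : List Bool × ℕ → Prop} (hR : REPred R) {a : List Bool → ℝ≥0∞}
    (ha : REPred fun q : List Bool × ℕ => a q.1 < (1 / 2) ^ q.2)
    (hle : ∀ w, (μ : Measure X) (ballUnion s fun k => R (w, k)) ≤ a w) :
    ∃ c : ℕ, ∀ w, (x ∈ ballUnion s fun k => R (w, k)) → (1 / 2) ^ (complexity U w + c) ≤ a w := by
  have hre : REPred fun r : (List Bool × List Bool × ℕ) × ℕ =>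
      (r.1.2.1 ∈ U r.1.1 ∧ a r.1.2.1 < (1 / 2) ^ r.1.2.2) ∧ R (r.1.2.1, r.2) :=
    rePred_and (rePred_and
      (rePred_comp (rePred_mem_of_partrec hU.1.1)
        (f := fun r : (List Bool × List Bool × ℕ) × ℕ => (r.1.1, r.1.2.1)) (by fun_prop))
      (rePred_comp ha (f := fun r : (List Bool × List Bool × ℕ) × ℕ => r.1.2) (by fun_prop)))
      (rePred_comp hR (f := fun r : (List Bool × List Bool × ℕ) × ℕ => (r.1.2.1, r.2))
        (by fun_prop))
  have hweight (p : List Bool) (j : ℕ) :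
      ENNReal.ofReal ((2 ^ j * (1 / 2) ^ p.length : ℚ) : ℝ) = (1 / 2) ^ p.length * 2 ^ j := by
    rw [mul_comm, Rat.cast_mul, ENNReal.ofReal_mul (by positivity)]
    push_cast
    rw [ofReal_half_pow, ENNReal.ofReal_pow two_pos.le, ENNReal.ofReal_ofNat]
  obtain ⟨M, hM, hbound⟩ := hx.exists_weight_le hre
    (g := fun a => 2 ^ a.2.2 * (1 / 2) ^ a.1.length) (by fun_prop) (fun a => by positivity)
    (lintegral_tsum_program_indicator_le_one hU.1
      (fun w => (isOpen_ballUnion s fun k => R (w, k)).measurableSet) hle) (by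
      rintro ⟨p, w, j⟩ y ⟨k, ⟨⟨hw, hj⟩, hk⟩, hy⟩
      dsimp only at hw hj hk ⊢
      have hp : p ∈ U.Dom := Part.dom_iff_mem.2 ⟨w, hw⟩
      have hyw : y ∈ ballUnion s fun k => R (w, k) := ⟨k, hk, hy⟩
      refine le_trans ?_ (ENNReal.le_tsum (⟨p, hp⟩ : U.Dom))
      rw [Part.get_eq_of_mem hw hp, Set.indicator_of_mem hyw, hweight]
      gcongr
      rw [ENNReal.le_inv_iff_le_inv, ENNReal.inv_pow]
      simpa using hj.le)
  obtain ⟨c, hc⟩ := ENNReal.exists_nat_gt hM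
  refine ⟨c, fun w ⟨k, hk, hxk⟩ => not_lt.1 fun hlt => hc.not_ge ?_⟩
  obtain ⟨p, hp, hpl⟩ := hU.exists_program w
  have hcM := hbound (p, w, complexity U w + c) ⟨k, ⟨⟨hp, hlt⟩, hk⟩, hxk⟩
  rw [hweight, hpl, pow_add, ← mul_assoc, ← mul_pow, one_div,
    ENNReal.inv_mul_cancel two_ne_zero ENNReal.ofNat_ne_top, one_pow, one_mul] at hcM
  exact le_trans (by exact_mod_cast Nat.lt_two_pow_self.le) hcM

end RandomPoints

/-! ### Superlevel sets of tests -/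

section Superlevel

variable {X : Type*} [MetricSpace X] [MeasurableSpace X] [BorelSpace X] {s : ℕ → X}
  {μ : ProbabilityMeasure X}

theorem IsRandomnessTest.exists_rePred_superlevel {t : X → ℝ≥0∞} (ht : IsRandomnessTest s μ t)
    (hμ : IsComputableMeasure s μ) : ∃ S : ℕ × ℕ → Prop, REPred S ∧
      ∀ m, (ballUnion s fun k => S (m, k)) = {y | 4 ^ m < t y} := by
  obtain ⟨T, hT, rfl⟩ := ht.exists_rePred hμ
  have hre : REPred fun r : (ℕ × ℕ) × ℕ => T (Nat.pair r.1.2 r.2) ∧ 4 ^ r.1.1 < posRatNum r.2 :=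
    rePred_and (rePred_comp hT (by fun_prop)) (rePred_rat_lt (by fun_prop) (by fun_prop))
  have hcast (m i : ℕ) : (4 : ℚ) ^ m < posRatNum i ↔
      (4 : ℝ≥0∞) ^ m < ENNReal.ofReal (posRatNum i : ℝ) := by
    have hfour : (4 : ℝ≥0∞) ^ m = ENNReal.ofReal (((4 : ℚ) ^ m : ℚ) : ℝ) := by
      push_cast
      rw [ENNReal.ofReal_pow (by norm_num), ENNReal.ofReal_ofNat]
    rw [hfour, ENNReal.ofReal_lt_ofReal_iff (by exact_mod_cast posRatNum_pos i), Rat.cast_lt]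
  refine ⟨_, rePred_exists hre, fun m => Set.ext fun y => ?_⟩
  rw [Set.mem_ofPred_eq]
  simp only [iSup_apply, lt_iSup_iff]
  constructor
  · rintro ⟨k, ⟨i, hi, hm⟩, hy⟩
    refine ⟨Nat.pair k i, hi, ?_⟩
    rw [stepFunction, Nat.unpair_pair, Set.indicator_of_mem hy]
    exact (hcast m i).1 hm
  · rintro ⟨k, hk, hlt⟩
    by_cases hy : y ∈ idealBall s k.unpair.1
    · rw [stepFunction, Set.indicator_of_mem hy] at hlt
      exact ⟨k.unpair.1, ⟨k.unpair.2, by rwa [Nat.pair_unpair], (hcast m _).2 hlt⟩, hy⟩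
    · rw [stepFunction, Set.indicator_of_notMem hy] at hlt
      exact absurd hlt not_lt_zero

theorem measure_superlevel_le_inv {Y : Type*} [MeasurableSpace Y] {ν : Measure Y} {t : Y → ℝ≥0∞}
    (ht : ∫⁻ y, t y ∂ν ≤ 1) {a : ℝ≥0∞} (ha : MeasurableSet {y | a < t y}) :
    ν {y | a < t y} ≤ a⁻¹ := by
  rw [ENNReal.le_inv_iff_mul_le, mul_comm]
  calc a * ν {y | a < t y} = ∫⁻ _ in {y | a < t y}, a ∂ν := (setLIntegral_const _ _).symm
    _ ≤ ∫⁻ y in {y | a < t y}, t y ∂ν := setLIntegral_mono' ha fun _ hy => le_of_lt hy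
    _ ≤ 1 := (setLIntegral_le_lintegral _ _).trans ht

end Superlevel

/-! ### Binary representations -/

namespace BinaryRepresentation

variable {X : Type*} [MetricSpace X] [MeasurableSpace X] [BorelSpace X] {s : ℕ → X}
  {μ : ProbabilityMeasure X} (δ : BinaryRepresentation s μ)

theorem expansion_mem_dom (x : X) : δ.expansion x ∈ δ.dom :=
  Function.invFunOn_mem (δ.surjective (Set.mem_univ x))

theorem toFun_expansion (x : X) : δ.toFun (δ.expansion x) = x :=
  Function.invFunOn_eq (δ.surjective (Set.mem_univ x))

theorem expansion_toFun {ω : ℕ → Bool} (hω : ω ∈ δ.dom) (hD : δ.toFun ω ∈ δ.D) :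
    δ.expansion (δ.toFun ω) = ω :=
  (δ.unique _ hD).unique ⟨δ.expansion_mem_dom _, δ.toFun_expansion _⟩ ⟨hω, rfl⟩

theorem measure_dom_inter (A : Set (ℕ → Bool)) :
    (δ.measure : Measure (ℕ → Bool)) (δ.dom ∩ A) = (δ.measure : Measure (ℕ → Bool)) A :=
  Measure.measure_inter_eq_of_ae
    ((mem_ae_iff_prob_eq_one δ.morphism.pi02.measurableSet).2 δ.morphism.full)

theorem measure_D_inter (A : Set X) : (μ : Measure X) (δ.D ∩ A) = (μ : Measure X) A :=
  Measure.measure_inter_eq_of_ae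
    ((mem_ae_iff_prob_eq_one δ.pi02_D.measurableSet).2 δ.full_D)

theorem exists_rePred_expansion (hX : IsComputableMetricSpace s) :
    ∃ R : List Bool × ℕ → Prop, REPred R ∧ ∀ w, ∀ x ∈ δ.D,
      δ.expansion x ∈ wordCylinder w ↔ x ∈ ballUnion s fun k => R (w, k) := by
  obtain ⟨code, hcode, hball⟩ := exists_computable_idealBall_eq_wordCylinder
  obtain ⟨R, hR, hpre⟩ := δ.inverse_computable.exists_rePred_preimage hX.semidecidableDistLT
    hX.dense semidecidableDistLT_cantorIdeal
  refine ⟨fun q => R (code q.1, q.2), rePred_comp hR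
    (f := fun q : List Bool × ℕ => (code q.1, q.2)) (by fun_prop), fun w x hx => ?_⟩
  rw [← hball]
  exact hpre (code w) x hx

theorem measure_le_of_expansion_mem {V : Set X} (hV : IsOpen V) {C : Set (ℕ → Bool)}
    (hVC : ∀ x ∈ δ.D, x ∈ V → δ.expansion x ∈ C) :
    (μ : Measure X) V ≤ (δ.measure : Measure (ℕ → Bool)) C := by
  rw [← δ.measure_D_inter, δ.morphism.preserving _
    (δ.pi02_D.measurableSet.inter hV.measurableSet)]
  refine measure_mono ?_
  rintro ω ⟨hω, hD, hωV⟩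
  rw [← δ.expansion_toFun hω hD]
  exact hVC _ hD hωV

theorem measure_cell (hX : IsComputableMetricSpace s) (x : X) (n : ℕ) :
    (μ : Measure X) (δ.cell x n) =
      (δ.measure : Measure (ℕ → Bool)) (wordCylinder (initialWord (δ.expansion x) n)) := by
  rw [cell, cylinder_eq_wordCylinder]
  refine le_antisymm ?_ ?_
  · obtain ⟨R, -, hR⟩ := δ.exists_rePred_expansion hX
    rw [← δ.measure_D_inter]
    refine (measure_mono ?_).trans (δ.measure_le_of_expansion_mem
      (isOpen_ballUnion s fun k => R (initialWord (δ.expansion x) n, k))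
      fun y hy => (hR _ y hy).2)
    rintro y ⟨hy, ω, ⟨hω, hωC⟩, rfl⟩
    rwa [← hR _ _ hy, δ.expansion_toFun hω hy]
  · rw [← measure_toMeasurable (μ := (μ : Measure X)),
      δ.morphism.preserving _ (measurableSet_toMeasurable _ _), ← δ.measure_dom_inter]
    exact measure_mono fun ω hω => ⟨hω.1, subset_toMeasurable _ _ ⟨ω, hω, rfl⟩⟩

theorem exists_half_pow_le_of_isRandom (hX : IsComputableProbabilitySpace s μ)
    {U : List Bool →. List Bool} (hU : IsUniversalPrefixMachine U) {x : X} (hx : IsRandom s μ x)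
    (hxD : x ∈ δ.D) : ∃ c : ℕ, ∀ n, (1 / 2 : ℝ≥0∞) ^ (δ.pointComplexity U x n + c) ≤
      (δ.measure : Measure (ℕ → Bool)) (wordCylinder (initialWord (δ.expansion x) n)) := by
  obtain ⟨R, hR, hRx⟩ := δ.exists_rePred_expansion hX.space
  obtain ⟨c, hc⟩ := hx.exists_half_pow_complexity_le hU hR
    δ.measure_computable.rePred_wordCylinder_lt_half_pow fun w =>
      δ.measure_le_of_expansion_mem (isOpen_ballUnion s fun k => R (w, k))
        fun y hy => (hRx w y hy).2
  exact ⟨c, fun n => hc _ ((hRx _ x hxD).1 (mem_wordCylinder_initialWord.2 fun _ _ => rfl))⟩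

section Preimage

variable {α : Type*} [Primcodable α] {S : α × ℕ → Prop}

theorem exists_rePred_preimage_ballUnion (hX : IsComputableMetricSpace s) (hS : REPred S) :
    ∃ W : α × ℕ → Prop, REPred W ∧ ∀ a, ∀ ω ∈ δ.dom,
      δ.toFun ω ∈ (ballUnion s fun k => S (a, k)) ↔
        ω ∈ ballUnion cantorIdeal fun j => W (a, j) := by
  obtain ⟨R, hR, hpre⟩ := δ.morphism.computable.exists_rePred_preimage
    semidecidableDistLT_cantorIdeal denseRange_cantorIdeal hX.semidecidableDistLT
  have hre : REPred fun r : (α × ℕ) × ℕ => S (r.1.1, r.2) ∧ R (r.2, r.1.2) :=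
    rePred_and (rePred_comp hS (f := fun r : (α × ℕ) × ℕ => (r.1.1, r.2)) (by fun_prop))
      (rePred_comp hR (f := fun r : (α × ℕ) × ℕ => (r.2, r.1.2)) (by fun_prop))
  refine ⟨_, rePred_exists hre, fun a ω hω => ⟨?_, ?_⟩⟩
  · rintro ⟨k, hk, hy⟩
    obtain ⟨j, hj, hωj⟩ := (hpre k ω hω).1 hy
    exact ⟨j, ⟨k, hk, hj⟩, hωj⟩
  · rintro ⟨j, ⟨k, hk, hj⟩, hωj⟩
    exact ⟨k, hk, (hpre k ω hω).2 ⟨j, hj, hωj⟩⟩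

theorem exists_prefixFree_of_ballUnion (hX : IsComputableMetricSpace s) (hS : REPred S) :
    ∃ P : α × List Bool → Prop, REPred P ∧
      (∀ a, ∑' w : {w // P (a, w)}, (δ.measure : Measure (ℕ → Bool)) (wordCylinder w) ≤
        (μ : Measure X) (ballUnion s fun k => S (a, k))) ∧
      ∀ a, ∀ x ∈ ballUnion s (fun k => S (a, k)), ∃ n, P (a, initialWord (δ.expansion x) n) := by
  obtain ⟨W, hW, hWS⟩ := δ.exists_rePred_preimage_ballUnion hX hS
  obtain ⟨P, hP, hfree, hPW⟩ := exists_prefixFree_of_rePred hW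
  refine ⟨P, hP, fun a => ?_, fun a x hx => (hPW a _).1 ((hWS a _ (δ.expansion_mem_dom x)).1 ?_)⟩
  · have hsub : ∀ w, P (a, w) → wordCylinder w ⊆ ballUnion cantorIdeal fun j => W (a, j) := by
      refine fun w hw ω hω => (hPW a ω).2 ⟨w.length, ?_⟩
      rwa [mem_wordCylinder.1 hω]
    refine (tsum_measure_wordCylinder_le (hfree a) hsub).trans ?_
    rw [← δ.measure_dom_inter,
      δ.morphism.preserving _ (isOpen_ballUnion s fun k => S (a, k)).measurableSet]
    exact measure_mono fun ω hω => ⟨hω.1, (hWS a ω hω.1).2 hω.2⟩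
  · rwa [δ.toFun_expansion]

end Preimage

theorem exists_words_of_isRandomnessTest (hX : IsComputableProbabilitySpace s μ)
    {t : X → ℝ≥0∞} (ht : IsRandomnessTest s μ t) :
    ∃ P : ℕ × List Bool → Prop, REPred P ∧
      (∀ m, ∑' w : {w // P (m, w)}, (δ.measure : Measure (ℕ → Bool)) (wordCylinder w) ≤
        (1 / 4) ^ m) ∧
      ∀ x, t x = ∞ → ∀ m, ∃ n, P (m, initialWord (δ.expansion x) n) := by
  obtain ⟨S, hS, hSt⟩ := ht.exists_rePred_superlevel hX.measure
  obtain ⟨P, hP, hsum, hcover⟩ := δ.exists_prefixFree_of_ballUnion hX.space hS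
  refine ⟨P, hP, fun m => (hsum m).trans ?_, fun x hx m => hcover m x ?_⟩
  · have hmeas : MeasurableSet {y | 4 ^ m < t y} := by
      rw [← hSt]
      exact (isOpen_ballUnion _ _).measurableSet
    rw [hSt, one_div, ← ENNReal.inv_pow]
    exact measure_superlevel_le_inv ht.2 hmeas
  · rw [hSt, Set.mem_ofPred_eq, hx]
    exact ENNReal.pow_lt_top (by simp)

end BinaryRepresentation

/-! ### Lower bounds on complexity imply randomness -/

section Requests

variable {β : Type*}

theorem tsum_subtype_prod {α : Type*} (r : α → β → Prop) (f : α → β → ℝ≥0∞) :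
    ∑' q : {q : α × β // r q.1 q.2}, f q.1.1 q.1.2 = ∑' a, ∑' b : {b // r a b}, f a b := by
  rw [← ENNReal.tsum_sigma, ← (Equiv.subtypeProdEquivSigmaSubtype r).tsum_eq]
  rfl

/-- A word of measure at most `4⁻ᵐ` can be given a code `m` bits shorter than its measure
suggests, since the total weight `2ᵐ 4⁻ᵐ` remains summable. -/
theorem tsum_half_pow_requests_le_one {P : ℕ × β → Prop} {a : β → ℝ≥0∞}
    (hP : ∀ m, ∑' b : {b // P (m, b)}, a b ≤ (1 / 4) ^ m) :
    ∑' q : {q : (ℕ × β) × ℕ // P (q.1.1 + 1, q.1.2) ∧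
      (1 / 2 : ℝ≥0∞) ^ (q.2 + q.1.1) < a q.1.2}, (1 / 2 : ℝ≥0∞) ^ q.1.2 ≤ 1 := by
  have hinner (m : ℕ) (b : β) : ∑' l : {l : ℕ // P (m + 1, b) ∧ (1 / 2) ^ (l + m) < a b},
      (1 / 2 : ℝ≥0∞) ^ (l : ℕ) ≤ {b | P (m + 1, b)}.indicator (fun b => 2 * (2 ^ m * a b)) b := by
    by_cases hb : P (m + 1, b)
    · rw [Set.indicator_of_mem (s := {b | P (m + 1, b)}) hb]
      exact (ENNReal.tsum_mono_subtype (fun l : ℕ => (1 / 2 : ℝ≥0∞) ^ l)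
        fun l hl => half_pow_add_lt_iff.1 hl.2).trans (tsum_half_pow_lt_le _)
    · simp [hb]
  have hfactor (m : ℕ) : (2 : ℝ≥0∞) * (2 ^ m * (1 / 4) ^ (m + 1)) = 2⁻¹ ^ (m + 1) := by
    rw [← mul_assoc, ← pow_succ', ← mul_pow, one_div, show (4 : ℝ≥0∞) = 2 * 2 by norm_num,
      ENNReal.mul_inv (by simp) (by simp), ← mul_assoc,
      ENNReal.mul_inv_cancel (by simp) (by simp), one_mul]
  calc _ = ∑' q : ℕ × β, ∑' l : {l : ℕ // P (q.1 + 1, q.2) ∧ (1 / 2) ^ (l + q.1) < a q.2},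
        (1 / 2 : ℝ≥0∞) ^ (l : ℕ) :=
      tsum_subtype_prod (fun (q : ℕ × β) l => P (q.1 + 1, q.2) ∧ (1 / 2) ^ (l + q.1) < a q.2)
        fun _ l => (1 / 2) ^ l
    _ = ∑' (m : ℕ) (b : β), ∑' l : {l : ℕ // P (m + 1, b) ∧ (1 / 2) ^ (l + m) < a b},
        (1 / 2 : ℝ≥0∞) ^ (l : ℕ) := ENNReal.tsum_prod'
    _ ≤ ∑' (m : ℕ) (b : β), {b | P (m + 1, b)}.indicator (fun b => 2 * (2 ^ m * a b)) b :=
      ENNReal.tsum_le_tsum fun m => ENNReal.tsum_le_tsum fun b => hinner m b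
    _ = ∑' m : ℕ, 2 * (2 ^ m * ∑' b : {b // P (m + 1, b)}, a b) := by
      refine tsum_congr fun m => ?_
      rw [← tsum_subtype, ENNReal.tsum_mul_left, ENNReal.tsum_mul_left]
      rfl
    _ ≤ ∑' m : ℕ, (2⁻¹ : ℝ≥0∞) ^ (m + 1) := by
      refine ENNReal.tsum_le_tsum fun m => ?_
      rw [← hfactor]
      gcongr
      exact hP (m + 1)
    _ = 1 := by
      rw [ENNReal.tsum_geometric_add_one, ENNReal.one_sub_inv_two, inv_inv,
        ENNReal.inv_mul_cancel (by simp) (by simp)]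

end Requests

namespace BinaryRepresentation

variable {X : Type*} [MetricSpace X] [MeasurableSpace X] [BorelSpace X] {s : ℕ → X}
  {μ : ProbabilityMeasure X} (δ : BinaryRepresentation s μ)

theorem isRandom_of_half_pow_le (hX : IsComputableProbabilitySpace s μ)
    {U : List Bool →. List Bool} (hU : IsUniversalPrefixMachine U) {x : X} {c : ℕ}
    (hc : ∀ n, (1 / 2 : ℝ≥0∞) ^ (δ.pointComplexity U x n + c) ≤
      (δ.measure : Measure (ℕ → Bool)) (wordCylinder (initialWord (δ.expansion x) n))) :
    IsRandom s μ x := by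
  rintro N ⟨t, ht, hN⟩ hxN
  obtain ⟨P, hP, hsum, hcover⟩ := δ.exists_words_of_isRandomnessTest hX ht
  have hre : REPred fun q : (ℕ × List Bool) × ℕ => P (q.1.1 + 1, q.1.2) ∧
      (1 / 2 : ℝ≥0∞) ^ (q.2 + q.1.1) <
        (δ.measure : Measure (ℕ → Bool)) (wordCylinder q.1.2) :=
    rePred_and (rePred_comp hP (f := fun q : (ℕ × List Bool) × ℕ => (q.1.1 + 1, q.1.2))
        (by fun_prop))
      (rePred_comp δ.measure_computable.rePred_half_pow_lt_wordCylinder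
        (f := fun q : (ℕ × List Bool) × ℕ => (q.1.2, q.2 + q.1.1)) (by fun_prop))
  obtain ⟨d, hd⟩ := hU.exists_complexity_le hre (out := fun q => q.1.2) (len := fun q => q.2)
    (by fun_prop) (by fun_prop) (tsum_half_pow_requests_le_one (P := P)
      (a := fun w => (δ.measure : Measure (ℕ → Bool)) (wordCylinder w)) hsum)
  obtain ⟨n, hn⟩ := hcover x (hN hxN) (c + d + 2 + 1)
  have hsmall : (δ.measure : Measure (ℕ → Bool))
      (wordCylinder (initialWord (δ.expansion x) n)) ≤ (1 / 2) ^ (c + d + 2) := calc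
    _ ≤ _ := ENNReal.le_tsum (f := fun w : {w // P (c + d + 2 + 1, w)} =>
      (δ.measure : Measure (ℕ → Bool)) (wordCylinder w)) ⟨_, hn⟩
    _ ≤ (1 / 4) ^ (c + d + 2 + 1) := hsum _
    _ ≤ (1 / 2) ^ (c + d + 2 + 1) := by gcongr; norm_num
    _ ≤ (1 / 2) ^ (c + d + 2) := half_pow_le_half_pow_iff.2 (Nat.le_succ _)
  obtain ⟨l, hlt, hle⟩ := exists_half_pow_lt_and_le (hc n) hsmall
  have hlong : l + (c + d + 2) ≤ δ.pointComplexity U x n + c :=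
    half_pow_le_half_pow_iff.1 ((hc n).trans hle)
  have hshort : δ.pointComplexity U x n ≤ l + 1 + d := (hd ((c + d + 2, _), l + 1) ⟨hn, hlt⟩).2
  omega

end BinaryRepresentation

end

theorem mainTheorem6 {X : Type*} [MetricSpace X] [MeasurableSpace X] [BorelSpace X]
    (s : ℕ → X) (μ : ProbabilityMeasure X) (hX : IsComputableProbabilitySpace s μ)
    (δ : BinaryRepresentation s μ)
    (U : List Bool →. List Bool) (hU : IsUniversalPrefixMachine U) (x : X) :
    IsRandom s μ x ↔
      x ∈ δ.D ∧ ∃ c : ℝ, ∀ n : ℕ,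
        -log2 ((μ : Measure X) (δ.cell x n)) - (c : EReal) ≤ (δ.pointComplexity U x n : EReal) := by
  constructor
  · intro hx
    have hxD : x ∈ δ.D := hx.mem_of_isPi02 hX δ.pi02_D δ.full_D
    obtain ⟨c, hc⟩ := δ.exists_half_pow_le_of_isRandom hX hU hx hxD
    refine ⟨hxD, c, fun n => ?_⟩
    rw [neg_log2_sub_le_iff, δ.measure_cell hX.space]
    exact hc n
  · rintro ⟨-, c, hc⟩
    obtain ⟨N, hN⟩ := exists_nat_ge c
    refine δ.isRandom_of_half_pow_le hX hU (c := N) fun n => ?_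
    rw [← δ.measure_cell hX.space, ← neg_log2_sub_le_iff]
    exact (EReal.sub_le_sub le_rfl (by exact_mod_cast hN)).trans (hc n)
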